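/- Let $D$ be the open unit disk in $\mathbb{C}$, $T$ the unit circle, $dm$ arc length on $T$ and $dm_2$ area measure on $D$. For $f(z)=\sum_{n\ge0}a_nz^n$ holomorphic in $D$ and $k\in\mathbb{R}$ put $D^kf(z)=\sum_{n\ge0}(n+1)^ka_nz^n$. Let $1\le s\le 2$, $q=2s-1$, $\tau=2(1-1/s)$, and let $k>\tau$ be real. Let $B^s_\tau$ be the space of all holomorphic $f$ in $D$ with $$\|f\|_{B^s_\tau}^s=\int_D|D^kf(z)|^s(1-|z|)^{sk+1-2s}\,dm_2(z)<\infty,$$ and let $BMOA_{s,q}(D)$ be the space of all $f$ in the Hardy space $H^s(D)$ with $$\|f\|_{BMOA_{s,q}}=\sup_{z\in D}\left((1-|z|^2)\int_T\frac{|f(\xi)-f(z)|^s}{|1-\xi\bar z|^q}\,dm(\xi)\right)^{1/s}<\infty,$$ where $f(\xi)$, $\xi\in T$, denotes the radial boundary value. Let $\varphi\in H^1(D)$, and for $f\in B^s_\tau$ with $f\bar\varphi\in L^1(T)$ let $$(T_{\bar\varphi}f)(z)=\frac1{2\pi}\int_T\frac{f(\xi)\overline{\varphi(\xi)}}{1-\bar\xi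 z}\,dm(\xi),\qquad z\in D.$$ Call $T_{\bar\varphi}$ bounded from $B^s_\tau$ to $BMOA_{s,q}(D)$ if there is a constant $C$ such that $T_{\bar\varphi}f\in BMOA_{s,q}(D)$ and $\|T_{\bar\varphi}f\|_{BMOA_{s,q}}\le C\|f\|_{B^s_\tau}$ for every $f\in B^s_\tau$ with $f\bar\varphi\in L^1(T)$. If $1<s\le2$, then $T_{\bar\varphi}$ is bounded from $B^s_\tau$ to $BMOA_{s,q}(D)$ if and only if $\varphi\in H^\infty(D)$; moreover, if $\varphi\in H^\infty(D)$ then $f\bar\varphi\in L^1(T)$ for every $f\in B^s_\tau$, so that $T_{\bar\varphi}$ is defined on all of $B^s_\tau$. If $s=1$ and $T_{\bar\varphi}$ is bounded from $B^1_0$ to $BMOA_{1,1}(D)$, then $\varphi\in H^\infty(D)$. -/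

import Mathlib

open Real Set Filter Topology MeasureTheory
open scoped ENNReal NNReal ComplexConjugate

noncomputable section

namespace BergmanBesov

/-- The open unit disk. -/
def unitDisk : Set ℂ := Metric.ball 0 1

/-- Holomorphic functions on the unit disk (values outside the disk are irrelevant). -/
def Holo (f : ℂ → ℂ) : Prop := DifferentiableOn ℂ f unitDisk

/-- The `n`-th Taylor coefficient of `f` at the origin. -/
def coeff (f : ℂ → ℂ) (n : ℕ) : ℂ := iteratedDeriv n f 0 / (Nat.factorial n : ℂ)

/-- The fractional derivative `D^α f (z) = ∑ (n+1)^α a_n z^n`, where `f (z) = ∑ a_n z^n`. -/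
def fracDeriv (α : ℝ) (f : ℂ → ℂ) (z : ℂ) : ℂ :=
  ∑' n : ℕ, ((((n : ℝ) + 1) ^ α : ℝ) : ℂ) * coeff f n * z ^ n

/-- The point `e^{iθ}` of the unit circle. -/
def circ (θ : ℝ) : ℂ := Complex.exp (θ * Complex.I)

/-- Arc length measure `dm` on the unit circle, in the coordinate `θ ∈ (0, 2π]`. -/
def arc : Measure ℝ := volume.restrict (Ioc 0 (2 * π))

/-- The Hardy space `H^p`, `0 < p < ∞`. -/
def MemHardy (p : ℝ) (f : ℂ → ℂ) : Prop :=
  Holo f ∧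
    (⨆ r ∈ Ioo (0 : ℝ) 1, ∫⁻ θ, ENNReal.ofReal (‖f ((r : ℂ) * circ θ)‖ ^ p) ∂arc) < ∞

/-- The space `H^∞` of bounded holomorphic functions. -/
def MemHardyInf (f : ℂ → ℂ) : Prop :=
  Holo f ∧ ∃ M : ℝ, ∀ z ∈ unitDisk, ‖f z‖ ≤ M

/-- The boundary function: the radial limit of `f` at the boundary point `e^{iθ}`
(it exists for almost every `θ` when `f` is in a Hardy space). -/
def bdry (f : ℂ → ℂ) (θ : ℝ) : ℂ :=
  limUnder (𝓝[<] (1 : ℝ)) (fun r : ℝ => f ((r : ℂ) * circ θ))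

/-- The quasinorm of the Bergman–Besov space `B^s_τ`, `τ = 2 (1 - 1/s)`, computed with the
derivative of order `k`. -/
def besovNorm (s k : ℝ) (f : ℂ → ℂ) : ℝ≥0∞ :=
  (∫⁻ z in unitDisk,
    ENNReal.ofReal (‖fracDeriv k f z‖ ^ s * (1 - ‖z‖) ^ (s * k + 1 - 2 * s))) ^ (1 / s)

/-- The Bergman–Besov space `B^s_τ`, `τ = 2 (1 - 1/s)`. -/
def MemBesov (s k : ℝ) (f : ℂ → ℂ) : Prop := Holo f ∧ besovNorm s k f < ∞

/-- The (semi)norm of `BMOA_{s,q}`. -/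
def bmoaNorm (s q : ℝ) (f : ℂ → ℂ) : ℝ≥0∞ :=
  ⨆ z ∈ unitDisk,
    ((∫⁻ θ, ENNReal.ofReal (‖bdry f θ - f z‖ ^ s / ‖1 - circ θ * conj z‖ ^ q) ∂arc)
      * ENNReal.ofReal (1 - ‖z‖ ^ 2)) ^ (1 / s)

/-- The space `BMOA_{s,q}`. -/
def MemBMOA (s q : ℝ) (f : ℂ → ℂ) : Prop := MemHardy s f ∧ bmoaNorm s q f < ∞

/-- `f` is in the natural domain of `T_h`: the product of `h` and the boundary function of `f`
is integrable on the circle. -/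
def InToeplitzDomain (h : ℝ → ℂ) (f : ℂ → ℂ) : Prop :=
  Integrable (fun θ => bdry f θ * h θ) arc

/-- The Toeplitz operator
`(T_h f)(z) = (1 / 2π) ∫_T f(ξ) h(ξ) / (1 - conj ξ * z) dm(ξ)`. -/
def toeplitz (h : ℝ → ℂ) (f : ℂ → ℂ) (z : ℂ) : ℂ :=
  (1 / (2 * π) : ℂ) * ∫ θ, bdry f θ * h θ / (1 - conj (circ θ) * z) ∂arc

/-- The symbol `conj φ` on the circle, for a holomorphic function `φ` on the disk. -/
def conjSymbol (φ : ℂ → ℂ) (θ : ℝ) : ℂ := conj (bdry φ θ)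

/-- `T_h` is bounded, on its natural domain, from `B^s_τ` to `BMOA_{s,q}`. -/
def ToeplitzBounded (s k q : ℝ) (h : ℝ → ℂ) : Prop :=
  ∃ C : ℝ≥0, ∀ f : ℂ → ℂ, MemBesov s k f → InToeplitzDomain h f →
    MemBMOA s q (toeplitz h f) ∧ bmoaNorm s q (toeplitz h f) ≤ C * besovNorm s k f

end BergmanBesov

end

noncomputable section

namespace BergmanBesov

/-! ### The circle -/

/-! Sufficiency (`1 < s ≤ 2`). A Besov function is a superposition of Szegő kernels: `π Γ(k) f(z)`
is the area integral of `D^k f(w) (-2 log |w|)^(k-1) / (1 - z conj w)` (`areaCauchy_besovDensity`),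
because the radial Gamma integral undoes the factor `(n+1)^k`. The density is at most `g(w)
((1-|w|)/|w|)^(1-1/s)`, where the `L^s` norm of `g` is comparable to the Besov norm. The operator
with symbol `conj φ` sends the Szegő kernel at `w` to `conj (φ w)` times itself, so it merely
multiplies the density by `conj φ` (`toeplitz_conjSymbol_eq`); a bounded `φ` preserves the
domination. It remains to see that Cauchy-type area integrals of dominated densities lie in
`BMOA_{s,2s-1}` (`exists_lintegral_areaCauchy_sub_le`). This follows from the difference formula for
two Cauchy kernels, a Schur-type test (`lintegral_rpow_lintegral_mul_le`), and the size of integrals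
of powers of `|1 - ξ conj w|` over the circle and the disk.

Necessity (`1 ≤ s ≤ 2`). The test functions are `f_w(z) = (1 - conj w z)^(-2)`, with `‖f_w‖^s ≲
(1-|w|)^(3-4s)` (`exists_besovNorm_szegoSq_le`). Their images combine the Szegő kernel at `w` and
its square, with coefficients `conj (w φ'(w))` and `conj (φ w)`. Pairing the oscillation `T f_w - T
f_w(w)` on the circle with `dualTest` isolates `φ(w)`: the zeros of the dual function at `0` and `w`
kill the constant and the `φ'` term. On the circle the dual function has modulus `|1 - ξ conj
w|^(-3)`, so the pointwise inequality `mul_rpow_neg_three_le` bounds the pairing by the `BMOA` norm.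
All powers of `1-|w|` cancel, leaving a uniform bound for `|φ(w)| |w|^2`.

Since `φ` is only in `H^1`, both directions need its boundary function to exist and to satisfy
Cauchy formulas. Factoring `φ` into two `H^2` functions makes the dilates of `φ` along a sequence of
radii tending to `1` converge in `L^1`; the Poisson formula then passes to the limit, and it gives
radial limits at Lebesgue points (`MemHardy.exists_boundary`). -/

lemma norm_circ (θ : ℝ) : ‖circ θ‖ = 1 := Complex.norm_exp_ofReal_mul_I θ

lemma circ_eq_circleMap (θ : ℝ) : circ θ = circleMap 0 1 θ := by simp [circ, circleMap]

@[fun_prop]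
lemma continuous_circ : Continuous circ := by unfold circ; fun_prop

lemma circ_ne_zero (θ : ℝ) : circ θ ≠ 0 := Complex.exp_ne_zero _

lemma conj_circ_mul (θ : ℝ) : conj (circ θ) * circ θ = 1 := by
  rw [mul_comm, Complex.mul_conj, Complex.normSq_eq_norm_sq, norm_circ]; simp

lemma conj_circ (θ : ℝ) : conj (circ θ) = (circ θ)⁻¹ :=
  eq_inv_of_mul_eq_one_left (conj_circ_mul θ)

lemma circ_add (a b : ℝ) : circ (a + b) = circ a * circ b := by
  simp [circ, add_mul, Complex.exp_add]

lemma circ_periodic : Function.Periodic circ (2 * π) := by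
  intro θ
  rw [circ_eq_circleMap, circ_eq_circleMap, periodic_circleMap]

instance : IsFiniteMeasure arc := by unfold arc; infer_instance

lemma integral_arc {E : Type*} [NormedAddCommGroup E] [NormedSpace ℝ E] (F : ℝ → E) :
    ∫ θ, F θ ∂arc = ∫ θ in (0 : ℝ)..2 * π, F θ := by
  rw [arc, intervalIntegral.integral_of_le Real.two_pi_pos.le]

lemma integral_arc_eq_circleAverage (f : ℂ → ℂ) :
    ∫ θ, f (circ θ) ∂arc = 2 * π * circleAverage f 0 1 := by
  rw [integral_arc, circleAverage_def]
  simp only [circ_eq_circleMap, Complex.real_smul]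
  push_cast
  field_simp

lemma integrable_arc_of_continuous {E : Type*} [NormedAddCommGroup E] {F : ℝ → E}
    (hF : Continuous F) : Integrable F arc :=
  (hF.integrableOn_Icc (a := 0) (b := 2 * π)).mono_set Ioc_subset_Icc_self

lemma one_sub_mul_conj_circ_ne_zero {w : ℂ} (hw : ‖w‖ < 1) (θ : ℝ) :
    1 - w * conj (circ θ) ≠ 0 := by
  intro h
  have h1 : w * conj (circ θ) = 1 := (sub_eq_zero.1 h).symm
  have := congrArg norm h1
  rw [norm_mul, RCLike.norm_conj, norm_circ] at this
  simp at this; linarith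

/-- On the circle `ζ / (ζ - w) = 1 / (1 - w conj ζ)`, so Cauchy's formula is reproduction by the
Szegő kernel. -/
lemma integral_cauchy {f : ℂ → ℂ} (hf : DiffContOnCl ℂ f (Metric.ball 0 1)) {w : ℂ}
    (hw : ‖w‖ < 1) :
    ∫ θ, f (circ θ) / (1 - w * conj (circ θ)) ∂arc = 2 * π * f w := by
  have h := DiffContOnCl.circleAverage_smul_div (f := f) (c := 0) (R := 1) (w := w)
    (by simpa using hf) (by simpa using hw)
  rw [← h, ← integral_arc_eq_circleAverage]
  congr 1; ext θ
  have h1 := one_sub_mul_conj_circ_ne_zero hw θ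
  have h2 := circ_ne_zero θ
  rw [conj_circ] at *
  have h3 : circ θ - w ≠ 0 := by
    intro h3; apply h1; rw [← sub_eq_zero.1 h3, mul_inv_cancel₀ h2]; simp
  simp only [sub_zero, smul_eq_mul]
  field_simp

lemma integral_mean {f : ℂ → ℂ} (hf : DiffContOnCl ℂ f (Metric.ball 0 1)) :
    ∫ θ, f (circ θ) ∂arc = 2 * π * f 0 := by
  simpa using integral_cauchy hf (w := 0) (by simp)

/-- Since `dζ = i ζ dθ`, the integrand is `ζ f(ζ) / (ζ - w)^2 dζ` up to the factor `i`. This is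
Cauchy's formula for a derivative, applied to `z f(z)`. -/
lemma integral_cauchy_sq {f : ℂ → ℂ} {U : Set ℂ} (hU : IsOpen U)
    (hUb : Metric.closedBall 0 1 ⊆ U) (hf : DifferentiableOn ℂ f U) {w : ℂ} (hw : ‖w‖ < 1) :
    ∫ θ, f (circ θ) / (1 - w * conj (circ θ)) ^ 2 ∂arc
      = 2 * π * deriv (fun z => z * f z) w := by
  have h := Complex.two_pi_I_inv_smul_circleIntegral_sub_sq_inv_smul_of_differentiable hU hUb
    (f := fun z => z * f z) (differentiableOn_id.mul hf) (w₀ := w) (by simpa using hw)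
  rw [← h, circleIntegral, integral_arc]
  have : ∀ θ : ℝ, deriv (circleMap 0 1) θ • ((circleMap 0 1 θ - w) ^ 2)⁻¹ •
      (circleMap 0 1 θ * f (circleMap 0 1 θ)) =
      Complex.I * (f (circ θ) / (1 - w * conj (circ θ)) ^ 2) := by
    intro θ
    rw [deriv_circleMap, ← circ_eq_circleMap]
    have h1 := one_sub_mul_conj_circ_ne_zero hw θ
    have h2 := circ_ne_zero θ
    rw [conj_circ] at *
    have h3 : circ θ - w ≠ 0 := by
      intro h3; apply h1; rw [← sub_eq_zero.1 h3, mul_inv_cancel₀ h2]; simp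
    simp only [smul_eq_mul]
    field_simp
  simp only [this]
  rw [intervalIntegral.integral_const_mul, smul_eq_mul]
  have := Complex.I_ne_zero
  have : (π : ℂ) ≠ 0 := by exact_mod_cast Real.pi_ne_zero
  field_simp

lemma integral_circ_pow_mul_conj (n m : ℕ) :
    ∫ θ, circ θ ^ n * conj (circ θ) ^ m ∂arc = if n = m then 2 * π else 0 := by
  have key : ∀ n m : ℕ, m ≤ n → ∫ θ, circ θ ^ n * conj (circ θ) ^ m ∂arc
      = if n = m then 2 * π else 0 := by
    intro n m h
    obtain ⟨l, rfl⟩ := Nat.exists_eq_add_of_le h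
    have : ∀ θ, circ θ ^ (m + l) * conj (circ θ) ^ m = circ θ ^ l := by
      intro θ
      rw [pow_add, mul_right_comm, ← mul_pow, mul_comm (circ θ), conj_circ_mul]; simp
    simp only [this]
    rw [integral_mean (f := fun z => z ^ l)
      (Differentiable.diffContOnCl (by fun_prop))]
    rcases Nat.eq_zero_or_pos l with rfl | hl
    · simp
    · rw [zero_pow hl.ne', if_neg (by omega)]; simp
  rcases le_total m n with h | h
  · exact key n m h
  · have h1 := congrArg conj (key m n h)
    rw [← integral_conj] at h1
    simp only [map_mul, map_pow, Complex.conj_conj] at h1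
    simp only [mul_comm (circ _ ^ n)]
    rw [h1, Complex.conj_ofReal]
    by_cases h2 : n = m
    · simp [h2]
    · simp [h2, Ne.symm h2]

/-! ### Square-root factorization of polynomials on the disk -/

/-- `F = g h` on the closed disk with `|g|² = |h|² = |F|` on the circle. -/
def HasSqrtFactorization (F : ℂ → ℂ) : Prop :=
  ∃ g h : ℂ → ℂ, DiffContOnCl ℂ g (Metric.ball 0 1) ∧ DiffContOnCl ℂ h (Metric.ball 0 1) ∧
    (∀ z ∈ Metric.closedBall (0 : ℂ) 1, F z = g z * h z) ∧
    ∀ z ∈ Metric.sphere (0 : ℂ) 1, ‖g z‖ ^ 2 = ‖F z‖ ∧ ‖h z‖ ^ 2 = ‖F z‖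

lemma HasSqrtFactorization.mul {F G : ℂ → ℂ} (hF : HasSqrtFactorization F)
    (hG : HasSqrtFactorization G) : HasSqrtFactorization (fun z => F z * G z) := by
  obtain ⟨g₁, h₁, hg₁, hh₁, e₁, n₁⟩ := hF
  obtain ⟨g₂, h₂, hg₂, hh₂, e₂, n₂⟩ := hG
  refine ⟨fun z => g₁ z * g₂ z, fun z => h₁ z * h₂ z, hg₁.smul hg₂, hh₁.smul hh₂, ?_, ?_⟩
  · intro z hz; simp only [e₁ z hz, e₂ z hz]; ring
  · intro z hz
    simp only [norm_mul, mul_pow, (n₁ z hz).1, (n₁ z hz).2, (n₂ z hz).1, (n₂ z hz).2, and_self]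

lemma sq_cpow_half (x : ℂ) : (x ^ ((2 : ℕ) : ℂ)⁻¹) ^ 2 = x :=
  Complex.cpow_nat_inv_pow x two_ne_zero

lemma hasSqrtFactorization_of_sq {F g : ℂ → ℂ} (hg : DiffContOnCl ℂ g (Metric.ball 0 1))
    (h : ∀ z, F z = g z ^ 2) : HasSqrtFactorization F :=
  ⟨g, g, hg, hg, fun z _ => by rw [h, sq], fun z _ => by simp [h]⟩

lemma hasSqrtFactorization_const (c : ℂ) : HasSqrtFactorization (fun _ => c) :=
  hasSqrtFactorization_of_sq (g := fun _ => c ^ ((2 : ℕ) : ℂ)⁻¹) diffContOnCl_const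
    fun _ => (sq_cpow_half c).symm

/-- The base has positive real part inside the disk, so the principal branch is holomorphic there.
If `‖c‖ = 1` it vanishes at one boundary point, where the root is still continuous because the
exponent is positive. -/
lemma diffContOnCl_sqrt_one_sub {c : ℂ} (hc : ‖c‖ ≤ 1) :
    DiffContOnCl ℂ (fun z => (1 - c * z) ^ ((2 : ℕ) : ℂ)⁻¹) (Metric.ball 0 1) := by
  have hre : (0 : ℝ) < (((2 : ℕ) : ℂ)⁻¹).re := by norm_num
  have hle : ∀ z : ℂ, (c * z).re ≤ ‖c‖ * ‖z‖ := fun z =>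
    (Complex.re_le_norm _).trans (norm_mul _ _).le
  constructor
  · intro z hz
    rw [Metric.mem_ball, dist_zero_right] at hz
    apply DifferentiableAt.differentiableWithinAt
    refine DifferentiableAt.cpow (by fun_prop) (by fun_prop) (Or.inl ?_)
    have := hle z
    have : ‖c‖ * ‖z‖ ≤ 1 * ‖z‖ := by gcongr
    rw [Complex.sub_re, Complex.one_re]; linarith
  · rw [closure_ball _ one_ne_zero]
    intro z hz
    rw [Metric.mem_closedBall, dist_zero_right] at hz
    apply ContinuousAt.continuousWithinAt
    have h1 : ContinuousAt (fun x : ℂ => x ^ ((2 : ℕ) : ℂ)⁻¹) (1 - c * z) := by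
      refine Complex.continuousAt_cpow_const_of_re_pos (Or.inl ?_) hre
      have := hle z
      have : ‖c‖ * ‖z‖ ≤ 1 * 1 := by gcongr
      rw [Complex.sub_re, Complex.one_re]; linarith
    exact ContinuousAt.comp (f := fun z => 1 - c * z) h1 (by fun_prop)

lemma norm_sub_eq_norm_one_sub {ξ : ℂ} (hξ : ‖ξ‖ = 1) (a : ℂ) :
    ‖ξ - a‖ = ‖1 - ξ * conj a‖ := by
  have h : conj ξ * ξ = 1 := by
    rw [mul_comm, Complex.mul_conj, Complex.normSq_eq_norm_sq, hξ]; simp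
  have : 1 - ξ * conj a = ξ * conj (ξ - a) := by
    rw [map_sub, mul_sub, mul_comm ξ (conj ξ), h]
  rw [this, norm_mul, hξ, RCLike.norm_conj, one_mul]

/-- A root outside the open disk admits a holomorphic square root of `z - a`. For a root inside, `1
- conj a * z` has the same modulus as `z - a` on the circle and no zero in the closed disk. Its
square root `s` is one factor, and the zero goes entirely into the other, `(z - a) / s`. -/
lemma hasSqrtFactorization_sub (a : ℂ) : HasSqrtFactorization (fun z => z - a) := by
  rcases le_or_gt 1 ‖a‖ with ha | ha
  · have ha0 : a ≠ 0 := by rintro rfl; simp at ha; linarith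
    refine hasSqrtFactorization_of_sq
      (g := fun z => (-a) ^ ((2 : ℕ) : ℂ)⁻¹ * (1 - a⁻¹ * z) ^ ((2 : ℕ) : ℂ)⁻¹) ?_ ?_
    · refine (diffContOnCl_const (c := (-a) ^ ((2 : ℕ) : ℂ)⁻¹)).smul (diffContOnCl_sqrt_one_sub ?_)
      rw [norm_inv]; exact inv_le_one_of_one_le₀ ha
    · intro z
      rw [mul_pow, sq_cpow_half, sq_cpow_half]; field_simp; ring
  · set s : ℂ → ℂ := fun z => (1 - conj a * z) ^ ((2 : ℕ) : ℂ)⁻¹ with hs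
    have hsd : DiffContOnCl ℂ s (Metric.ball 0 1) :=
      diffContOnCl_sqrt_one_sub (by rw [RCLike.norm_conj]; exact ha.le)
    have hs2 : ∀ z, s z ^ 2 = 1 - conj a * z := fun z => sq_cpow_half _
    have hs0 : ∀ z ∈ closure (Metric.ball (0 : ℂ) 1), s z ≠ 0 := by
      intro z hz h0
      rw [closure_ball _ one_ne_zero, Metric.mem_closedBall, dist_zero_right] at hz
      have h1 := hs2 z
      rw [h0, zero_pow two_ne_zero] at h1
      have h2 : ‖conj a * z‖ = 1 := by rw [← sub_eq_zero.1 h1.symm]; simp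
      rw [norm_mul, RCLike.norm_conj] at h2
      nlinarith [norm_nonneg a, norm_nonneg z]
    have hcb : closure (Metric.ball (0 : ℂ) 1) = Metric.closedBall 0 1 :=
      closure_ball _ one_ne_zero
    refine ⟨s, fun z => (s z)⁻¹ * (z - a), hsd, (hsd.inv hs0).smul
      (Differentiable.diffContOnCl (by fun_prop)), ?_, ?_⟩
    · intro z hz
      have := hs0 z (hcb ▸ hz)
      field_simp
    · intro z hz
      have h0 := hs0 z (hcb ▸ Metric.sphere_subset_closedBall hz)
      rw [mem_sphere_zero_iff_norm] at hz
      have h1 : ‖s z‖ ^ 2 = ‖z - a‖ := by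
        rw [← norm_pow, hs2, norm_sub_eq_norm_one_sub hz, mul_comm]
      refine ⟨h1, ?_⟩
      have h3 : ‖s z‖ ≠ 0 := norm_ne_zero_iff.2 h0
      rw [norm_mul, norm_inv, ← h1]
      field_simp

lemma hasSqrtFactorization_polynomial (p : Polynomial ℂ) :
    HasSqrtFactorization (fun z => p.eval z) := by
  have hp := (IsAlgClosed.splits p).eq_prod_roots
  have hm : ∀ m : Multiset ℂ, HasSqrtFactorization
      (fun z => ((m.map (fun a => Polynomial.X - Polynomial.C a)).prod).eval z) := by
    intro m
    induction m using Multiset.induction with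
    | empty => simpa using hasSqrtFactorization_const 1
    | cons a m ih =>
      have := (hasSqrtFactorization_sub a).mul ih
      simpa using this
  have := (hasSqrtFactorization_const p.leadingCoeff).mul (hm p.roots)
  rw [hp]
  simpa using this

/-! ### Fourier coefficients -/

/-- The normalized Fourier coefficients of nonnegative order on the circle. -/
def circCoeff (F : ℝ → ℂ) (n : ℕ) : ℂ := (2 * π : ℂ)⁻¹ * ∫ θ, F θ * conj (circ θ) ^ n ∂arc

lemma two_pi_ne_zero' : (2 * π : ℂ) ≠ 0 := by
  exact_mod_cast Real.two_pi_pos.ne'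

/-- The Szegő kernel in Cauchy's formula is expanded as a geometric series and integrated term by
term. -/
lemma hasSum_circCoeff {g : ℂ → ℂ} (hg : DiffContOnCl ℂ g (Metric.ball 0 1))
    (hc : Continuous fun θ => g (circ θ)) {z : ℂ} (hz : ‖z‖ < 1) :
    HasSum (fun n => circCoeff (fun θ => g (circ θ)) n * z ^ n) (g z) := by
  have h1 : HasSum (fun n : ℕ => ∫ θ, g (circ θ) * conj (circ θ) ^ n * z ^ n ∂arc)
      (∫ θ, ∑' n : ℕ, g (circ θ) * conj (circ θ) ^ n * z ^ n ∂arc) := by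
    have hcc : Continuous fun θ => conj (circ θ) := Complex.continuous_conj.comp continuous_circ
    refine hasSum_integral_of_summable_integral_norm (fun n => ?_) ?_
    · exact integrable_arc_of_continuous ((hc.mul (hcc.pow n)).mul continuous_const)
    · simp only [norm_mul, norm_pow, RCLike.norm_conj, norm_circ, one_pow, mul_one]
      simp only [integral_mul_const]
      exact (summable_geometric_of_lt_one (norm_nonneg z) hz).mul_left _
  have h2 : ∀ θ, ∑' n : ℕ, g (circ θ) * conj (circ θ) ^ n * z ^ n
      = g (circ θ) / (1 - z * conj (circ θ)) := by
    intro θ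
    simp only [mul_assoc, ← mul_pow]
    rw [tsum_mul_left, tsum_geometric_of_norm_lt_one, mul_comm (conj _), div_eq_mul_inv]
    rwa [norm_mul, RCLike.norm_conj, norm_circ, one_mul]
  simp only [h2] at h1
  rw [integral_cauchy hg hz] at h1
  have h3 := h1.mul_left (2 * π : ℂ)⁻¹
  rw [inv_mul_cancel_left₀ two_pi_ne_zero'] at h3
  refine h3.congr_fun ?_
  intro n
  rw [circCoeff, integral_mul_const]; ring

/-- Bessel's inequality, from expanding the integral of `‖F - S‖ ^ 2`, where `S` is the partial
Fourier sum. -/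
lemma sum_sq_circCoeff_le {F : ℝ → ℂ} (hc : Continuous F) (N : ℕ) :
    ∑ n ∈ Finset.range N, ‖circCoeff F n‖ ^ 2 ≤ (2 * π)⁻¹ * ∫ θ, ‖F θ‖ ^ 2 ∂arc := by
  set a := circCoeff F with ha
  have hcc : Continuous fun θ => conj (circ θ) := Complex.continuous_conj.comp continuous_circ
  have hccF : Continuous fun θ => conj (F θ) := Complex.continuous_conj.comp hc
  have hFa : ∀ n, ∫ θ, F θ * conj (circ θ) ^ n ∂arc = 2 * π * a n := by
    intro n; rw [ha, circCoeff, mul_inv_cancel_left₀ two_pi_ne_zero']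
  have hFa' : ∀ n, ∫ θ, conj (F θ) * circ θ ^ n ∂arc = 2 * π * conj (a n) := by
    intro n
    have := congrArg conj (hFa n)
    rw [← integral_conj] at this
    simpa [Complex.conj_ofNat] using this
  set S : ℝ → ℂ := fun θ => ∑ n ∈ Finset.range N, a n * circ θ ^ n with hS
  have hSc : Continuous S := by rw [hS]; fun_prop
  have hSc' : Continuous fun θ => conj (S θ) := Complex.continuous_conj.comp hSc
  set σ : ℝ := ∑ n ∈ Finset.range N, ‖a n‖ ^ 2 with hσ
  have hσC : (σ : ℂ) = ∑ n ∈ Finset.range N, a n * conj (a n) := by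
    simp [hσ, Complex.mul_conj, Complex.normSq_eq_norm_sq]
  have e1 : ∫ θ, conj (F θ) * S θ ∂arc = 2 * π * σ := by
    simp only [hS, Finset.mul_sum]
    rw [integral_finsetSum _ fun n _ => integrable_arc_of_continuous (by fun_prop), hσC,
      Finset.mul_sum]
    refine Finset.sum_congr rfl fun n _ => ?_
    rw [← mul_assoc, mul_right_comm, ← hFa', ← integral_mul_const]
    congr 1; ext θ; ring
  have e2 : ∫ θ, F θ * conj (S θ) ∂arc = 2 * π * σ := by
    have := congrArg conj e1
    rw [← integral_conj] at this
    simpa [Complex.conj_ofNat] using this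
  have e3 : ∫ θ, S θ * conj (S θ) ∂arc = 2 * π * σ := by
    have : ∀ θ, S θ * conj (S θ) = ∑ m ∈ Finset.range N, ∑ n ∈ Finset.range N,
        a m * conj (a n) * (circ θ ^ m * conj (circ θ) ^ n) := by
      intro θ
      simp only [hS, map_sum, Finset.sum_mul_sum, map_mul, map_pow]
      refine Finset.sum_congr rfl fun m _ => Finset.sum_congr rfl fun n _ => by ring
    simp only [this]
    rw [integral_finsetSum _ fun n _ => integrable_arc_of_continuous (by fun_prop), hσC,
      Finset.mul_sum]
    refine Finset.sum_congr rfl fun m hm => ?_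
    rw [integral_finsetSum _ fun n _ => integrable_arc_of_continuous (by fun_prop)]
    simp only [integral_const_mul, integral_circ_pow_mul_conj]
    simp only [apply_ite (fun x : ℝ => (x : ℂ)), mul_ite, Complex.ofReal_zero, mul_zero]
    rw [Finset.sum_ite_eq, if_pos hm]; push_cast; ring
  have e4 : ∫ θ, ((‖F θ - S θ‖ ^ 2 : ℝ) : ℂ) ∂arc
      = ((∫ θ, ‖F θ‖ ^ 2 ∂arc : ℝ) : ℂ) - 2 * π * σ := by
    have : ∀ θ, ((‖F θ - S θ‖ ^ 2 : ℝ) : ℂ) = ((‖F θ‖ ^ 2 : ℝ) : ℂ) - conj (F θ) * S θ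
        - F θ * conj (S θ) + S θ * conj (S θ) := by
      intro θ
      rw [← Complex.normSq_eq_norm_sq, ← Complex.normSq_eq_norm_sq, ← Complex.mul_conj,
        ← Complex.mul_conj, map_sub]; ring
    simp only [this]
    rw [integral_add, integral_sub, integral_sub, e1, e2, e3, integral_complex_ofReal]
    · ring
    all_goals exact integrable_arc_of_continuous (by fun_prop)
  rw [integral_complex_ofReal] at e4
  have e5 : ∫ θ, ‖F θ - S θ‖ ^ 2 ∂arc = ∫ θ, ‖F θ‖ ^ 2 ∂arc - 2 * π * σ := by exact_mod_cast e4
  have e6 : 0 ≤ ∫ θ, ‖F θ - S θ‖ ^ 2 ∂arc := integral_nonneg fun _ => by positivity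
  rw [e5] at e6
  have := Real.two_pi_pos
  rw [← div_eq_inv_mul, le_div_iff₀ this]; linarith

/-- **Parseval** for absolutely convergent power series on the circle. -/
lemma integral_norm_sq_tsum {c : ℕ → ℂ} (hc : Summable fun n => ‖c n‖) :
    ∫ θ, ‖∑' n, c n * circ θ ^ n‖ ^ 2 ∂arc = 2 * π * ∑' n, ‖c n‖ ^ 2 := by
  set S : ℝ → ℂ := fun θ => ∑' n, c n * circ θ ^ n with hS
  have hSum : ∀ θ, Summable fun n => c n * circ θ ^ n := fun θ =>
    Summable.of_norm (by simpa [norm_circ] using hc)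
  have hSc : Continuous S := by
    refine continuous_tsum (fun n => by fun_prop) hc fun n θ => by simp [norm_circ]
  have hcc : Continuous fun θ => conj (circ θ) := Complex.continuous_conj.comp continuous_circ
  have e1 : ∀ m, ∫ θ, S θ * conj (circ θ) ^ m ∂arc = 2 * π * c m := by
    intro m
    have h1 : HasSum (fun n : ℕ => ∫ θ, c n * circ θ ^ n * conj (circ θ) ^ m ∂arc)
        (∫ θ, ∑' n : ℕ, c n * circ θ ^ n * conj (circ θ) ^ m ∂arc) := by
      refine hasSum_integral_of_summable_integral_norm
        (fun n => integrable_arc_of_continuous (by fun_prop)) ?_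
      simp only [norm_mul, norm_pow, RCLike.norm_conj, norm_circ, one_pow, mul_one]
      simp only [integral_const, smul_eq_mul]
      exact hc.mul_left _
    simp only [tsum_mul_right] at h1
    rw [← h1.tsum_eq]
    simp only [mul_assoc, integral_const_mul, integral_circ_pow_mul_conj]
    rw [tsum_eq_single m]
    · simp; ring
    · intro n hn; simp [hn]
  have h2 : HasSum (fun n : ℕ => ∫ θ, S θ * (conj (c n) * conj (circ θ) ^ n) ∂arc)
      (∫ θ, ∑' n : ℕ, S θ * (conj (c n) * conj (circ θ) ^ n) ∂arc) := by
    refine hasSum_integral_of_summable_integral_norm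
      (fun n => integrable_arc_of_continuous (by fun_prop)) ?_
    simp only [norm_mul, norm_pow, RCLike.norm_conj, norm_circ, one_pow, mul_one]
    simp only [integral_mul_const]
    exact hc.mul_left _
  have h3 : ∀ θ, ∑' n : ℕ, S θ * (conj (c n) * conj (circ θ) ^ n) = ((‖S θ‖ ^ 2 : ℝ) : ℂ) := by
    intro θ
    rw [tsum_mul_left, ← Complex.normSq_eq_norm_sq, ← Complex.mul_conj]
    congr 1
    rw [hS, Complex.conj_tsum]
    simp
  simp only [h3] at h2
  rw [integral_complex_ofReal] at h2
  have h4 : ∀ n, ∫ θ, S θ * (conj (c n) * conj (circ θ) ^ n) ∂arc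
      = ((2 * π * ‖c n‖ ^ 2 : ℝ) : ℂ) := by
    intro n
    have : ∀ θ, S θ * (conj (c n) * conj (circ θ) ^ n)
      = conj (c n) * (S θ * conj (circ θ) ^ n) := fun θ => by ring
    simp only [this]
    rw [integral_const_mul, e1]
    push_cast
    rw [← Complex.ofReal_pow, ← Complex.normSq_eq_norm_sq, ← Complex.mul_conj]; ring
  simp only [h4] at h2
  have h5 := (Complex.hasSum_ofReal.1 h2).tsum_eq
  rw [← h5, tsum_mul_left]

/-! ### Taylor series -/

lemma mem_unitDisk {z : ℂ} : z ∈ unitDisk ↔ ‖z‖ < 1 := by simp [unitDisk]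

lemma Holo.hasSum {f : ℂ → ℂ} (hf : Holo f) {z : ℂ} (hz : ‖z‖ < 1) :
    HasSum (fun n => coeff f n * z ^ n) (f z) := by
  have h := Complex.hasSum_taylorSeries_on_ball (c := 0) (r := 1) hf (z := z) (by simpa using hz)
  refine h.congr_fun fun n => ?_
  simp only [sub_zero, smul_eq_mul, coeff]; ring

lemma Holo.summable_coeff {f : ℂ → ℂ} (hf : Holo f) {r : ℝ} (h0 : 0 ≤ r) (h1 : r < 1) :
    Summable fun n => ‖coeff f n‖ * r ^ n := by
  have h := (hf.hasSum (z := (r : ℂ)) (by simpa [abs_of_nonneg h0] using h1)).summable.norm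
  simpa [abs_of_nonneg h0] using h

lemma Holo.exists_polynomial_approx {f : ℂ → ℂ} (hf : Holo f) {R ε : ℝ} (h0 : 0 ≤ R) (h1 : R < 1)
    (hε : 0 < ε) : ∃ p : Polynomial ℂ, ∀ z : ℂ, ‖z‖ ≤ 1 → ‖p.eval z - f (R * z)‖ ≤ ε := by
  have hs := hf.summable_coeff h0 h1
  obtain ⟨N, hN⟩ := (((tendsto_sum_nat_add (fun n => ‖coeff f n‖ * R ^ n))).eventually
    (gt_mem_nhds hε)).exists
  refine ⟨∑ n ∈ Finset.range N, Polynomial.C (coeff f n * R ^ n) * Polynomial.X ^ n, ?_⟩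
  intro z hz
  have hRz : ‖(R : ℂ) * z‖ < 1 := by
    rw [norm_mul, Complex.norm_real, Real.norm_of_nonneg h0]; nlinarith [norm_nonneg z]
  have h2 := hf.hasSum hRz
  rw [← h2.tsum_eq, ← h2.summable.sum_add_tsum_nat_add N, Polynomial.eval_finsetSum]
  simp only [Polynomial.eval_mul, Polynomial.eval_C, Polynomial.eval_pow, Polynomial.eval_X,
    mul_pow, mul_assoc, sub_add_cancel_left, norm_neg]
  refine (tsum_of_norm_bounded ((summable_nat_add_iff N).2 hs).hasSum fun n => ?_).trans hN.le
  rw [norm_mul, norm_mul, norm_pow, norm_pow, Complex.norm_real, Real.norm_of_nonneg h0]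
  gcongr
  exact mul_le_of_le_one_right (by positivity) (pow_le_one₀ (norm_nonneg z) hz)

lemma Holo.continuous_circle {f : ℂ → ℂ} (hf : Holo f) {r : ℝ} (hr : r ∈ Ioo (0 : ℝ) 1) :
    Continuous fun θ => f (r * circ θ) := by
  refine hf.continuousOn.comp_continuous (by fun_prop) fun θ => ?_
  rw [mem_unitDisk, norm_mul, norm_circ, mul_one, Complex.norm_real, Real.norm_of_nonneg hr.1.le]
  exact hr.2

lemma MemHardy.exists_integral_le {f : ℂ → ℂ} (hf : MemHardy 1 f) :
    ∃ K : ℝ, 0 ≤ K ∧ ∀ r ∈ Ioo (0 : ℝ) 1, ∫ θ, ‖f (r * circ θ)‖ ∂arc ≤ K := by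
  obtain ⟨h1, h2⟩ := hf
  refine ⟨(⨆ r ∈ Ioo (0 : ℝ) 1, ∫⁻ θ, ENNReal.ofReal (‖f ((r : ℂ) * circ θ)‖ ^ (1 : ℝ)) ∂arc).toReal,
    ENNReal.toReal_nonneg, fun r hr => ?_⟩
  rw [integral_eq_lintegral_of_nonneg_ae (ae_of_all _ fun _ => norm_nonneg _)
    (h1.continuous_circle hr).norm.aestronglyMeasurable]
  refine ENNReal.toReal_mono h2.ne ?_
  simp only [Real.rpow_one]
  exact le_iSup₂ (f := fun (r : ℝ) (_ : r ∈ Ioo (0 : ℝ) 1) =>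
    ∫⁻ θ, ENNReal.ofReal (‖f ((r : ℂ) * circ θ)‖) ∂arc) r hr

/-! ### Factorization of `H¹` functions -/

/-- As `|g|² = |h|² = |p|` on the circle, the `L¹` bound on `p` is an `L²` bound on both factors.
Bessel's inequality turns it into `ℓ²` bounds on coefficients, uniform in the degree of `p`. -/
lemma exists_coeff_factorization_polynomial {p : Polynomial ℂ} {K : ℝ}
    (hp : ∫ θ, ‖p.eval (circ θ)‖ ∂arc ≤ K) :
    ∃ a b : ℕ → ℂ, (∀ N, ∑ n ∈ Finset.range N, ‖a n‖ ^ 2 ≤ K) ∧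
      (∀ N, ∑ n ∈ Finset.range N, ‖b n‖ ^ 2 ≤ K) ∧
      ∀ z : ℂ, ‖z‖ < 1 → p.eval z = (∑' n, a n * z ^ n) * ∑' n, b n * z ^ n := by
  obtain ⟨g, h, hg, hh, he, hn⟩ := hasSqrtFactorization_polynomial p
  have hK : (2 * π)⁻¹ * ∫ θ, ‖p.eval (circ θ)‖ ∂arc ≤ K := by
    have h1 : (0 : ℝ) ≤ ∫ θ, ‖p.eval (circ θ)‖ ∂arc := integral_nonneg fun _ => norm_nonneg _
    have h2 : (2 * π)⁻¹ ≤ (1 : ℝ) := inv_le_one_of_one_le₀ (by linarith [Real.pi_gt_three])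
    nlinarith
  have hcont : ∀ {g : ℂ → ℂ}, DiffContOnCl ℂ g (Metric.ball 0 1) →
      Continuous fun θ => g (circ θ) := by
    intro g hg
    have := hg.continuousOn
    rw [closure_ball _ one_ne_zero] at this
    exact this.comp_continuous (by fun_prop) fun θ => by simp [norm_circ]
  have hcs : ∀ θ, circ θ ∈ Metric.sphere (0 : ℂ) 1 := fun θ => by simp [norm_circ]
  refine ⟨circCoeff fun θ => g (circ θ), circCoeff fun θ => h (circ θ), fun N => ?_, fun N => ?_,
    fun z hz => ?_⟩
  · refine (sum_sq_circCoeff_le (hcont hg) N).trans ?_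
    simpa only [(hn _ (hcs _)).1] using hK
  · refine (sum_sq_circCoeff_le (hcont hh) N).trans ?_
    simpa only [(hn _ (hcs _)).2] using hK
  · rw [(hasSum_circCoeff hg (hcont hg) hz).tsum_eq, (hasSum_circCoeff hh (hcont hh) hz).tsum_eq]
    exact he z (by simpa using hz.le)

lemma norm_le_sqrt_of_sum_sq_le {a : ℕ → ℂ} {K : ℝ}
    (h : ∀ N, ∑ n ∈ Finset.range N, ‖a n‖ ^ 2 ≤ K) (n : ℕ) : ‖a n‖ ≤ √K := by
  refine Real.le_sqrt_of_sq_le ((Finset.single_le_sum (f := fun n => ‖a n‖ ^ 2)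
    (fun _ _ => by positivity) (Finset.self_mem_range_succ n)).trans (h (n + 1)))

/-- Bounded sequences in `ℓ²` have a coordinatewise limit along an ultrafilter. -/
lemma exists_coordinatewise_limit (U : Ultrafilter ℕ) {a : ℕ → ℕ → ℂ} {K : ℝ}
    (h : ∀ j N, ∑ n ∈ Finset.range N, ‖a j n‖ ^ 2 ≤ K) :
    ∃ b : ℕ → ℂ, (∀ n, Tendsto (fun j => a j n) U (𝓝 (b n))) ∧
      ∀ N, ∑ n ∈ Finset.range N, ‖b n‖ ^ 2 ≤ K := by
  have hc : IsCompact (Set.univ.pi fun _ : ℕ => Metric.closedBall (0 : ℂ) √K) :=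
    isCompact_univ_pi fun _ => isCompact_closedBall _ _
  obtain ⟨b, -, hb⟩ := hc.ultrafilter_le_nhds (U.map a) (by
    rw [Ultrafilter.coe_map, le_principal_iff]
    refine mem_map.2 (univ_mem' fun j => ?_)
    intro n _
    simpa using norm_le_sqrt_of_sum_sq_le (h j) n)
  have hb' : Tendsto a U (𝓝 b) := hb
  rw [tendsto_pi_nhds] at hb'
  refine ⟨b, hb', fun N => ?_⟩
  exact le_of_tendsto (tendsto_finsetSum _ fun n _ => (hb' n).norm.pow 2)
    (Eventually.of_forall fun j => h j N)

lemma tendsto_tsum_mul_pow {l : Filter ℕ} {a : ℕ → ℕ → ℂ} {b : ℕ → ℂ} {K : ℝ}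
    (h : ∀ j N, ∑ n ∈ Finset.range N, ‖a j n‖ ^ 2 ≤ K)
    (hb : ∀ n, Tendsto (fun j => a j n) l (𝓝 (b n))) {z : ℂ} (hz : ‖z‖ < 1) :
    Tendsto (fun j => ∑' n, a j n * z ^ n) l (𝓝 (∑' n, b n * z ^ n)) := by
  refine tendsto_tsum_of_dominated_convergence (bound := fun n => √K * ‖z‖ ^ n)
    ((summable_geometric_of_lt_one (norm_nonneg z) hz).mul_left _)
    (fun n => (hb n).mul_const _) (Eventually.of_forall fun j n => ?_)
  rw [norm_mul, norm_pow]
  gcongr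
  exact norm_le_sqrt_of_sum_sq_le (h j) n

/-- An `H¹` function is a product of two `H²` functions. -/
theorem MemHardy.exists_factorization {φ : ℂ → ℂ} (hφ : MemHardy 1 φ) :
    ∃ a b : ℕ → ℂ, (Summable fun n => ‖a n‖ ^ 2) ∧ (Summable fun n => ‖b n‖ ^ 2) ∧
      ∀ z : ℂ, ‖z‖ < 1 → φ z = (∑' n, a n * z ^ n) * ∑' n, b n * z ^ n := by
  obtain ⟨K, hK0, hK⟩ := hφ.exists_integral_le
  -- The shift by `2` keeps the radius positive already at `j = 0`.
  have hR : ∀ j : ℕ, (1 - 1 / ((j : ℝ) + 2)) ∈ Ioo (0 : ℝ) 1 := by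
    intro j
    have : (0 : ℝ) ≤ j := j.cast_nonneg
    constructor
    · rw [sub_pos, div_lt_one (by positivity)]; linarith
    · rw [sub_lt_self_iff]; positivity
  set R : ℕ → ℝ := fun j => 1 - 1 / ((j : ℝ) + 2) with hRdef
  have hε : ∀ j : ℕ, (0 : ℝ) < 1 / ((j : ℝ) + 1) := fun j => by positivity
  choose p hp using fun j : ℕ => hφ.1.exists_polynomial_approx (hR j).1.le (hR j).2 (hε j)
  -- The polynomials approximate dilates of `φ` within `1` on the circle, which costs at most the
  -- length of the circle.
  have hpint : ∀ j, ∫ θ, ‖(p j).eval (circ θ)‖ ∂arc ≤ K + 2 * π := by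
    intro j
    have h1 : ∀ θ, ‖(p j).eval (circ θ)‖ ≤ ‖φ (R j * circ θ)‖ + 1 := by
      intro θ
      have h2 := hp j (circ θ) (norm_circ θ).le
      have h3 : 1 / ((j : ℝ) + 1) ≤ 1 := by
        rw [div_le_one (by positivity)]; linarith [(j.cast_nonneg : (0 : ℝ) ≤ j)]
      have h4 := norm_sub_norm_le ((p j).eval (circ θ)) (φ (R j * circ θ))
      linarith
    have hc := hφ.1.continuous_circle (hR j)
    calc ∫ θ, ‖(p j).eval (circ θ)‖ ∂arc ≤ ∫ θ, (‖φ (R j * circ θ)‖ + 1) ∂arc :=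
          integral_mono (integrable_arc_of_continuous (by fun_prop))
            (integrable_arc_of_continuous (hc.norm.add continuous_const)) h1
      _ = ∫ θ, ‖φ (R j * circ θ)‖ ∂arc + 2 * π := by
          rw [integral_add (integrable_arc_of_continuous hc.norm)
            (integrable_arc_of_continuous (by fun_prop))]
          rw [integral_const]
          congr 1
          simp [arc, Measure.real, Real.pi_pos.le]
      _ ≤ _ := by linarith [hK (R j) (hR j)]
  choose a b ha hb hab using fun j => exists_coeff_factorization_polynomial (hpint j)
  -- One ultrafilter serves both coefficient sequences, so no subsequences have to be extracted.
  obtain ⟨A, hA, hAs⟩ := exists_coordinatewise_limit (hyperfilter ℕ) ha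
  obtain ⟨B, hB, hBs⟩ := exists_coordinatewise_limit (hyperfilter ℕ) hb
  refine ⟨A, B, summable_of_sum_range_le (fun _ => by positivity) hAs,
    summable_of_sum_range_le (fun _ => by positivity) hBs, fun z hz => ?_⟩
  have h1 : Tendsto (fun j => (p j).eval z) (hyperfilter ℕ) (𝓝 (φ z)) := by
    have hat : (hyperfilter ℕ : Filter ℕ) ≤ atTop := Nat.hyperfilter_le_atTop
    refine Tendsto.mono_left ?_ hat
    have hRt : Tendsto R atTop (𝓝 1) := by
      have : Tendsto (fun j : ℕ => 1 / ((j : ℝ) + 2)) atTop (𝓝 0) :=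
        tendsto_const_nhds.div_atTop (tendsto_atTop_add_const_right _ _ tendsto_natCast_atTop_atTop)
      simpa [hRdef] using this.const_sub 1
    have h2 : Tendsto (fun j => φ (R j * z)) atTop (𝓝 (φ z)) := by
      have hca : ContinuousAt φ z := hφ.1.continuousOn.continuousAt
        (Metric.isOpen_ball.mem_nhds (mem_unitDisk.2 hz))
      refine Tendsto.comp hca ?_
      have := ((Complex.continuous_ofReal.tendsto _).comp hRt).mul_const z
      simpa using this
    have h3 : Tendsto (fun j => (p j).eval z - φ (R j * z)) atTop (𝓝 0) :=
      squeeze_zero_norm (fun j => hp j z hz.le) tendsto_one_div_add_atTop_nhds_zero_nat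
    simpa using h3.add h2
  have h2 := (tendsto_tsum_mul_pow ha hA hz).mul (tendsto_tsum_mul_pow hb hB hz)
  refine tendsto_nhds_unique h1 (h2.congr fun j => (hab j z hz).symm)

/-! ### The boundary function of an `H¹` function in the `L¹` sense -/

lemma exists_L1_limit {X : Type*} [MeasurableSpace X] {μ : Measure X} {F : ℕ → X → ℂ}
    (hF : ∀ n, Integrable (F n) μ) {t : ℕ → ℝ} (ht : Tendsto t atTop (𝓝 0))
    (h : ∀ n m, ∫ x, ‖F n x - F m x‖ ∂μ ≤ t n + t m) :
    ∃ u : X → ℂ, StronglyMeasurable u ∧ Integrable u μ ∧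
      Tendsto (fun n => ∫ x, ‖F n x - u x‖ ∂μ) atTop (𝓝 0) := by
  have hd : ∀ n m, dist ((hF n).toL1 (F n)) ((hF m).toL1 (F m)) = ∫ x, ‖F n x - F m x‖ ∂μ := by
    intro n m
    rw [dist_eq_norm, ← Integrable.toL1_sub]
    exact L1.norm_of_fun_eq_integral_norm ((hF n).sub (hF m))
  have hc : CauchySeq fun n => (hF n).toL1 (F n) := by
    rw [Metric.cauchySeq_iff]
    intro ε hε
    obtain ⟨N, hN⟩ := eventually_atTop.1 (ht.eventually (gt_mem_nhds (half_pos hε)))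
    refine ⟨N, fun m hm n hn => ?_⟩
    rw [hd]
    linarith [h m n, hN m hm, hN n hn]
  obtain ⟨u, hu⟩ := cauchySeq_tendsto_of_complete hc
  refine ⟨u, Lp.stronglyMeasurable u, L1.integrable_coeFn u, ?_⟩
  have := tendsto_iff_dist_tendsto_zero.1 hu
  refine this.congr fun n => ?_
  rw [dist_eq_norm, L1.norm_eq_integral_norm]
  refine integral_congr_ae ?_
  filter_upwards [Lp.coeFn_sub ((hF n).toL1 (F n)) u, (hF n).coeFn_toL1] with x h1 h2
  rw [h1, Pi.sub_apply, h2]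

/-- The power series with coefficients `a` on the circle of radius `r`. -/
def circSeries (a : ℕ → ℂ) (r θ : ℝ) : ℂ := ∑' n, a n * (r : ℂ) ^ n * circ θ ^ n

lemma summable_norm_of_sq {a : ℕ → ℂ} (ha : Summable fun n => ‖a n‖ ^ 2) {r : ℝ}
    (hr : r ∈ Ioo (0 : ℝ) 1) : Summable fun n => ‖a n * (r : ℂ) ^ n‖ := by
  have h1 : Summable fun n : ℕ => (r ^ 2) ^ n :=
    summable_geometric_of_lt_one (by positivity) (by nlinarith [hr.1, hr.2])
  refine Summable.of_nonneg_of_le (fun n => norm_nonneg _) (fun n => ?_) (ha.add h1)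
  rw [norm_mul, norm_pow, Complex.norm_real, Real.norm_of_nonneg hr.1.le, ← pow_mul, mul_comm 2 n,
    pow_mul]
  nlinarith [sq_nonneg (‖a n‖ - r ^ n), norm_nonneg (a n), pow_pos hr.1 n]

lemma continuous_circSeries {a : ℕ → ℂ} (ha : Summable fun n => ‖a n‖ ^ 2) {r : ℝ}
    (hr : r ∈ Ioo (0 : ℝ) 1) : Continuous (circSeries a r) := by
  refine continuous_tsum (fun n => by fun_prop) (summable_norm_of_sq ha hr) fun n θ => ?_
  rw [norm_mul, norm_pow, norm_circ, one_pow, mul_one]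

/-- The squared `ℓ²` distance from the coefficients of the dilate to the coefficients. -/
def dilationDefect (a : ℕ → ℂ) (r : ℝ) : ℝ := ∑' n, ‖a n‖ ^ 2 * (1 - r ^ n) ^ 2

lemma summable_dilationDefect {a : ℕ → ℂ} (ha : Summable fun n => ‖a n‖ ^ 2) {r : ℝ}
    (hr : r ∈ Ioo (0 : ℝ) 1) : Summable fun n => ‖a n‖ ^ 2 * (1 - r ^ n) ^ 2 := by
  refine Summable.of_nonneg_of_le (fun n => by positivity) (fun n => ?_) ha
  have h1 := pow_pos hr.1 n
  have h2 := pow_le_one₀ hr.1.le hr.2.le (n := n)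
  exact mul_le_of_le_one_right (by positivity) (by nlinarith)

lemma tendsto_dilationDefect {a : ℕ → ℂ} (ha : Summable fun n => ‖a n‖ ^ 2) {R : ℕ → ℝ}
    (hR : ∀ j, R j ∈ Ioo (0 : ℝ) 1) (hRt : Tendsto R atTop (𝓝 1)) :
    Tendsto (fun j => dilationDefect a (R j)) atTop (𝓝 0) := by
  have : Tendsto (fun j => dilationDefect a (R j)) atTop (𝓝 (∑' n : ℕ, (0 : ℝ))) := by
    refine tendsto_tsum_of_dominated_convergence ha (fun n => ?_) (Eventually.of_forall fun j n => ?_)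
    · have := (((hRt.pow n).const_sub 1).pow 2).const_mul (‖a n‖ ^ 2)
      simpa using this
    · have h1 := pow_pos (hR j).1 n
      have h2 := pow_le_one₀ (hR j).1.le (hR j).2.le (n := n)
      rw [Real.norm_of_nonneg (by positivity)]
      exact mul_le_of_le_one_right (by positivity) (by nlinarith)
  simpa using this

lemma integral_norm_sq_circSeries_le {a : ℕ → ℂ} (ha : Summable fun n => ‖a n‖ ^ 2) {r : ℝ}
    (hr : r ∈ Ioo (0 : ℝ) 1) :
    ∫ θ, ‖circSeries a r θ‖ ^ 2 ∂arc ≤ 2 * π * ∑' n, ‖a n‖ ^ 2 := by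
  have := integral_norm_sq_tsum (summable_norm_of_sq ha hr)
  rw [show (fun θ => ‖circSeries a r θ‖ ^ 2) = fun θ => ‖∑' n, a n * (r : ℂ) ^ n * circ θ ^ n‖ ^ 2
    from rfl, this]
  have hle : ∀ n, ‖a n * (r : ℂ) ^ n‖ ^ 2 ≤ ‖a n‖ ^ 2 := fun n => by
    rw [norm_mul, norm_pow, Complex.norm_real, Real.norm_of_nonneg hr.1.le]
    exact pow_le_pow_left₀ (mul_nonneg (norm_nonneg _) (pow_nonneg hr.1.le n))
      (mul_le_of_le_one_right (norm_nonneg (a n)) (pow_le_one₀ hr.1.le hr.2.le)) 2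
  exact mul_le_mul_of_nonneg_left
    (Summable.tsum_le_tsum hle (Summable.of_nonneg_of_le (fun n => by positivity) hle ha) ha)
    Real.two_pi_pos.le

lemma integral_norm_sq_circSeries_sub_le {a : ℕ → ℂ} (ha : Summable fun n => ‖a n‖ ^ 2) {r ρ : ℝ}
    (hr : r ∈ Ioo (0 : ℝ) 1) (hρ : ρ ∈ Ioo (0 : ℝ) 1) :
    ∫ θ, ‖circSeries a r θ - circSeries a ρ θ‖ ^ 2 ∂arc
      ≤ 4 * π * (dilationDefect a r + dilationDefect a ρ) := by
  have h1 := summable_norm_of_sq ha hr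
  have h2 := summable_norm_of_sq ha hρ
  have hsum : ∀ {r : ℝ}, r ∈ Ioo (0 : ℝ) 1 → ∀ θ,
      Summable fun n => a n * (r : ℂ) ^ n * circ θ ^ n := fun hr θ =>
    Summable.of_norm (by simpa only [norm_mul _ (circ θ ^ _), norm_pow, norm_circ, one_pow, mul_one]
      using summable_norm_of_sq ha hr)
  have h3 : Summable fun n => ‖a n * (r : ℂ) ^ n - a n * (ρ : ℂ) ^ n‖ :=
    Summable.of_nonneg_of_le (fun _ => norm_nonneg _) (fun _ => norm_sub_le _ _) (h1.add h2)
  have h4 : ∀ θ, circSeries a r θ - circSeries a ρ θ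
      = ∑' n, (a n * (r : ℂ) ^ n - a n * (ρ : ℂ) ^ n) * circ θ ^ n := by
    intro θ
    rw [circSeries, circSeries, ← (hsum hr θ).tsum_sub (hsum hρ θ)]
    simp only [sub_mul]
  simp only [h4]
  rw [integral_norm_sq_tsum h3]
  have hle : ∀ n, ‖a n * (r : ℂ) ^ n - a n * (ρ : ℂ) ^ n‖ ^ 2
      ≤ 2 * (‖a n‖ ^ 2 * (1 - r ^ n) ^ 2 + ‖a n‖ ^ 2 * (1 - ρ ^ n) ^ 2) := by
    intro n
    have : a n * (r : ℂ) ^ n - a n * (ρ : ℂ) ^ n = a n * ((r ^ n - ρ ^ n : ℝ) : ℂ) := by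
      push_cast; ring
    rw [this, norm_mul, Complex.norm_real, mul_pow, Real.norm_eq_abs, sq_abs]
    have : (r ^ n - ρ ^ n) ^ 2 ≤ 2 * ((1 - r ^ n) ^ 2 + (1 - ρ ^ n) ^ 2) := by
      nlinarith [sq_nonneg ((1 - r ^ n) + (1 - ρ ^ n))]
    calc _ ≤ ‖a n‖ ^ 2 * (2 * ((1 - r ^ n) ^ 2 + (1 - ρ ^ n) ^ 2)) := by gcongr
      _ = _ := by ring
  have hs := ((summable_dilationDefect ha hr).add (summable_dilationDefect ha hρ)).mul_left 2
  have h5 := Summable.tsum_le_tsum hle (Summable.of_nonneg_of_le (fun n => by positivity) hle hs) hs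
  rw [tsum_mul_left, (summable_dilationDefect ha hr).tsum_add (summable_dilationDefect ha hρ)] at h5
  have := Real.pi_pos
  calc _ ≤ 2 * π * (2 * (dilationDefect a r + dilationDefect a ρ)) := by
        gcongr; exact h5
    _ = _ := by ring

lemma integral_mul_norm_le_sqrt {F G : ℝ → ℂ} (hF : Continuous F) (hG : Continuous G) :
    ∫ θ, ‖F θ‖ * ‖G θ‖ ∂arc ≤ √(∫ θ, ‖F θ‖ ^ 2 ∂arc) * √(∫ θ, ‖G θ‖ ^ 2 ∂arc) := by
  have hmem : ∀ {F : ℝ → ℂ}, Continuous F → MemLp F (ENNReal.ofReal 2) arc := by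
    intro F hF
    rw [ENNReal.ofReal_ofNat, memLp_two_iff_integrable_sq_norm hF.aestronglyMeasurable]
    exact integrable_arc_of_continuous (by fun_prop)
  have := integral_mul_norm_le_Lp_mul_Lq (p := 2) (q := 2)
    Real.HolderConjugate.two_two (hmem hF) (hmem hG)
  simpa only [Real.rpow_two, ← Real.sqrt_eq_rpow] using this

/-- With `φ = a b` a product of `H²` functions, the difference of two dilates is `(a_r - a_ρ) b_r +
a_ρ (b_r - b_ρ)`. Cauchy–Schwarz and Parseval bound its `L¹` norm by the dilation defects of `a` and
`b`. These tend to zero, so the dilates form a Cauchy sequence in `L¹`. -/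
theorem MemHardy.exists_L1_boundary {φ : ℂ → ℂ} (hφ : MemHardy 1 φ) :
    ∃ (u : ℝ → ℂ) (R : ℕ → ℝ), StronglyMeasurable u ∧ Integrable u arc ∧ (∀ j, R j ∈ Ioo (0 : ℝ) 1) ∧ Tendsto R atTop (𝓝 1) ∧
      Tendsto (fun j => ∫ θ, ‖φ (R j * circ θ) - u θ‖ ∂arc) atTop (𝓝 0) := by
  obtain ⟨a, b, ha, hb, hab⟩ := hφ.exists_factorization
  set R : ℕ → ℝ := fun j => 1 - 1 / ((j : ℝ) + 2) with hRdef
  have hR : ∀ j : ℕ, R j ∈ Ioo (0 : ℝ) 1 := by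
    intro j
    have : (0 : ℝ) ≤ j := j.cast_nonneg
    constructor
    · simp only [hRdef]; rw [sub_pos, div_lt_one (by positivity)]; linarith
    · simp only [hRdef]; rw [sub_lt_self_iff]; positivity
  have hRt : Tendsto R atTop (𝓝 1) := by
    have : Tendsto (fun j : ℕ => 1 / ((j : ℝ) + 2)) atTop (𝓝 0) :=
      tendsto_const_nhds.div_atTop (tendsto_atTop_add_const_right _ _ tendsto_natCast_atTop_atTop)
    simpa [hRdef] using this.const_sub 1
  have hφR : ∀ j θ, φ (R j * circ θ) = circSeries a (R j) θ * circSeries b (R j) θ := by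
    intro j θ
    rw [hab _ (by rw [norm_mul, norm_circ, mul_one, Complex.norm_real,
      Real.norm_of_nonneg (hR j).1.le]; exact (hR j).2)]
    simp only [circSeries, mul_pow, mul_assoc]
  set Ka := 2 * π * ∑' n, ‖a n‖ ^ 2
  set Kb := 2 * π * ∑' n, ‖b n‖ ^ 2
  set t : ℕ → ℝ := fun j => √(4 * π * dilationDefect a (R j)) * √Kb
    + √Ka * √(4 * π * dilationDefect b (R j)) with ht
  have htt : Tendsto t atTop (𝓝 0) := by
    have h1 := (((tendsto_dilationDefect ha hR hRt).const_mul (4 * π)).sqrt).mul_const √Kb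
    have h2 := (((tendsto_dilationDefect hb hR hRt).const_mul (4 * π)).sqrt).const_mul √Ka
    simpa [ht] using h1.add h2
  have hdd : ∀ (a : ℕ → ℂ) r, 0 ≤ dilationDefect a r := fun a r =>
    tsum_nonneg fun n => by positivity
  have hsqrt : ∀ x y : ℝ, 0 ≤ x → 0 ≤ y → √(4 * π * (x + y)) ≤ √(4 * π * x) + √(4 * π * y) := by
    intro x y hx hy
    have := Real.pi_pos
    rw [mul_add, Real.sqrt_le_iff]
    refine ⟨by positivity, ?_⟩
    have e1 := Real.sq_sqrt (show 0 ≤ 4 * π * x by positivity)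
    have e2 := Real.sq_sqrt (show 0 ≤ 4 * π * y by positivity)
    nlinarith [Real.sqrt_nonneg (4 * π * x), Real.sqrt_nonneg (4 * π * y),
      mul_nonneg (Real.sqrt_nonneg (4 * π * x)) (Real.sqrt_nonneg (4 * π * y))]
  have key : ∀ n m, ∫ θ, ‖φ (R n * circ θ) - φ (R m * circ θ)‖ ∂arc ≤ t n + t m := by
    intro n m
    have ca := fun j => continuous_circSeries ha (hR j)
    have cb := fun j => continuous_circSeries hb (hR j)
    have can := ca n
    have cam := ca m
    have cbn := cb n
    have cbm := cb m
    simp only [hφR]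
    calc ∫ θ, ‖circSeries a (R n) θ * circSeries b (R n) θ
          - circSeries a (R m) θ * circSeries b (R m) θ‖ ∂arc
        ≤ ∫ θ, (‖circSeries a (R n) θ - circSeries a (R m) θ‖ * ‖circSeries b (R n) θ‖
          + ‖circSeries a (R m) θ‖ * ‖circSeries b (R n) θ - circSeries b (R m) θ‖) ∂arc := by
          refine integral_mono (integrable_arc_of_continuous (by fun_prop))
            (integrable_arc_of_continuous (by fun_prop)) fun θ => ?_
          rw [← norm_mul, ← norm_mul]
          refine le_trans (le_of_eq ?_) (norm_add_le _ _)
          congr 1; ring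
      _ = ∫ θ, ‖circSeries a (R n) θ - circSeries a (R m) θ‖ * ‖circSeries b (R n) θ‖ ∂arc
          + ∫ θ, ‖circSeries a (R m) θ‖ * ‖circSeries b (R n) θ - circSeries b (R m) θ‖ ∂arc :=
          integral_add (integrable_arc_of_continuous (by fun_prop))
            (integrable_arc_of_continuous (by fun_prop))
      _ ≤ √(4 * π * (dilationDefect a (R n) + dilationDefect a (R m))) * √Kb
          + √Ka * √(4 * π * (dilationDefect b (R n) + dilationDefect b (R m))) := by
          refine add_le_add ((integral_mul_norm_le_sqrt (can.sub cam) cbn).trans ?_)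
            ((integral_mul_norm_le_sqrt cam (cbn.sub cbm)).trans ?_)
          · gcongr
            · exact integral_norm_sq_circSeries_sub_le ha (hR n) (hR m)
            · exact integral_norm_sq_circSeries_le hb (hR n)
          · gcongr
            · exact integral_norm_sq_circSeries_le ha (hR m)
            · exact integral_norm_sq_circSeries_sub_le hb (hR n) (hR m)
      _ ≤ (√(4 * π * dilationDefect a (R n)) + √(4 * π * dilationDefect a (R m))) * √Kb
          + √Ka * (√(4 * π * dilationDefect b (R n)) + √(4 * π * dilationDefect b (R m))) := by
          gcongr
          all_goals exact hsqrt _ _ (hdd _ _) (hdd _ _)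
      _ = t n + t m := by simp only [ht]; ring
  obtain ⟨u, hum, hu, hut⟩ := exists_L1_limit (μ := arc) (F := fun j θ => φ (R j * circ θ))
    (fun j => integrable_arc_of_continuous (hφ.1.continuous_circle (hR j))) htt key
  exact ⟨u, R, hum, hu, hR, hRt, hut⟩

/-! ### The Cauchy kernel at a Lebesgue point -/

/-- The integrand is minus the derivative of `δ / (δ² + ρ²)`. The kernel is thus a superposition of
indicators of the intervals `|t| < ρ`, which suits Lebesgue point averages. -/
lemma lintegral_Ioi_cauchyKernel_deriv {δ : ℝ} (hδ : 0 < δ) {a : ℝ} (ha : 0 ≤ a) :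
    ∫⁻ ρ in Ioi a, ENNReal.ofReal (2 * δ * ρ / (δ ^ 2 + ρ ^ 2) ^ 2)
      = ENNReal.ofReal (δ / (δ ^ 2 + a ^ 2)) := by
  have hd : ∀ ρ ∈ Ici a, HasDerivAt (fun ρ : ℝ => -(δ / (δ ^ 2 + ρ ^ 2)))
      (2 * δ * ρ / (δ ^ 2 + ρ ^ 2) ^ 2) ρ := by
    intro ρ _
    have h0 : δ ^ 2 + ρ ^ 2 ≠ 0 := by positivity
    have := (((hasDerivAt_pow 2 ρ).const_add (δ ^ 2)).inv h0).const_mul (-δ)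
    have h2 : HasDerivAt (fun ρ : ℝ => -δ * (δ ^ 2 + ρ ^ 2)⁻¹)
        (2 * δ * ρ / (δ ^ 2 + ρ ^ 2) ^ 2) ρ := this.congr_deriv (by field_simp; simp; ring)
    simpa [div_eq_mul_inv] using h2
  have hnn : ∀ ρ ∈ Ioi a, 0 ≤ 2 * δ * ρ / (δ ^ 2 + ρ ^ 2) ^ 2 := by
    intro ρ hρ
    have : 0 < ρ := ha.trans_lt hρ
    positivity
  have hlim : Tendsto (fun ρ : ℝ => -(δ / (δ ^ 2 + ρ ^ 2))) atTop (𝓝 0) := by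
    have : Tendsto (fun ρ : ℝ => δ / (δ ^ 2 + ρ ^ 2)) atTop (𝓝 0) :=
      tendsto_const_nhds.div_atTop
        (tendsto_atTop_add_const_left _ _ (tendsto_pow_atTop two_ne_zero))
    simpa using this.neg
  have hint := integrableOn_Ioi_deriv_of_nonneg' hd hnn hlim
  rw [← ofReal_integral_eq_lintegral_ofReal hint
    ((ae_restrict_iff' measurableSet_Ioi).2 (ae_of_all _ hnn)),
    integral_Ioi_of_hasDerivAt_of_nonneg' hd hnn hlim]
  simp

/-- The integrand is at most `2δ / (δ² + ρ²)`, whose primitive is `2 arctan (ρ/δ)`; what matters is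
that the bound does not depend on `δ`. -/
lemma lintegral_Ioi_cauchyKernel_le {δ : ℝ} (hδ : 0 < δ) :
    ∫⁻ ρ in Ioi (0 : ℝ), ENNReal.ofReal (2 * δ * ρ / (δ ^ 2 + ρ ^ 2) ^ 2 * ρ)
      ≤ ENNReal.ofReal π := by
  have hd : ∀ ρ ∈ Ici (0 : ℝ), HasDerivAt (fun ρ : ℝ => 2 * arctan (ρ / δ))
      (2 * δ / (δ ^ 2 + ρ ^ 2)) ρ := by
    intro ρ _
    have := ((hasDerivAt_id ρ).div_const δ).arctan.const_mul 2
    have h0 : δ ^ 2 + ρ ^ 2 ≠ 0 := by positivity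
    exact this.congr_deriv (by simp only [id]; field_simp)
  have hnn : ∀ ρ ∈ Ioi (0 : ℝ), 0 ≤ 2 * δ / (δ ^ 2 + ρ ^ 2) := fun ρ _ => by positivity
  have hlim : Tendsto (fun ρ : ℝ => 2 * arctan (ρ / δ)) atTop (𝓝 (2 * (π / 2))) :=
    ((tendsto_nhds_of_tendsto_nhdsWithin tendsto_arctan_atTop).comp
      (tendsto_id.atTop_div_const hδ)).const_mul 2
  have hint := integrableOn_Ioi_deriv_of_nonneg' hd hnn hlim
  have h1 : ∫⁻ ρ in Ioi (0 : ℝ), ENNReal.ofReal (2 * δ / (δ ^ 2 + ρ ^ 2)) = ENNReal.ofReal π := by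
    rw [← ofReal_integral_eq_lintegral_ofReal hint
      ((ae_restrict_iff' measurableSet_Ioi).2 (ae_of_all _ hnn)),
      integral_Ioi_of_hasDerivAt_of_nonneg' hd hnn hlim]
    congr 1; simp; ring
  rw [← h1]
  refine lintegral_mono fun ρ => ENNReal.ofReal_le_ofReal ?_
  have h0 : 0 < δ ^ 2 + ρ ^ 2 := by positivity
  rw [div_mul_eq_mul_div, div_le_div_iff₀ (by positivity) h0]
  have : 0 ≤ 2 * δ * (δ ^ 2 + ρ ^ 2) * δ ^ 2 := by positivity
  nlinarith

/-- The Cauchy kernels form an approximate identity at a Lebesgue point. -/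
lemma tendsto_lintegral_cauchyKernel {h : ℝ → ℝ≥0∞} (hm : Measurable h)
    (hfin : ∫⁻ t, h t ≠ ∞)
    (hL : ∀ ε : ℝ, 0 < ε → ∃ η : ℝ, 0 < η ∧ ∀ ρ, 0 < ρ → ρ ≤ η →
      ∫⁻ t in {t | |t| < ρ}, h t ≤ ENNReal.ofReal (ε * ρ)) :
    Tendsto (fun δ : ℝ => ∫⁻ t, ENNReal.ofReal (δ / (δ ^ 2 + t ^ 2)) * h t) (𝓝[>] 0) (𝓝 0) := by
  set w : ℝ → ℝ → ℝ≥0∞ := fun δ ρ => ENNReal.ofReal (2 * δ * ρ / (δ ^ 2 + ρ ^ 2) ^ 2) with hw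
  have hwm : ∀ δ, Measurable (w δ) := fun δ => by rw [hw]; fun_prop
  -- Layer-cake formula: the kernel is written as an integral over `ρ > |t|`, and the order of
  -- integration is exchanged.
  have key : ∀ δ : ℝ, 0 < δ → ∫⁻ t, ENNReal.ofReal (δ / (δ ^ 2 + t ^ 2)) * h t
      = ∫⁻ ρ in Ioi (0 : ℝ), w δ ρ * ∫⁻ t in {t | |t| < ρ}, h t := by
    intro δ hδ
    have hS : MeasurableSet {p : ℝ × ℝ | |p.1| < p.2} :=
      measurableSet_lt (by fun_prop) (by fun_prop)
    set F : ℝ → ℝ → ℝ≥0∞ := fun t ρ =>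
      {p : ℝ × ℝ | |p.1| < p.2}.indicator (fun p => w δ p.2 * h p.1) (t, ρ) with hF
    have hFm : Measurable (Function.uncurry F) := by
      have : Measurable fun p : ℝ × ℝ => w δ p.2 * h p.1 :=
        ((hwm δ).comp measurable_snd).mul (hm.comp measurable_fst)
      exact this.indicator hS
    have e1 : ∀ t, ENNReal.ofReal (δ / (δ ^ 2 + t ^ 2)) * h t = ∫⁻ ρ in Ioi 0, F t ρ := by
      intro t
      rw [← sq_abs t, ← lintegral_Ioi_cauchyKernel_deriv hδ (abs_nonneg t),
        ← lintegral_mul_const _ (hwm δ), ← lintegral_indicator measurableSet_Ioi,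
        ← lintegral_indicator measurableSet_Ioi]
      congr 1; ext ρ
      by_cases h1 : |t| < ρ
      · have : 0 < ρ := (abs_nonneg t).trans_lt h1
        simp [hF, indicator, h1, this, hw]
      · simp [hF, indicator, h1]
    simp only [e1]
    rw [lintegral_lintegral_swap hFm.aemeasurable]
    refine lintegral_congr fun ρ => ?_
    have hSρ : MeasurableSet {t : ℝ | |t| < ρ} := measurableSet_lt (by fun_prop) (by fun_prop)
    rw [← lintegral_const_mul _ hm, ← lintegral_indicator hSρ]
    congr 1
  rw [ENNReal.tendsto_nhds_zero]
  intro ε hε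
  obtain ⟨ε', hε'0, hε'⟩ : ∃ ε' : ℝ, 0 < ε' ∧ ENNReal.ofReal (2 * ε') ≤ ε := by
    rcases eq_or_ne ε ∞ with rfl | hε2
    · exact ⟨1, one_pos, le_top⟩
    · refine ⟨ε.toReal / 2, half_pos (ENNReal.toReal_pos hε.ne' hε2), ?_⟩
      rw [mul_div_cancel₀ _ two_ne_zero, ENNReal.ofReal_toReal hε2]
  -- The divisor `π` absorbs the total weight on `ρ ≤ η`. Beyond `η` the full mass `A` is multiplied
  -- by `δ / (δ² + η²)`, which tends to zero.
  obtain ⟨η, hη, hη'⟩ := hL (ε' / π) (by positivity)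
  set A := (∫⁻ t, h t).toReal with hA
  have hAeq : ∫⁻ t, h t = ENNReal.ofReal A := (ENNReal.ofReal_toReal hfin).symm
  have hA0 : 0 ≤ A := ENNReal.toReal_nonneg
  have hlim : Tendsto (fun δ : ℝ => δ / (δ ^ 2 + η ^ 2) * A) (𝓝[>] 0) (𝓝 0) := by
    have hc : ContinuousAt (fun δ : ℝ => δ / (δ ^ 2 + η ^ 2) * A) 0 := by
      have : (0 : ℝ) ^ 2 + η ^ 2 ≠ 0 := by positivity
      fun_prop (disch := assumption)
    have := hc.tendsto
    simp only [zero_div, zero_mul] at this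
    exact this.mono_left nhdsWithin_le_nhds
  filter_upwards [self_mem_nhdsWithin, hlim.eventually (gt_mem_nhds hε'0)] with δ hδ hδ2
  have hδ : 0 < δ := hδ
  rw [key δ hδ, ← Ioc_union_Ioi_eq_Ioi hη.le,
    lintegral_union measurableSet_Ioi (Ioc_disjoint_Ioi le_rfl)]
  have b1 : ∫⁻ ρ in Ioc 0 η, w δ ρ * ∫⁻ t in {t | |t| < ρ}, h t ≤ ENNReal.ofReal ε' := by
    calc _ ≤ ∫⁻ ρ in Ioc 0 η,
          ENNReal.ofReal (ε' / π) * ENNReal.ofReal (2 * δ * ρ / (δ ^ 2 + ρ ^ 2) ^ 2 * ρ) := by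
          refine setLIntegral_mono' measurableSet_Ioc fun ρ hρ => ?_
          refine (mul_le_mul_right (hη' ρ hρ.1 hρ.2) _).trans (le_of_eq ?_)
          have : 0 < ρ := hρ.1
          rw [hw, ← ENNReal.ofReal_mul (by positivity), ← ENNReal.ofReal_mul (by positivity)]
          congr 1; ring
      _ ≤ ∫⁻ ρ in Ioi 0,
          ENNReal.ofReal (ε' / π) * ENNReal.ofReal (2 * δ * ρ / (δ ^ 2 + ρ ^ 2) ^ 2 * ρ) :=
          lintegral_mono_set Ioc_subset_Ioi_self
      _ ≤ ENNReal.ofReal (ε' / π) * ENNReal.ofReal π := by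
          rw [lintegral_const_mul _ (by fun_prop)]
          exact mul_le_mul_right (lintegral_Ioi_cauchyKernel_le hδ) _
      _ = ENNReal.ofReal ε' := by
          rw [← ENNReal.ofReal_mul (by positivity), div_mul_cancel₀ _ Real.pi_ne_zero]
  have b2 : ∫⁻ ρ in Ioi η, w δ ρ * ∫⁻ t in {t | |t| < ρ}, h t ≤ ENNReal.ofReal ε' := by
    calc _ ≤ ∫⁻ ρ in Ioi η, w δ ρ * ENNReal.ofReal A := by
          refine lintegral_mono fun ρ => mul_le_mul_right ?_ _
          rw [← hAeq]; exact setLIntegral_le_lintegral _ _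
      _ = ENNReal.ofReal (δ / (δ ^ 2 + η ^ 2)) * ENNReal.ofReal A := by
          rw [lintegral_mul_const _ (hwm δ), hw, lintegral_Ioi_cauchyKernel_deriv hδ hη.le]
      _ ≤ ENNReal.ofReal ε' := by
          rw [← ENNReal.ofReal_mul (by positivity)]
          exact ENNReal.ofReal_le_ofReal hδ2.le
  refine (add_le_add b1 b2).trans ?_
  rw [← ENNReal.ofReal_add hε'0.le hε'0.le, ← two_mul]
  exact hε'

/-! ### Radial limits -/

lemma norm_circ_sub_circ (a b : ℝ) : ‖circ a - circ b‖ = 2 * |sin ((a - b) / 2)| := by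
  have h1 : circ a - circ b = circ b * (circ (a - b) - 1) := by
    rw [mul_sub, ← circ_add]; simp
  rw [h1, norm_mul, norm_circ, one_mul, circ, mul_comm, Complex.norm_exp_I_mul_ofReal_sub_one]
  simp

/-- On `|t| ≤ π`, the chord is comparable to the arc. -/
lemma two_div_pi_mul_abs_le_norm_circ_sub {a b : ℝ} (h : |a - b| ≤ π) :
    2 / π * |a - b| ≤ ‖circ a - circ b‖ := by
  rw [norm_circ_sub_circ]
  have h1 := Real.mul_abs_le_abs_sin (x := (a - b) / 2) (by rw [abs_div, abs_two]; linarith)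
  rw [abs_div, abs_two] at h1
  linarith

/-- In the coordinate `(0, 2π]` points near the two ends are close on the circle but far apart as
numbers. Chord and difference are therefore comparable only with a constant depending on the
distance `c` from `b` to the ends. -/
lemma exists_mul_abs_le_norm_circ_sub {b : ℝ} (hb : b ∈ Ioo 0 (2 * π)) :
    ∃ m : ℝ, 0 < m ∧ ∀ a ∈ Ioc 0 (2 * π), m * |a - b| ≤ ‖circ a - circ b‖ := by
  have hpi := Real.pi_pos
  set c := min b (2 * π - b) with hc
  have hc0 : 0 < c := lt_min hb.1 (by linarith [hb.2])
  have hcpi : c ≤ π := by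
    rcases le_total b π with h | h
    · exact (min_le_left _ _).trans h
    · exact (min_le_right _ _).trans (by linarith)
  refine ⟨c / π ^ 2, by positivity, fun a ha => ?_⟩
  have habs : |a - b| ≤ 2 * π - c := by
    have h1 : c ≤ b := min_le_left _ _
    have h2 : c ≤ 2 * π - b := min_le_right _ _
    rw [abs_le]; constructor <;> linarith [ha.1, ha.2]
  rcases le_total |a - b| π with h | h
  · refine le_trans ?_ (two_div_pi_mul_abs_le_norm_circ_sub h)
    gcongr ?_ * _
    rw [div_le_div_iff₀ (by positivity) hpi]
    nlinarith
  · rw [norm_circ_sub_circ]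
    have h2 : |sin ((a - b) / 2)| = sin (π - |a - b| / 2) := by
      rw [Real.sin_pi_sub, ← abs_two, ← abs_div, abs_two]
      rcases abs_cases ((a - b) / 2) with ⟨h3, -⟩ | ⟨h3, -⟩
      · rw [h3, abs_of_nonneg]
        rw [← h3]
        refine Real.sin_nonneg_of_nonneg_of_le_pi (abs_nonneg _) ?_
        rw [abs_div, abs_two]; linarith
      · rw [h3, Real.sin_neg, abs_of_nonpos]
        rw [← neg_nonneg, ← Real.sin_neg, ← h3]
        refine Real.sin_nonneg_of_nonneg_of_le_pi (abs_nonneg _) ?_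
        rw [abs_div, abs_two]; linarith
    rw [h2]
    have h3 := Real.mul_le_sin (x := π - |a - b| / 2) (by linarith) (by linarith)
    have h4 : c / π ^ 2 * |a - b| ≤ c / π ^ 2 * (2 * π) := by
      gcongr; linarith
    have h5 : c / π ^ 2 * (2 * π) = 2 / π * c := by field_simp
    have h6 : 2 / π * c ≤ 2 * (2 / π * (π - |a - b| / 2)) := by
      have : 2 * (2 / π * (π - |a - b| / 2)) = 2 / π * (2 * π - |a - b|) := by ring
      rw [this]; gcongr; linarith
    linarith

lemma tendsto_integral_mul_of_L1 {X : Type*} [MeasurableSpace X] {μ : Measure X}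
    {F : ℕ → X → ℂ} {u K : X → ℂ} (hF : ∀ n, Integrable (F n) μ) (hu : Integrable u μ)
    (h : Tendsto (fun n => ∫ x, ‖F n x - u x‖ ∂μ) atTop (𝓝 0))
    (hK : AEStronglyMeasurable K μ) {C : ℝ} (hC : ∀ x, ‖K x‖ ≤ C) :
    Tendsto (fun n => ∫ x, F n x * K x ∂μ) atTop (𝓝 (∫ x, u x * K x ∂μ)) := by
  have hi : ∀ {G : X → ℂ}, Integrable G μ → Integrable (fun x => G x * K x) μ := fun hG =>
    hG.mul_bdd hK (ae_of_all _ hC)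
  rw [tendsto_iff_norm_sub_tendsto_zero]
  refine squeeze_zero (fun _ => norm_nonneg _) (fun n => ?_) (by simpa using h.mul_const C)
  rw [← integral_sub (hi (hF n)) (hi hu), ← integral_mul_const]
  refine norm_integral_le_of_norm_le (((hF n).sub hu).norm.mul_const C) (ae_of_all _ fun x => ?_)
  rw [← sub_mul, norm_mul]
  exact mul_le_mul_of_nonneg_left (hC x) (norm_nonneg _)

lemma Holo.diffContOnCl_dilate {f : ℂ → ℂ} (hf : Holo f) {r : ℝ} (hr : r ∈ Ioo (0 : ℝ) 1) :
    DifferentiableOn ℂ (fun z => f (r * z)) (Metric.ball 0 r⁻¹) := by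
  refine hf.comp (by fun_prop) fun z hz => ?_
  rw [Metric.mem_ball, dist_zero_right] at hz
  rw [mem_unitDisk, norm_mul, Complex.norm_real, Real.norm_of_nonneg hr.1.le]
  calc r * ‖z‖ < r * r⁻¹ := by gcongr; exact hr.1
    _ = 1 := mul_inv_cancel₀ hr.1.ne'

lemma closedBall_subset_ball_inv {r : ℝ} (hr : r ∈ Ioo (0 : ℝ) 1) :
    Metric.closedBall (0 : ℂ) 1 ⊆ Metric.ball 0 r⁻¹ :=
  Metric.closedBall_subset_ball (one_lt_inv₀ hr.1 |>.2 hr.2)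

lemma diffContOnCl_of_differentiableOn_ball {f : ℂ → ℂ} {r : ℝ} (hr : r ∈ Ioo (0 : ℝ) 1)
    (hf : DifferentiableOn ℂ f (Metric.ball 0 r⁻¹)) : DiffContOnCl ℂ f (Metric.ball 0 1) := by
  refine DifferentiableOn.diffContOnCl (hf.mono ?_)
  rw [closure_ball _ one_ne_zero]
  exact closedBall_subset_ball_inv hr

/-- The Poisson kernel of the disk on the circle. -/
def poisson (w : ℂ) (θ : ℝ) : ℝ := (1 - ‖w‖ ^ 2) / ‖circ θ - w‖ ^ 2

lemma circ_sub_ne_zero {w : ℂ} (hw : ‖w‖ < 1) (θ : ℝ) : circ θ - w ≠ 0 := by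
  intro h
  have := norm_circ θ
  rw [sub_eq_zero.1 h] at this; linarith

lemma continuous_poisson {w : ℂ} (hw : ‖w‖ < 1) : Continuous (poisson w) := by
  unfold poisson
  refine Continuous.div (by fun_prop) (by fun_prop) fun θ => ?_
  have := norm_pos_iff.2 (circ_sub_ne_zero hw θ)
  positivity

lemma poisson_nonneg {w : ℂ} (hw : ‖w‖ < 1) (θ : ℝ) : 0 ≤ poisson w θ :=
  div_nonneg (by nlinarith [norm_nonneg w]) (by positivity)

lemma integral_mul_poisson {f : ℂ → ℂ} (hf : DiffContOnCl ℂ f (Metric.ball 0 1)) {w : ℂ}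
    (hw : ‖w‖ < 1) : ∫ θ, f (circ θ) * poisson w θ ∂arc = 2 * π * f w := by
  have h := DiffContOnCl.circleAverage_poissonKernel_smul' (c := 0) (w := w) hf (by simpa using hw)
  rw [← h, ← integral_arc_eq_circleAverage]
  simp only [sub_zero, norm_circ, poisson, one_pow, Complex.real_smul, mul_comm]

lemma norm_poisson_le {w : ℂ} (hw : ‖w‖ < 1) (θ : ℝ) :
    ‖(poisson w θ : ℂ)‖ ≤ 2 / (1 - ‖w‖) := by
  rw [Complex.norm_real, Real.norm_of_nonneg (poisson_nonneg hw θ), poisson]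
  have h1 : 1 - ‖w‖ ≤ ‖circ θ - w‖ := by
    have := norm_sub_norm_le (circ θ) w
    rwa [norm_circ] at this
  have h2 : 0 < 1 - ‖w‖ := by linarith
  calc (1 - ‖w‖ ^ 2) / ‖circ θ - w‖ ^ 2 ≤ (1 - ‖w‖ ^ 2) / (1 - ‖w‖) ^ 2 := by
        gcongr
        nlinarith [norm_nonneg w]
    _ ≤ 2 / (1 - ‖w‖) := by
        rw [div_le_div_iff₀ (by positivity) h2]
        nlinarith [norm_nonneg w]

/-- `H¹` functions are Poisson integrals of their boundary functions, which are radial limits. -/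
theorem MemHardy.exists_boundary {φ : ℂ → ℂ} (hφ : MemHardy 1 φ) :
    ∃ (u : ℝ → ℂ) (R : ℕ → ℝ), Integrable u arc ∧ (∀ j, R j ∈ Ioo (0 : ℝ) 1) ∧
      Tendsto R atTop (𝓝 1) ∧
      Tendsto (fun j => ∫ θ, ‖φ (R j * circ θ) - u θ‖ ∂arc) atTop (𝓝 0) ∧
      ∀ᵐ θ ∂arc, Tendsto (fun r : ℝ => φ (r * circ θ)) (𝓝[<] 1) (𝓝 (u θ)) := by
  obtain ⟨u, R, hum, hu, hR, hRt, hRu⟩ := hφ.exists_L1_boundary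
  refine ⟨u, R, hu, hR, hRt, hRu, ?_⟩
  -- The Poisson formula holds for the dilates; the kernel at a fixed `w` is bounded, so the `L¹`
  -- limit may be taken under the integral.
  have hpois : ∀ w : ℂ, ‖w‖ < 1 → ∫ θ, u θ * poisson w θ ∂arc = 2 * π * φ w := by
    intro w hw
    have h1 := tendsto_integral_mul_of_L1 (μ := arc) (F := fun j θ => φ (R j * circ θ))
      (K := fun θ => (poisson w θ : ℂ))
      (fun j => integrable_arc_of_continuous (hφ.1.continuous_circle (hR j))) hu hRu
      (Complex.continuous_ofReal.comp (continuous_poisson hw)).aestronglyMeasurable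
      (norm_poisson_le hw)
    have h2 : ∀ j, ∫ θ, φ (R j * circ θ) * poisson w θ ∂arc = 2 * π * φ (R j * w) := fun j =>
      integral_mul_poisson (f := fun z => φ (R j * z))
        (diffContOnCl_of_differentiableOn_ball (hR j) (hφ.1.diffContOnCl_dilate (hR j))) hw
    simp only [h2] at h1
    refine tendsto_nhds_unique h1 (Tendsto.const_mul _ ?_)
    have hca : ContinuousAt φ w := hφ.1.continuousOn.continuousAt
      (Metric.isOpen_ball.mem_nhds (mem_unitDisk.2 hw))
    refine Tendsto.comp hca ?_
    have := ((Complex.continuous_ofReal.tendsto _).comp hRt).mul_const w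
    simpa using this
  set S : Set ℝ := Ioc 0 (2 * π) with hS
  have hSm : MeasurableSet S := measurableSet_Ioc
  have hUi : Integrable (S.indicator u) := (integrable_indicator_iff hSm).2 hu
  have hLeb := (Besicovitch.vitaliFamily (volume : Measure ℝ)).ae_tendsto_lintegral_enorm_sub_div
    hUi.locallyIntegrable
  -- The chord comparison needs `b` in the interior of the parameter interval.
  have hne : ∀ᵐ θ : ℝ, θ ≠ 2 * π := by simp [ae_iff, measure_singleton]
  rw [arc, ae_restrict_iff' hSm]
  filter_upwards [hLeb, hne] with b hb hb2 hbS
  have hbI : b ∈ Ioo 0 (2 * π) := ⟨hbS.1, lt_of_le_of_ne hbS.2 hb2⟩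
  obtain ⟨m, hm0, hm⟩ := exists_mul_abs_le_norm_circ_sub hbI
  have hub : S.indicator u b = u b := indicator_of_mem hbS u
  rw [hub] at hb
  -- The oscillation of `u` about its value at `b`, cut off to the parameter interval and recentred
  -- at `0`.
  set h : ℝ → ℝ≥0∞ := fun t => S.indicator (fun a => ‖u a - u b‖ₑ) (b + t) with hh
  have hum' : Measurable fun a => ‖u a - u b‖ₑ := (hum.measurable.sub_const _).enorm
  have hhm : Measurable h := (hum'.indicator hSm).comp (measurable_const_add b)
  have hhfin : ∫⁻ t, h t ≠ ∞ := by
    rw [hh, lintegral_add_left_eq_self (fun t => S.indicator (fun a => ‖u a - u b‖ₑ) t) b,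
      lintegral_indicator hSm]
    exact (hu.sub (integrable_const (μ := arc) (u b))).2.ne
  have hhL : ∀ ε : ℝ, 0 < ε → ∃ η : ℝ, 0 < η ∧ ∀ ρ, 0 < ρ → ρ ≤ η →
      ∫⁻ t in {t | |t| < ρ}, h t ≤ ENNReal.ofReal (ε * ρ) := by
    intro ε hε
    have h1 := hb.comp (Besicovitch.tendsto_filterAt volume b)
    -- The ball of radius `ρ` has length `2ρ`, hence `ε / 2`.
    have h2 := (ENNReal.tendsto_nhds_zero.1 h1) (ENNReal.ofReal (ε / 2)) (by simpa using hε)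
    rw [eventually_nhdsWithin_iff, Metric.eventually_nhds_iff] at h2
    obtain ⟨η, hη, hη2⟩ := h2
    refine ⟨η / 2, half_pos hη, fun ρ hρ0 hρ => ?_⟩
    have h3 := hη2 (y := ρ) (by rw [dist_zero_right, Real.norm_of_nonneg hρ0.le]; linarith) hρ0
    simp only [Function.comp_apply, Real.volume_closedBall] at h3
    rw [ENNReal.div_le_iff (by simpa using hρ0) ENNReal.ofReal_ne_top,
      ← ENNReal.ofReal_mul (by positivity)] at h3
    refine le_trans ?_ (h3.trans (le_of_eq (by congr 1; ring)))
    have hSρ : MeasurableSet {t : ℝ | |t| < ρ} := measurableSet_lt (by fun_prop) (by fun_prop)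
    rw [← lintegral_indicator hSρ, ← lintegral_indicator measurableSet_closedBall,
      ← lintegral_add_left_eq_self
        ((Metric.closedBall b ρ).indicator fun y => ‖S.indicator u y - u b‖ₑ) b]
    refine lintegral_mono fun t => ?_
    by_cases ht : |t| < ρ
    · have ht' : b + t ∈ Metric.closedBall b ρ := by
        rw [Metric.mem_closedBall, Real.dist_eq, add_sub_cancel_left]; exact ht.le
      rw [indicator_of_mem (show t ∈ {t : ℝ | |t| < ρ} from ht), indicator_of_mem ht', hh]
      by_cases hts : b + t ∈ S
      · simp only [indicator_of_mem hts, le_refl]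
      · simp only [indicator_of_notMem hts, zero_le]
    · rw [indicator_of_notMem (show t ∉ {t : ℝ | |t| < ρ} from ht)]; exact zero_le
  have hCauchy := tendsto_lintegral_cauchyKernel hhm hhfin hhL
  -- The Poisson kernel at `r e^{ib}` is dominated by the Cauchy kernel with `δ = 1 - r`: the
  -- distance `X` from `e^{ia}` to `r e^{ib}` is at least `1 - r` and at least `m |a - b| / 2`.
  obtain ⟨C, hC0, hC⟩ : ∃ C : ℝ, 0 ≤ C ∧ ∀ r : ℝ, r ∈ Ioo (0 : ℝ) 1 → ∀ a ∈ S,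
      poisson (r * circ b) a ≤ C * ((1 - r) / ((1 - r) ^ 2 + (a - b) ^ 2)) := by
    refine ⟨2 * (1 + 4 / m ^ 2), by positivity, fun r hr a ha => ?_⟩
    have hrn : ‖(r : ℂ) * circ b‖ = r := by
      rw [norm_mul, norm_circ, mul_one, Complex.norm_real, Real.norm_of_nonneg hr.1.le]
    set X := ‖circ a - r * circ b‖ with hX
    have hX1 : 1 - r ≤ X := by
      have := norm_sub_norm_le (circ a) (r * circ b)
      rwa [norm_circ, hrn] at this
    have hX2 : m * |a - b| ≤ 2 * X := by
      refine (hm a ha).trans ?_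
      have e1 : circ a - circ b = (circ a - r * circ b) - (1 - r : ℝ) * circ b := by
        push_cast; ring
      have e2 : ‖((1 - r : ℝ) : ℂ) * circ b‖ = 1 - r := by
        rw [norm_mul, norm_circ, mul_one, Complex.norm_real,
          Real.norm_of_nonneg (by linarith [hr.2])]
      rw [e1]
      refine (norm_sub_le _ _).trans ?_
      rw [e2]; linarith
    have h1r : 0 < 1 - r := by linarith [hr.2]
    have hX0 : 0 < X := h1r.trans_le hX1
    rw [poisson, hrn, ← hX]
    have hXX : (1 - r) ^ 2 + (a - b) ^ 2 ≤ (1 + 4 / m ^ 2) * X ^ 2 := by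
      have e1 : (1 - r) ^ 2 ≤ X ^ 2 := by gcongr
      have e2 : (m * |a - b|) ^ 2 ≤ (2 * X) ^ 2 := by gcongr
      rw [mul_pow, sq_abs, mul_pow] at e2
      have e3 : (a - b) ^ 2 ≤ 4 / m ^ 2 * X ^ 2 := by
        rw [div_mul_eq_mul_div, le_div_iff₀ (by positivity)]; linarith
      linarith
    have hnn : 0 < (1 - r) ^ 2 + (a - b) ^ 2 := by positivity
    rw [← mul_div_assoc, div_le_div_iff₀ (by positivity) hnn]
    calc (1 - r ^ 2) * ((1 - r) ^ 2 + (a - b) ^ 2)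
        ≤ (2 * (1 - r)) * ((1 + 4 / m ^ 2) * X ^ 2) := by
          gcongr
          nlinarith [hr.1]
      _ = _ := by ring
  rw [tendsto_iff_edist_tendsto_0]
  have hlim : Tendsto (fun r : ℝ => ENNReal.ofReal C *
      ∫⁻ t, ENNReal.ofReal ((1 - r) / ((1 - r) ^ 2 + t ^ 2)) * h t) (𝓝[<] 1) (𝓝 0) := by
    have h1 : Tendsto (fun r : ℝ => 1 - r) (𝓝[<] 1) (𝓝[>] 0) := by
      refine tendsto_nhdsWithin_iff.2 ⟨?_, ?_⟩
      · have : Tendsto (fun r : ℝ => 1 - r) (𝓝 1) (𝓝 (1 - 1)) := by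
          exact (continuous_const.sub continuous_id).tendsto _
        rw [sub_self] at this
        exact this.mono_left nhdsWithin_le_nhds
      · filter_upwards [self_mem_nhdsWithin] with r hr
        exact sub_pos.2 (mem_Iio.1 hr)
    have h2 := ENNReal.Tendsto.const_mul (hCauchy.comp h1)
      (Or.inr (ENNReal.ofReal_ne_top (r := C)))
    simpa using h2
  refine tendsto_of_tendsto_of_tendsto_of_le_of_le' tendsto_const_nhds hlim
    (Eventually.of_forall fun _ => zero_le) ?_
  filter_upwards [Ioo_mem_nhdsLT (zero_lt_one' ℝ)] with r hr
  have hw : ‖(r : ℂ) * circ b‖ < 1 := by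
    rw [norm_mul, norm_circ, mul_one, Complex.norm_real, Real.norm_of_nonneg hr.1.le]; exact hr.2
  have hPc := continuous_poisson hw
  have hPc' : Continuous fun θ => (poisson (r * circ b) θ : ℂ) :=
    Complex.continuous_ofReal.comp hPc
  have hone := integral_mul_poisson (f := fun _ => u b) diffContOnCl_const hw
  have hsub : 2 * π * (φ (r * circ b) - u b)
      = ∫ θ, (u θ - u b) * poisson (r * circ b) θ ∂arc := by
    simp only [sub_mul]
    rw [integral_sub, hone, hpois _ hw]
    · ring
    · exact hu.mul_bdd hPc'.aestronglyMeasurable (ae_of_all _ (norm_poisson_le hw))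
    · exact integrable_arc_of_continuous (by fun_prop)
  -- The factor `2π` exceeds `1` in modulus, so it may be kept.
  have hle : edist (φ (r * circ b)) (u b) ≤ ‖2 * π * (φ (r * circ b) - u b)‖ₑ := by
    rw [edist_eq_enorm_sub, enorm_mul]
    refine le_mul_of_one_le_left' ?_
    rw [← ofReal_norm, ENNReal.one_le_ofReal, norm_mul, Complex.norm_real]
    simp only [Complex.norm_ofNat, Real.norm_of_nonneg Real.pi_pos.le]
    linarith [Real.pi_gt_three]
  refine hle.trans ?_
  rw [hsub]
  refine (enorm_integral_le_lintegral_enorm _).trans ?_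
  rw [← lintegral_const_mul _ (by fun_prop), arc, ← lintegral_indicator hSm,
    ← lintegral_add_left_eq_self _ b]
  refine lintegral_mono fun t => ?_
  by_cases hts : b + t ∈ S
  · simp only [hh, indicator_of_mem hts]
    rw [enorm_mul, mul_comm, ← mul_assoc]
    gcongr
    rw [← ofReal_norm, Complex.norm_real, Real.norm_of_nonneg (poisson_nonneg hw _),
      ← ENNReal.ofReal_mul hC0]
    refine ENNReal.ofReal_le_ofReal ?_
    have := hC r hr (b + t) hts
    rwa [add_sub_cancel_left] at this
  · simp only [indicator_of_notMem hts, zero_le]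

/-! ### Cauchy formulas for the boundary function -/

lemma bdry_eq_of_tendsto {f : ℂ → ℂ} {θ : ℝ} {c : ℂ}
    (h : Tendsto (fun r : ℝ => f (r * circ θ)) (𝓝[<] 1) (𝓝 c)) : bdry f θ = c :=
  h.limUnder_eq

lemma bdry_of_continuousAt {f : ℂ → ℂ} {θ : ℝ} (h : ContinuousAt f (circ θ)) :
    bdry f θ = f (circ θ) := by
  refine bdry_eq_of_tendsto (h.tendsto.comp ?_)
  have h1 : Tendsto (fun r : ℝ => (r : ℂ) * circ θ) (𝓝 1) (𝓝 (((1 : ℝ) : ℂ) * circ θ)) :=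
    Continuous.tendsto (by fun_prop) _
  simp only [Complex.ofReal_one, one_mul] at h1
  exact h1.mono_left nhdsWithin_le_nhds

lemma bdry_congr {f g : ℂ → ℂ} (h : ∀ z ∈ unitDisk, f z = g z) (θ : ℝ) : bdry f θ = bdry g θ := by
  unfold bdry limUnder
  congr 1
  refine Filter.map_congr ?_
  filter_upwards [Ioo_mem_nhdsLT (zero_lt_one' ℝ)] with r hr
  refine h _ ?_
  rw [mem_unitDisk, norm_mul, norm_circ, mul_one, Complex.norm_real, Real.norm_of_nonneg hr.1.le]
  exact hr.2

lemma one_sub_norm_le_norm_one_sub_mul {w ξ : ℂ} (hξ : ‖ξ‖ ≤ 1) : 1 - ‖w‖ ≤ ‖1 - w * ξ‖ := by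
  have h1 := norm_sub_norm_le 1 (w * ξ)
  rw [norm_one, norm_mul] at h1
  nlinarith [norm_nonneg w, norm_nonneg ξ]

lemma norm_inv_one_sub_mul_le {w ξ : ℂ} (hw : ‖w‖ < 1) (hξ : ‖ξ‖ ≤ 1) :
    ‖(1 - w * ξ)⁻¹‖ ≤ (1 - ‖w‖)⁻¹ := by
  rw [norm_inv]
  exact inv_anti₀ (by linarith) (one_sub_norm_le_norm_one_sub_mul hξ)

lemma continuous_inv_one_sub {w : ℂ} (hw : ‖w‖ < 1) :
    Continuous fun θ => (1 - w * conj (circ θ))⁻¹ :=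
  Continuous.inv₀ (continuous_const.sub (continuous_const.mul
    (Complex.continuous_conj.comp continuous_circ))) (one_sub_mul_conj_circ_ne_zero hw)

lemma one_sub_mul_ne_zero {w z : ℂ} (hw : ‖w‖ ≤ 1) (hz : ‖z‖ < 1) : 1 - w * z ≠ 0 := by
  have h := one_sub_norm_le_norm_one_sub_mul (w := z) hw
  rw [mul_comm z w] at h
  rw [← norm_pos_iff]; linarith

section

variable {φ : ℂ → ℂ}

lemma MemHardy.integrable_bdry (hφ : MemHardy 1 φ) : Integrable (bdry φ) arc := by
  obtain ⟨u, R, hu, -, -, -, h⟩ := hφ.exists_boundary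
  refine hu.congr ?_
  filter_upwards [h] with θ hθ
  exact (bdry_eq_of_tendsto hθ).symm

lemma MemHardy.exists_radii (hφ : MemHardy 1 φ) :
    ∃ R : ℕ → ℝ, (∀ j, R j ∈ Ioo (0 : ℝ) 1) ∧ Tendsto R atTop (𝓝 1) ∧
      ∀ (K : ℝ → ℂ) (C : ℝ), Continuous K → (∀ θ, ‖K θ‖ ≤ C) →
        Tendsto (fun j => ∫ θ, φ (R j * circ θ) * K θ ∂arc) atTop
          (𝓝 (∫ θ, bdry φ θ * K θ ∂arc)) := by
  obtain ⟨u, R, hu, hR, hRt, hRu, h⟩ := hφ.exists_boundary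
  refine ⟨R, hR, hRt, fun K C hK hC => ?_⟩
  have h1 := tendsto_integral_mul_of_L1 (μ := arc) (F := fun j θ => φ (R j * circ θ))
    (fun j => integrable_arc_of_continuous (hφ.1.continuous_circle (hR j))) hu hRu
    hK.aestronglyMeasurable hC
  refine h1.trans (le_of_eq ?_)
  congr 1
  refine integral_congr_ae ?_
  filter_upwards [h] with θ hθ
  rw [bdry_eq_of_tendsto hθ]

/-- For dilates this is Cauchy's formula for `φ(Rζ) (1 - zζ)⁻¹`; the `L¹` convergence carries it to
the boundary function. After conjugation it says that `T` multiplies the Szegő kernel at `w` by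
`conj (φ w)`. -/
lemma MemHardy.integral_bdry_mul_szego (hφ : MemHardy 1 φ) {w z : ℂ} (hw : ‖w‖ < 1)
    (hz : ‖z‖ < 1) :
    ∫ θ, bdry φ θ * ((1 - z * circ θ)⁻¹ * (1 - w * conj (circ θ))⁻¹) ∂arc
      = 2 * π * (φ w * (1 - z * w)⁻¹) := by
  obtain ⟨R, hR, hRt, h⟩ := hφ.exists_radii
  have h0 : ∀ θ, 1 - z * circ θ ≠ 0 := fun θ => by
    rw [mul_comm]; exact one_sub_mul_ne_zero (norm_circ θ).le hz
  have h1 := h (fun θ => (1 - z * circ θ)⁻¹ * (1 - w * conj (circ θ))⁻¹)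
    ((1 - ‖z‖)⁻¹ * (1 - ‖w‖)⁻¹)
    ((Continuous.inv₀ (by fun_prop) h0).mul (continuous_inv_one_sub hw)) (fun θ => by
      rw [norm_mul]
      gcongr
      · exact norm_inv_one_sub_mul_le hz (norm_circ θ).le
      · exact norm_inv_one_sub_mul_le hw (by rw [RCLike.norm_conj, norm_circ]))
  refine tendsto_nhds_unique h1 ?_
  have h2 : ∀ j, ∫ θ, φ (R j * circ θ) * ((1 - z * circ θ)⁻¹ * (1 - w * conj (circ θ))⁻¹) ∂arc
      = 2 * π * (φ (R j * w) * (1 - z * w)⁻¹) := by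
    intro j
    have hd : DiffContOnCl ℂ (fun ζ => (1 - z * ζ)⁻¹) (Metric.ball 0 1) := by
      refine DiffContOnCl.inv (Differentiable.diffContOnCl (by fun_prop)) fun ζ hζ => ?_
      rw [closure_ball _ one_ne_zero, Metric.mem_closedBall, dist_zero_right] at hζ
      rw [mul_comm]; exact one_sub_mul_ne_zero hζ hz
    have := integral_cauchy
      ((diffContOnCl_of_differentiableOn_ball (hR j) (hφ.1.diffContOnCl_dilate (hR j))).smul hd) hw
    simpa only [smul_eq_mul, div_eq_mul_inv, mul_assoc] using this
  simp only [h2]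
  refine ((Tendsto.mul_const _ ?_).const_mul _)
  have hca : ContinuousAt φ w := hφ.1.continuousOn.continuousAt
    (Metric.isOpen_ball.mem_nhds (mem_unitDisk.2 hw))
  refine Tendsto.comp hca ?_
  have := ((Complex.continuous_ofReal.tendsto _).comp hRt).mul_const w
  simpa using this

/-- The analogue for the squared kernel, where the derivative of `ζ φ(ζ) (1 - zζ)⁻¹` at `w` brings
in `φ'(w)`. After conjugation it gives the image under `T` of the test functions. -/
lemma MemHardy.integral_bdry_mul_szego_sq (hφ : MemHardy 1 φ) {w z : ℂ} (hw : ‖w‖ < 1)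
    (hz : ‖z‖ < 1) :
    ∫ θ, bdry φ θ * ((1 - z * circ θ)⁻¹ * ((1 - w * conj (circ θ)) ^ 2)⁻¹) ∂arc
      = 2 * π * (w * deriv φ w * (1 - z * w)⁻¹ + φ w * ((1 - z * w) ^ 2)⁻¹) := by
  obtain ⟨R, hR, hRt, h⟩ := hφ.exists_radii
  have h0 : ∀ θ, 1 - z * circ θ ≠ 0 := fun θ => by
    rw [mul_comm]; exact one_sub_mul_ne_zero (norm_circ θ).le hz
  have h1 := h (fun θ => (1 - z * circ θ)⁻¹ * ((1 - w * conj (circ θ)) ^ 2)⁻¹)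
    ((1 - ‖z‖)⁻¹ * ((1 - ‖w‖)⁻¹) ^ 2)
    ((Continuous.inv₀ (by fun_prop) h0).mul (by
      simp only [← inv_pow]; exact (continuous_inv_one_sub hw).pow 2)) (fun θ => by
      rw [norm_mul, ← inv_pow, norm_pow]
      gcongr
      · exact norm_inv_one_sub_mul_le hz (norm_circ θ).le
      · exact norm_inv_one_sub_mul_le hw (by rw [RCLike.norm_conj, norm_circ]))
  refine tendsto_nhds_unique h1 ?_
  have hzw : 1 - z * w ≠ 0 := one_sub_mul_ne_zero hz.le hw
  have hda : ∀ v : ℂ, ‖v‖ < 1 → HasDerivAt φ (deriv φ v) v := fun v hv =>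
    ((hφ.1 v (mem_unitDisk.2 hv)).differentiableAt
      (Metric.isOpen_ball.mem_nhds (mem_unitDisk.2 hv))).hasDerivAt
  have h2 : ∀ j, ∫ θ, φ (R j * circ θ) *
      ((1 - z * circ θ)⁻¹ * ((1 - w * conj (circ θ)) ^ 2)⁻¹) ∂arc
      = 2 * π * (φ (R j * w) * (1 - z * w)⁻¹
        + w * (deriv φ (R j * w) * R j * (1 - z * w)⁻¹
          + φ (R j * w) * (z * ((1 - z * w) ^ 2)⁻¹))) := by
    intro j
    -- A radius beyond `1` up to which both factors are holomorphic. When `z = 0` the second factor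
    -- imposes no constraint, and `2` stands for any number above `1`, since `‖0‖⁻¹ = 0`.
    set ρ : ℝ := min (R j)⁻¹ (if z = 0 then 2 else ‖z‖⁻¹) with hρ
    have hρ1 : 1 < ρ := by
      refine lt_min (one_lt_inv₀ (hR j).1 |>.2 (hR j).2) ?_
      split_ifs with h
      · norm_num
      · exact one_lt_inv₀ (norm_pos_iff.2 h) |>.2 hz
    have hne : ∀ ζ ∈ Metric.ball (0 : ℂ) ρ, 1 - z * ζ ≠ 0 := by
      intro ζ hζ h3
      rw [Metric.mem_ball, dist_zero_right] at hζ
      have h4 : ‖z * ζ‖ = 1 := by rw [← sub_eq_zero.1 h3, norm_one]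
      by_cases hz0 : z = 0
      · simp [hz0] at h4
      · have h5 : ‖ζ‖ < ‖z‖⁻¹ := hζ.trans_le ((min_le_right _ _).trans (by simp [hz0]))
        have h6 : 0 < ‖z‖ := norm_pos_iff.2 hz0
        rw [norm_mul] at h4
        have : ‖z‖ * ‖ζ‖ < ‖z‖ * ‖z‖⁻¹ := by gcongr
        rw [mul_inv_cancel₀ h6.ne'] at this
        linarith
    have hd : DifferentiableOn ℂ (fun ζ => φ (R j * ζ) * (1 - z * ζ)⁻¹) (Metric.ball 0 ρ) := by
      refine ((hφ.1.diffContOnCl_dilate (hR j)).mono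
        (Metric.ball_subset_ball (min_le_left _ _))).mul ?_
      exact DifferentiableOn.inv (by fun_prop) hne
    have h3 := integral_cauchy_sq Metric.isOpen_ball (Metric.closedBall_subset_ball hρ1) hd hw
    simp only [div_eq_mul_inv, mul_assoc] at h3
    rw [h3, ← mul_assoc]
    congr 1
    have hRw : ‖(R j : ℂ) * w‖ < 1 := by
      rw [norm_mul, Complex.norm_real, Real.norm_of_nonneg (hR j).1.le]
      nlinarith [(hR j).1, (hR j).2, norm_nonneg w]
    have d1 : HasDerivAt (fun ζ : ℂ => (R j : ℂ) * ζ) (R j) w := by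
      simpa using (hasDerivAt_id w).const_mul (R j : ℂ)
    have d2 := (hda _ hRw).comp w d1
    have d3 : HasDerivAt (fun ζ : ℂ => (1 - z * ζ)⁻¹) (z * ((1 - z * w) ^ 2)⁻¹) w := by
      have := (((hasDerivAt_id w).const_mul z).const_sub 1).inv hzw
      refine this.congr_deriv ?_
      simp [div_eq_mul_inv]
    have d4 := (hasDerivAt_id w).mul (d2.mul d3)
    refine HasDerivAt.deriv (HasDerivAt.congr_deriv d4 ?_)
    simp only [Function.comp_apply, Pi.mul_apply, id, one_mul]
  simp only [h2]
  have t1 : Tendsto (fun j => (R j : ℂ)) atTop (𝓝 1) := by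
    exact (Complex.continuous_ofReal.tendsto' 1 1 (by simp)).comp hRt
  have t2 : Tendsto (fun j => (R j : ℂ) * w) atTop (𝓝 w) := by simpa using t1.mul_const w
  have hca : ContinuousAt φ w := (hda w hw).continuousAt
  have hca' : ContinuousAt (deriv φ) w :=
    (hφ.1.deriv Metric.isOpen_ball).continuousOn.continuousAt
      (Metric.isOpen_ball.mem_nhds (mem_unitDisk.2 hw))
  have t3 : Tendsto (fun j => φ (R j * w)) atTop (𝓝 (φ w)) := hca.tendsto.comp t2
  have t4 : Tendsto (fun j => deriv φ (R j * w)) atTop (𝓝 (deriv φ w)) := hca'.tendsto.comp t2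
  have t5 := ((t3.mul_const (1 - z * w)⁻¹).add ((((t4.mul t1).mul_const (1 - z * w)⁻¹).add
    (t3.mul_const (z * ((1 - z * w) ^ 2)⁻¹))).const_mul w)).const_mul (2 * π : ℂ)
  refine t5.trans (le_of_eq ?_)
  congr 1
  field_simp
  ring

end

/-! ### Elementary integrals -/

lemma lintegral_Ioc_rpow {b δ : ℝ} (hb : -1 < b) (hδ : 0 < δ) :
    ∫⁻ u in Ioc 0 δ, ENNReal.ofReal (u ^ b) = ENNReal.ofReal (δ ^ (b + 1) / (b + 1)) := by
  have hi : IntegrableOn (fun u : ℝ => u ^ b) (Ioc 0 δ) :=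
    (intervalIntegrable_iff_integrableOn_Ioc_of_le hδ.le).1
      (intervalIntegral.intervalIntegrable_rpow' hb)
  rw [← ofReal_integral_eq_lintegral_ofReal hi
    ((ae_restrict_iff' measurableSet_Ioc).2 (ae_of_all _ fun u hu => rpow_nonneg hu.1.le _)),
    ← intervalIntegral.integral_of_le hδ.le, integral_rpow (Or.inl hb),
    zero_rpow (by linarith), sub_zero]

lemma lintegral_Ioi_rpow {e δ : ℝ} (he : e < -1) (hδ : 0 < δ) :
    ∫⁻ u in Ioi δ, ENNReal.ofReal (u ^ e) = ENNReal.ofReal (-δ ^ (e + 1) / (e + 1)) := by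
  rw [← ofReal_integral_eq_lintegral_ofReal (integrableOn_Ioi_rpow_of_lt he hδ)
    ((ae_restrict_iff' measurableSet_Ioi).2 (ae_of_all _ fun u hu =>
      rpow_nonneg (hδ.le.trans (le_of_lt hu)) _)), integral_Ioi_rpow_of_lt he hδ]

/-- The integral is split at `u = δ`: below, `δ + u` is replaced by `δ` and `b > -1` gives
convergence at `0`; above, it is replaced by `u` and `Q > b + 1` gives convergence at infinity. -/
lemma exists_lintegral_rpow_mul_rpow_le {b Q : ℝ} (hb : -1 < b) (hQ : b + 1 < Q) :
    ∃ C : ℝ, 0 < C ∧ ∀ δ : ℝ, 0 < δ →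
      ∫⁻ u in Ioi (0 : ℝ), ENNReal.ofReal (u ^ b * (δ + u) ^ (-Q))
        ≤ ENNReal.ofReal (C * δ ^ (b + 1 - Q)) := by
  have h1 : 0 < b + 1 := by linarith
  have h2 : 0 < Q - b - 1 := by linarith
  refine ⟨1 / (b + 1) + 1 / (Q - b - 1), by positivity, fun δ hδ => ?_⟩
  rw [← Ioc_union_Ioi_eq_Ioi hδ.le, lintegral_union measurableSet_Ioi (Ioc_disjoint_Ioi le_rfl),
    add_mul, ENNReal.ofReal_add (by positivity) (by positivity)]
  gcongr ?_ + ?_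
  · calc _ ≤ ∫⁻ u in Ioc 0 δ, ENNReal.ofReal (δ ^ (-Q)) * ENNReal.ofReal (u ^ b) := by
          refine setLIntegral_mono' measurableSet_Ioc fun u hu => ?_
          rw [← ENNReal.ofReal_mul (by positivity), mul_comm]
          refine ENNReal.ofReal_le_ofReal (mul_le_mul_of_nonneg_right ?_ (rpow_nonneg hu.1.le _))
          exact rpow_le_rpow_of_nonpos hδ (by linarith [hu.1]) (by linarith)
      _ = _ := by
          rw [lintegral_const_mul _ (by fun_prop), lintegral_Ioc_rpow hb hδ,
            ← ENNReal.ofReal_mul (by positivity)]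
          congr 1
          rw [show b + 1 - Q = -Q + (b + 1) by ring, rpow_add hδ (-Q) (b + 1)]; ring
  · calc _ ≤ ∫⁻ u in Ioi δ, ENNReal.ofReal (u ^ (b - Q)) := by
          refine setLIntegral_mono' measurableSet_Ioi fun u hu => ?_
          have hu0 : 0 < u := hδ.trans hu
          refine ENNReal.ofReal_le_ofReal ?_
          rw [sub_eq_add_neg, rpow_add hu0]
          refine mul_le_mul_of_nonneg_left ?_ (by positivity)
          exact rpow_le_rpow_of_nonpos hu0 (by linarith) (by linarith)
      _ = _ := by
          rw [lintegral_Ioi_rpow (by linarith) hδ]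
          congr 1
          rw [show b - Q + 1 = b + 1 - Q by ring]
          have : b + 1 - Q ≠ 0 := by linarith
          field_simp
          rw [show b + 1 - Q = -(Q - b - 1) by ring]

lemma lintegral_comp_abs' {F : ℝ → ℝ≥0∞} :
    ∫⁻ t, F |t| = 2 * ∫⁻ t in Ioi (0 : ℝ), F t := by
  have h1 : ∫⁻ t in Ioi (0 : ℝ), F |t| = ∫⁻ t in Ioi (0 : ℝ), F t :=
    setLIntegral_congr_fun measurableSet_Ioi fun t ht => by rw [abs_of_pos ht]
  have h2 : ∫⁻ t in Iio (0 : ℝ), F |t| = ∫⁻ t in Ioi (0 : ℝ), F t := by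
    rw [← h1]
    have := (Measure.measurePreserving_neg (volume : Measure ℝ)).setLIntegral_comp_preimage_emb
      (Homeomorph.neg ℝ).measurableEmbedding (fun t => F |t|) (Ioi 0)
    rw [← this]
    simp
  rw [← lintegral_add_compl _ (measurableSet_Iio (a := (0 : ℝ))), h2, compl_Iio,
    setLIntegral_congr Ioi_ae_eq_Ici.symm, h1, two_mul]

lemma lintegral_arc_eq_Ioc {G : ℝ → ℝ≥0∞} (hG : Function.Periodic G (2 * π)) (a : ℝ) :
    ∫⁻ θ, G θ ∂arc = ∫⁻ θ in Ioc a (a + 2 * π), G θ := by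
  have h1 := isAddFundamentalDomain_Ioc Real.two_pi_pos 0
  have h2 := isAddFundamentalDomain_Ioc Real.two_pi_pos a
  rw [zero_add] at h1
  refine h1.setLIntegral_eq h2 G fun g x => ?_
  obtain ⟨g, n, rfl⟩ := g
  have := hG.zsmul n x
  change G (n • (2 * π) + x) = G x
  rw [add_comm]; exact this

lemma lintegral_arc_le_of_le_abs {G : ℝ → ℝ≥0∞} (hG : Function.Periodic G (2 * π)) {α : ℝ}
    {F : ℝ → ℝ≥0∞} (h : ∀ θ, 0 < |θ - α| → |θ - α| ≤ π → G θ ≤ F |θ - α|) :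
    ∫⁻ θ, G θ ∂arc ≤ 2 * ∫⁻ t in Ioi (0 : ℝ), F t := by
  rw [lintegral_arc_eq_Ioc hG (α - π), ← lintegral_comp_abs',
    ← lintegral_sub_right_eq_self (fun t => F |t|) α, ← lintegral_indicator measurableSet_Ioc]
  refine lintegral_mono_ae ?_
  have : ∀ᵐ θ : ℝ, θ ≠ α := by simp [ae_iff, measure_singleton]
  filter_upwards [this] with θ hθ
  by_cases hm : θ ∈ Ioc (α - π) (α - π + 2 * π)
  · rw [indicator_of_mem hm]
    refine h θ (abs_pos.2 (sub_ne_zero.2 hθ)) ?_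
    rw [abs_le]; constructor <;> linarith [hm.1, hm.2]
  · rw [indicator_of_notMem hm]; exact zero_le

lemma norm_one_sub_conj_comm (a b : ℂ) : ‖1 - a * conj b‖ = ‖1 - b * conj a‖ := by
  rw [← RCLike.norm_conj (1 - a * conj b)]
  simp [mul_comm]

/-- Take `α = arg a`. The point `e^{iα}` is at distance `1 - |a|` from `a`, no farther than `e^{iθ}`
is. Hence the chord from `e^{iθ}` to `e^{iα}` is at most `2 |e^{iθ} - a|`. -/
lemma exists_angle {a : ℂ} (ha : ‖a‖ ≤ 1) :
    ∃ α : ℝ, ∀ θ : ℝ, |θ - α| ≤ π → |θ - α| / π ≤ ‖1 - circ θ * conj a‖ := by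
  refine ⟨a.arg, fun θ h => ?_⟩
  have h1 := two_div_pi_mul_abs_le_norm_circ_sub h
  have h2 : ‖a - circ a.arg‖ ≤ ‖circ θ - a‖ := by
    have e1 : a - circ a.arg = ((‖a‖ - 1 : ℝ) : ℂ) * circ a.arg := by
      have : (‖a‖ : ℂ) * circ a.arg = a := Complex.norm_mul_exp_arg_mul_I a
      push_cast
      rw [sub_mul, this, one_mul]
    have e2 := norm_sub_norm_le (circ θ) a
    rw [norm_circ] at e2
    rw [e1, norm_mul, norm_circ, mul_one, Complex.norm_real, Real.norm_of_nonpos (by linarith)]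
    linarith
  have h3 : ‖circ θ - circ a.arg‖ ≤ ‖circ θ - a‖ + ‖a - circ a.arg‖ := norm_sub_le_norm_sub_add_norm_sub _ _ _
  rw [← norm_sub_eq_norm_one_sub (norm_circ θ)]
  have h4 : |θ - a.arg| / π = (2 / π * |θ - a.arg|) / 2 := by ring
  rw [h4]; linarith

lemma one_sub_norm_le (w : ℂ) (θ : ℝ) : 1 - ‖w‖ ≤ ‖1 - circ θ * conj w‖ := by
  rw [← norm_sub_eq_norm_one_sub (norm_circ θ)]
  have := norm_sub_norm_le (circ θ) w
  rwa [norm_circ] at this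

/-- With `L`, `x`, `y` the moduli of `1 - ξ conj a`, `1 - ξ conj w`, `1 - a conj w`, one has `y ≤ L
+ x`, so the larger of `L` and `x` is at least `y / 2`. A factor `y^(-κ)` is extracted from it, and
what remains (`Q₁` where `x ≤ L`, `Q₂` where `L ≤ x`) has a one-parameter estimate. The condition `κ
< 1` makes `L^(-κ)` integrable uniformly in `a`. -/
lemma exists_lintegral_arc_rpow_mul_rpow_le {κ s : ℝ} (hκ0 : 0 ≤ κ) (hκ : κ < 1) (hs : 1 < s) :
    ∃ C : ℝ, 0 < C ∧ ∀ a w : ℂ, ‖a‖ < 1 → ‖w‖ < 1 →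
      ∫⁻ θ, ENNReal.ofReal (‖1 - circ θ * conj a‖ ^ (-κ) * ‖1 - circ θ * conj w‖ ^ (-s)) ∂arc
        ≤ ENNReal.ofReal (C * (‖1 - a * conj w‖ ^ (-κ) * (1 - ‖w‖) ^ (1 - s))) := by
  have hpi := Real.pi_pos
  obtain ⟨C₁, hC₁, h₁⟩ := exists_lintegral_rpow_mul_rpow_le (b := 0) (Q := s) (by norm_num)
    (by linarith)
  obtain ⟨C₂, hC₂, h₂⟩ := exists_lintegral_rpow_mul_rpow_le (b := -κ) (Q := s - κ) (by linarith)
    (by linarith)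
  have hC : ∀ {c : ℝ}, 0 < c → 0 < (2 * π) ^ c := fun _ => by positivity
  refine ⟨2 * (2 * (2 * π) ^ s * C₁ + 2 * (2 * π) ^ s * C₂), by positivity,
    fun a w ha hw => ?_⟩
  set y := ‖1 - a * conj w‖ with hy
  set d := 1 - ‖w‖ with hd
  have hd0 : 0 < d := by rw [hd]; linarith
  have hy0 : 0 < y := norm_pos_iff.2 (one_sub_mul_ne_zero ha.le (by rwa [RCLike.norm_conj]))
  set L : ℝ → ℝ := fun θ => ‖1 - circ θ * conj a‖ with hL
  set x : ℝ → ℝ := fun θ => ‖1 - circ θ * conj w‖ with hx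
  have hL0 : ∀ θ, 0 < L θ := fun θ => (by linarith : 0 < 1 - ‖a‖).trans_le (one_sub_norm_le a θ)
  have hxd : ∀ θ, d ≤ x θ := fun θ => one_sub_norm_le w θ
  have hx0 : ∀ θ, 0 < x θ := fun θ => hd0.trans_le (hxd θ)
  -- From `1 - a conj w = conj ξ (ξ - a) + a conj (ξ - w)` for `|ξ| = 1`.
  have hyLx : ∀ θ, y ≤ L θ + x θ := by
    intro θ
    rw [hL, hx]
    simp only [← norm_sub_eq_norm_one_sub (norm_circ θ)]
    have e1 : 1 - a * conj w = conj (circ θ) * (circ θ - a) + a * conj (circ θ - w) := by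
      rw [map_sub, mul_sub, mul_sub, conj_circ_mul]; ring
    rw [hy, e1]
    refine (norm_add_le _ _).trans ?_
    rw [norm_mul, norm_mul, RCLike.norm_conj, RCLike.norm_conj, norm_circ, one_mul]
    nlinarith [norm_nonneg (circ θ - w)]
  set Q₁ : ℝ → ℝ := fun θ => x θ ^ (-s) with hQ₁
  set Q₂ : ℝ → ℝ := fun θ => L θ ^ (-κ) * (max (L θ) d) ^ (κ - s) with hQ₂
  have hpt : ∀ θ, L θ ^ (-κ) * x θ ^ (-s) ≤ 2 * y ^ (-κ) * (Q₁ θ + Q₂ θ) := by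
    intro θ
    have hQ₁n : 0 ≤ Q₁ θ := rpow_nonneg (hx0 θ).le _
    have hQ₂n : 0 ≤ Q₂ θ := mul_nonneg (rpow_nonneg (hL0 θ).le _)
      (rpow_nonneg (le_max_of_le_right hd0.le) _)
    have h2κ : ∀ M, 0 < M → y ≤ 2 * M → M ^ (-κ) ≤ 2 * y ^ (-κ) := by
      intro M hM hyM
      have e1 : (2 * M) ^ (-κ) ≤ y ^ (-κ) := rpow_le_rpow_of_nonpos hy0 hyM (by linarith)
      rw [mul_rpow two_pos.le hM.le, rpow_neg two_pos.le] at e1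
      have e2 : (2 : ℝ) ^ κ ≤ 2 := by
        simpa using rpow_le_rpow_of_exponent_le (one_le_two) hκ.le
      have e3 : 0 < (2 : ℝ) ^ κ := by positivity
      have e4 : M ^ (-κ) ≤ 2 ^ κ * y ^ (-κ) := by
        rw [inv_mul_le_iff₀ e3] at e1; exact e1
      exact e4.trans (by gcongr)
    rcases le_total (x θ) (L θ) with h | h
    · calc L θ ^ (-κ) * x θ ^ (-s) ≤ 2 * y ^ (-κ) * Q₁ θ := by
            gcongr
            exact h2κ _ (hL0 θ) (by linarith [hyLx θ])
        _ ≤ _ := by gcongr; linarith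
    · have e1 : x θ ^ (-s) = x θ ^ (-κ) * x θ ^ (κ - s) := by
        rw [← rpow_add (hx0 θ)]; congr 1; ring
      have e2 : x θ ^ (κ - s) ≤ (max (L θ) d) ^ (κ - s) :=
        rpow_le_rpow_of_nonpos (lt_max_of_lt_right hd0) (max_le h (hxd θ)) (by linarith)
      have e3 := h2κ _ (hx0 θ) (by linarith [hyLx θ])
      have e4 : 0 ≤ L θ ^ (-κ) := rpow_nonneg (hL0 θ).le _
      calc L θ ^ (-κ) * x θ ^ (-s) = x θ ^ (-κ) * (L θ ^ (-κ) * x θ ^ (κ - s)) := by rw [e1]; ring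
        _ ≤ 2 * y ^ (-κ) * Q₂ θ := by
            refine mul_le_mul e3 (mul_le_mul_of_nonneg_left e2 e4) (mul_nonneg e4
              (rpow_nonneg (hx0 θ).le _)) (by positivity)
        _ ≤ _ := by gcongr; linarith
  have hper : ∀ v : ℂ, Function.Periodic (fun θ => ‖1 - circ θ * conj v‖) (2 * π) := fun v θ => by
    simp only [circ_periodic θ]
  have hcL : Measurable L := by
    have : Continuous L := by rw [hL]; fun_prop
    exact this.measurable
  have hcx : Measurable x := by
    have : Continuous x := by rw [hx]; fun_prop
    exact this.measurable
  have i₁ : ∫⁻ θ, ENNReal.ofReal (Q₁ θ) ∂arc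
      ≤ ENNReal.ofReal (2 * (2 * π) ^ s * C₁ * d ^ (1 - s)) := by
    obtain ⟨α, hα⟩ := exists_angle hw.le
    refine (lintegral_arc_le_of_le_abs (α := α)
      (F := fun t => ENNReal.ofReal ((2 * π) ^ s) * ENNReal.ofReal (t ^ (0 : ℝ) * (d + t) ^ (-s)))
      (fun θ => ?_) fun θ h0 hθ => ?_).trans ?_
    · have := hper w θ
      simp only [hQ₁, hx] at this ⊢
      rw [this]
    · rw [← ENNReal.ofReal_mul (by positivity)]
      refine ENNReal.ofReal_le_ofReal ?_
      have e1 : (d + |θ - α|) / (2 * π) ≤ x θ := by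
        have e2 := hα θ hθ
        have e3 := hxd θ
        have e5 : |θ - α| / (2 * π) = (|θ - α| / π) / 2 := by ring
        have e6 : d / (2 * π) ≤ d / 2 := by
          gcongr; linarith [Real.pi_gt_three]
        rw [add_div, e5]
        have e7 : |θ - α| / π ≤ x θ := e2
        linarith
      have e2 := rpow_le_rpow_of_nonpos (by positivity) e1 (show -s ≤ 0 by linarith)
      refine e2.trans (le_of_eq ?_)
      rw [div_rpow (by positivity) (by positivity), rpow_neg (by positivity : 0 ≤ 2 * π), rpow_zero]
      field_simp
    · rw [lintegral_const_mul _ (by fun_prop)]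
      calc _ ≤ 2 * (ENNReal.ofReal ((2 * π) ^ s) * ENNReal.ofReal (C₁ * d ^ (0 + 1 - s))) := by
            gcongr; exact h₁ d hd0
        _ = _ := by
            rw [← ENNReal.ofReal_mul (by positivity), ← ENNReal.ofReal_ofNat 2,
              ← ENNReal.ofReal_mul (by positivity)]
            congr 1; rw [zero_add]; ring
  have i₂ : ∫⁻ θ, ENNReal.ofReal (Q₂ θ) ∂arc
      ≤ ENNReal.ofReal (2 * (2 * π) ^ s * C₂ * d ^ (1 - s)) := by
    obtain ⟨α, hα⟩ := exists_angle ha.le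
    refine (lintegral_arc_le_of_le_abs (α := α)
      (F := fun t => ENNReal.ofReal ((2 * π) ^ s) *
        ENNReal.ofReal (t ^ (-κ) * (d + t) ^ (-(s - κ))))
      (fun θ => ?_) fun θ h0 hθ => ?_).trans ?_
    · have := hper a θ
      simp only [hQ₂, hL] at this ⊢
      rw [this]
    · rw [← ENNReal.ofReal_mul (by positivity)]
      refine ENNReal.ofReal_le_ofReal ?_
      have e2 : |θ - α| / π ≤ L θ := hα θ hθ
      have e5 : |θ - α| / (2 * π) = (|θ - α| / π) / 2 := by ring
      have e1 : (d + |θ - α|) / (2 * π) ≤ max (L θ) d := by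
        have e3 := le_max_left (L θ) d
        have e4 := le_max_right (L θ) d
        have e6 : d / (2 * π) ≤ d / 2 := by
          gcongr; linarith [Real.pi_gt_three]
        rw [add_div, e5]
        linarith
      have e7 := rpow_le_rpow_of_nonpos (by positivity) e1 (show κ - s ≤ 0 by linarith)
      have e8 : |θ - α| / (2 * π) ≤ L θ := by
        rw [e5]
        have : 0 ≤ |θ - α| / π := by positivity
        linarith
      have e9 := rpow_le_rpow_of_nonpos (by positivity) e8 (show -κ ≤ 0 by linarith)
      refine (mul_le_mul e9 e7 (rpow_nonneg (le_max_of_le_right hd0.le) _)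
        (by positivity)).trans (le_of_eq ?_)
      rw [div_rpow (by positivity) (by positivity), div_rpow (by positivity) (by positivity),
        neg_sub, div_mul_div_comm, ← rpow_add (by positivity), show -κ + (κ - s) = -s by ring,
        rpow_neg (by positivity : 0 ≤ 2 * π)]
      field_simp
    · rw [lintegral_const_mul _ (by fun_prop)]
      calc _ ≤ 2 * (ENNReal.ofReal ((2 * π) ^ s) *
            ENNReal.ofReal (C₂ * d ^ (-κ + 1 - (s - κ)))) := by
            gcongr; exact h₂ d hd0
        _ = _ := by
            rw [← ENNReal.ofReal_mul (by positivity), ← ENNReal.ofReal_ofNat 2,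
              ← ENNReal.ofReal_mul (by positivity), show -κ + 1 - (s - κ) = 1 - s by ring]
            congr 1; ring
  calc ∫⁻ θ, ENNReal.ofReal (L θ ^ (-κ) * x θ ^ (-s)) ∂arc
      ≤ ∫⁻ θ, ENNReal.ofReal (2 * y ^ (-κ)) *
          (ENNReal.ofReal (Q₁ θ) + ENNReal.ofReal (Q₂ θ)) ∂arc := by
        refine lintegral_mono fun θ => ?_
        have hQ₁n : 0 ≤ Q₁ θ := rpow_nonneg (hx0 θ).le _
        have hQ₂n : 0 ≤ Q₂ θ := mul_nonneg (rpow_nonneg (hL0 θ).le _)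
          (rpow_nonneg (le_max_of_le_right hd0.le) _)
        rw [← ENNReal.ofReal_add hQ₁n hQ₂n, ← ENNReal.ofReal_mul (by positivity)]
        exact ENNReal.ofReal_le_ofReal (hpt θ)
    _ = ENNReal.ofReal (2 * y ^ (-κ)) *
          (∫⁻ θ, ENNReal.ofReal (Q₁ θ) ∂arc + ∫⁻ θ, ENNReal.ofReal (Q₂ θ) ∂arc) := by
        rw [lintegral_const_mul _ (by fun_prop), lintegral_add_left (by fun_prop)]
    _ ≤ ENNReal.ofReal (2 * y ^ (-κ)) * (ENNReal.ofReal (2 * (2 * π) ^ s * C₁ * d ^ (1 - s))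
          + ENNReal.ofReal (2 * (2 * π) ^ s * C₂ * d ^ (1 - s))) := by gcongr
    _ = _ := by
        rw [← ENNReal.ofReal_add (by positivity) (by positivity),
          ← ENNReal.ofReal_mul (by positivity)]
        congr 1; ring

lemma exists_lintegral_arc_rpow_le {s : ℝ} (hs : 1 < s) :
    ∃ C : ℝ, 0 < C ∧ ∀ w : ℂ, ‖w‖ < 1 →
      ∫⁻ θ, ENNReal.ofReal (‖1 - circ θ * conj w‖ ^ (-s)) ∂arc
        ≤ ENNReal.ofReal (C * (1 - ‖w‖) ^ (1 - s)) := by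
  obtain ⟨C, hC, h⟩ := exists_lintegral_arc_rpow_mul_rpow_le le_rfl zero_lt_one hs
  refine ⟨C, hC, fun w hw => ?_⟩
  simpa using h 0 w (by simp) hw

/-! ### Polar coordinates on the disk -/

lemma measurableSet_unitDisk : MeasurableSet unitDisk := measurableSet_ball

lemma polarCoord_symm_eq (p : ℝ × ℝ) : Complex.polarCoord.symm p = p.1 * circ p.2 := by
  rw [Complex.polarCoord_symm_apply, circ, Complex.exp_mul_I]
  push_cast; ring

lemma mul_circ_mem_unitDisk_iff {r : ℝ} (hr : 0 < r) (θ : ℝ) :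
    (r : ℂ) * circ θ ∈ unitDisk ↔ r < 1 := by
  rw [mem_unitDisk, norm_mul, norm_circ, mul_one, Complex.norm_real, Real.norm_of_nonneg hr.le]

lemma measurable_circ : Measurable circ := continuous_circ.measurable

lemma lintegral_unitDisk {Φ : ℂ → ℝ≥0∞} (hΦ : Measurable Φ) :
    ∫⁻ z in unitDisk, Φ z
      = ∫⁻ r in Ioo (0 : ℝ) 1, ENNReal.ofReal r * ∫⁻ θ, Φ (r * circ θ) ∂arc := by
  have hΦ' : Measurable (unitDisk.indicator Φ) := hΦ.indicator measurableSet_unitDisk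
  have hm : Measurable fun p : ℝ × ℝ => (p.1 : ℂ) * circ p.2 :=
    (Complex.measurable_ofReal.comp measurable_fst).mul (measurable_circ.comp measurable_snd)
  rw [← lintegral_indicator measurableSet_unitDisk, ← Complex.lintegral_comp_polarCoord_symm]
  simp only [polarCoord_symm_eq, polarCoord_target, smul_eq_mul]
  rw [Measure.volume_eq_prod, ← Measure.prod_restrict, lintegral_prod]
  swap
  · exact ((ENNReal.measurable_ofReal.comp measurable_fst).mul (hΦ'.comp hm)).aemeasurable
  have h1 : ∀ r ∈ Ioi (0 : ℝ), ∫⁻ θ in Ioo (-π) π,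
      ENNReal.ofReal r * unitDisk.indicator Φ (r * circ θ)
      = (Iio (1 : ℝ)).indicator (fun r : ℝ =>
        ENNReal.ofReal r * ∫⁻ θ, Φ (r * circ θ) ∂arc) r := by
    intro r hr
    by_cases h : r < 1
    · rw [indicator_of_mem (show r ∈ Iio (1 : ℝ) from h)]
      simp only [indicator_of_mem ((mul_circ_mem_unitDisk_iff hr _).2 h)]
      rw [lintegral_const_mul' _ _ ENNReal.ofReal_ne_top,
        lintegral_arc_eq_Ioc (fun θ => by rw [circ_periodic θ]) (-π),
        show -π + 2 * π = π by ring, setLIntegral_congr Ioo_ae_eq_Ioc]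
    · rw [indicator_of_notMem (show r ∉ Iio (1 : ℝ) from h)]
      simp only [indicator_of_notMem (mt (mul_circ_mem_unitDisk_iff hr _).1 h), mul_zero,
        lintegral_zero]
  rw [setLIntegral_congr_fun measurableSet_Ioi h1, setLIntegral_indicator measurableSet_Iio,
    inter_comm, Ioi_inter_Iio]

lemma integral_unitDisk {Φ : ℂ → ℂ} (hΦ : Measurable Φ) (hi : IntegrableOn Φ unitDisk) :
    ∫ z in unitDisk, Φ z = ∫ r in Ioo (0 : ℝ) 1, (r : ℂ) * ∫ θ, Φ (r * circ θ) ∂arc := by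
  have hΦ' : Measurable (unitDisk.indicator Φ) := hΦ.indicator measurableSet_unitDisk
  have hm : Measurable fun p : ℝ × ℝ => (p.1 : ℂ) * circ p.2 :=
    (Complex.measurable_ofReal.comp measurable_fst).mul (measurable_circ.comp measurable_snd)
  rw [← integral_indicator measurableSet_unitDisk, ← Complex.integral_comp_polarCoord_symm]
  simp only [polarCoord_symm_eq, polarCoord_target, Complex.real_smul]
  rw [Measure.volume_eq_prod, ← Measure.prod_restrict, integral_prod]
  swap
  · refine ⟨((Complex.measurable_ofReal.comp measurable_fst).mul
      (hΦ'.comp hm)).aestronglyMeasurable, ?_⟩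
    have h2 := Complex.lintegral_comp_polarCoord_symm fun z => ‖unitDisk.indicator Φ z‖ₑ
    have h3 : ∫⁻ z, ‖unitDisk.indicator Φ z‖ₑ < ∞ :=
      ((integrable_indicator_iff measurableSet_unitDisk).2 hi).2
    rw [← h2] at h3
    rw [HasFiniteIntegral, Measure.prod_restrict, ← Measure.volume_eq_prod]
    refine lt_of_le_of_lt (le_of_eq ?_) h3
    rw [polarCoord_target]
    refine setLIntegral_congr_fun (measurableSet_Ioi.prod measurableSet_Ioo) fun p hp => ?_
    have hp1 : 0 < p.1 := hp.1
    simp only [polarCoord_symm_eq, smul_eq_mul]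
    rw [enorm_mul, ← ofReal_norm (p.1 : ℂ), Complex.norm_real, Real.norm_of_nonneg hp1.le]
  have h1 : ∀ r ∈ Ioi (0 : ℝ), ∫ θ in Ioo (-π) π,
      (r : ℂ) * unitDisk.indicator Φ (r * circ θ)
      = (Iio (1 : ℝ)).indicator (fun r : ℝ => (r : ℂ) * ∫ θ, Φ (r * circ θ) ∂arc) r := by
    intro r hr
    by_cases h : r < 1
    · rw [indicator_of_mem (show r ∈ Iio (1 : ℝ) from h)]
      simp only [indicator_of_mem ((mul_circ_mem_unitDisk_iff hr _).2 h)]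
      have hper : Function.Periodic (fun θ => Φ (r * circ θ)) (2 * π) := fun θ => by
        simp only [circ_periodic θ]
      rw [integral_const_mul, integral_arc, ← integral_Ioc_eq_integral_Ioo,
        ← intervalIntegral.integral_of_le (by linarith [Real.pi_pos])]
      have := hper.intervalIntegral_add_eq (-π) 0
      rw [show -π + 2 * π = π by ring, zero_add] at this
      rw [this]
    · rw [indicator_of_notMem (show r ∉ Iio (1 : ℝ) from h)]
      simp only [indicator_of_notMem (mt (mul_circ_mem_unitDisk_iff hr _).1 h), mul_zero,
        integral_zero]
  rw [setIntegral_congr_fun measurableSet_Ioi h1, setIntegral_indicator measurableSet_Iio,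
    Ioi_inter_Iio]

/-- The weight `‖z‖⁻¹` cancels the polar Jacobian; it is present because dominated densities carry a
power of `1 / ‖w‖`. The angular integral gives `(1 - r‖a‖)^(1-P)`, and `1 - r‖a‖` is at least the
mean of `1 - ‖a‖` and `1 - r`. -/
lemma exists_lintegral_unitDisk_le {b P : ℝ} (hb : -1 < b) (hP : b + 2 < P) :
    ∃ C : ℝ, 0 < C ∧ ∀ a : ℂ, ‖a‖ < 1 →
      ∫⁻ z in unitDisk, ENNReal.ofReal (‖z‖⁻¹ * (1 - ‖z‖) ^ b * ‖1 - a * conj z‖ ^ (-P))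
        ≤ ENNReal.ofReal (C * (1 - ‖a‖) ^ (b + 2 - P)) := by
  obtain ⟨C₁, hC₁, h₁⟩ := exists_lintegral_arc_rpow_le (s := P) (by linarith)
  obtain ⟨C₂, hC₂, h₂⟩ := exists_lintegral_rpow_mul_rpow_le hb (Q := P - 1) (by linarith)
  refine ⟨C₁ * 2 ^ (P - 1) * C₂, by positivity, fun a ha => ?_⟩
  have hδ : 0 < 1 - ‖a‖ := by linarith
  set δ := 1 - ‖a‖ with hδd
  have hcl : ∀ p : ℝ, Measurable fun z : ℂ => ‖1 - a * conj z‖ ^ p := fun p => by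
    have : Measurable fun z : ℂ => ‖1 - a * conj z‖ :=
      (continuous_norm.comp (continuous_const.sub
        (continuous_const.mul Complex.continuous_conj))).measurable
    exact this.pow_const p
  have hmeas : Measurable fun z : ℂ =>
      ENNReal.ofReal (‖z‖⁻¹ * (1 - ‖z‖) ^ b * ‖1 - a * conj z‖ ^ (-P)) :=
    ENNReal.measurable_ofReal.comp
      ((by fun_prop : Measurable fun z : ℂ => ‖z‖⁻¹ * (1 - ‖z‖) ^ b).mul (hcl (-P)))
  rw [lintegral_unitDisk hmeas]
  calc _ ≤ ∫⁻ r in Ioo (0 : ℝ) 1,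
        ENNReal.ofReal ((1 - r) ^ b) * ENNReal.ofReal (C₁ * ((δ + (1 - r)) / 2) ^ (1 - P)) := by
        refine setLIntegral_mono' measurableSet_Ioo fun r hr => ?_
        have hr0 : 0 < r := hr.1
        have hnr : ∀ θ, ‖(r : ℂ) * circ θ‖ = r := fun θ => by
          rw [norm_mul, norm_circ, mul_one, Complex.norm_real, Real.norm_of_nonneg hr0.le]
        have h3 : ∀ θ, ENNReal.ofReal (‖(r : ℂ) * circ θ‖⁻¹ * (1 - ‖(r : ℂ) * circ θ‖) ^ b *
            ‖1 - a * conj ((r : ℂ) * circ θ)‖ ^ (-P))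
            = ENNReal.ofReal (r⁻¹ * (1 - r) ^ b) *
              ENNReal.ofReal (‖1 - circ θ * conj (r * a)‖ ^ (-P)) := by
          intro θ
          rw [hnr, ← ENNReal.ofReal_mul (mul_nonneg (by positivity)
            (rpow_nonneg (by linarith [hr.2]) _)), norm_one_sub_conj_comm]
          congr 5
          simp only [map_mul, Complex.conj_ofReal]; ring
        simp only [h3]
        rw [lintegral_const_mul' _ _ ENNReal.ofReal_ne_top, ← mul_assoc,
          ← ENNReal.ofReal_mul hr0.le, mul_inv_cancel_left₀ hr0.ne']
        have hra : ‖(r : ℂ) * a‖ = r * ‖a‖ := by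
          rw [norm_mul, Complex.norm_real, Real.norm_of_nonneg hr0.le]
        have hra1 : r * ‖a‖ < 1 := by nlinarith [norm_nonneg a, hr.2]
        refine mul_le_mul_right ((h₁ _ (by rwa [hra])).trans ?_) _
        refine ENNReal.ofReal_le_ofReal (mul_le_mul_of_nonneg_left ?_ hC₁.le)
        refine rpow_le_rpow_of_nonpos (by linarith [hr.2]) ?_ (by linarith)
        rw [hra, hδd]
        nlinarith [norm_nonneg a, hr.2, hr.1]
    _ = ∫⁻ r in Ioo (0 : ℝ) 1, ENNReal.ofReal (C₁ * 2 ^ (P - 1)) *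
          ENNReal.ofReal ((1 - r) ^ b * (δ + (1 - r)) ^ (-(P - 1))) := by
        refine setLIntegral_congr_fun measurableSet_Ioo fun r hr => ?_
        have h1r : 0 < 1 - r := by linarith [hr.2]
        rw [← ENNReal.ofReal_mul (by positivity), ← ENNReal.ofReal_mul (by positivity)]
        congr 1
        rw [div_rpow (by positivity) two_pos.le, neg_sub, show P - 1 = -(1 - P) by ring,
          rpow_neg two_pos.le]
        field_simp
    _ = ENNReal.ofReal (C₁ * 2 ^ (P - 1)) * ∫⁻ r in Ioo (0 : ℝ) 1,
          ENNReal.ofReal ((1 - r) ^ b * (δ + (1 - r)) ^ (-(P - 1))) :=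
        lintegral_const_mul' _ _ ENNReal.ofReal_ne_top
    _ ≤ ENNReal.ofReal (C₁ * 2 ^ (P - 1)) * ∫⁻ u in Ioi (0 : ℝ),
          ENNReal.ofReal (u ^ b * (δ + u) ^ (-(P - 1))) := by
        refine mul_le_mul_right ?_ _
        rw [← lintegral_indicator measurableSet_Ioo, ← lintegral_indicator measurableSet_Ioi,
          ← lintegral_sub_left_eq_self _ (1 : ℝ)]
        refine lintegral_mono fun r => ?_
        by_cases h : (1 - r) ∈ Ioo (0 : ℝ) 1
        · rw [indicator_of_mem h, indicator_of_mem (show r ∈ Ioi (0 : ℝ) from by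
            have := h.2; simp only [mem_Ioi]; linarith), sub_sub_cancel]
        · rw [indicator_of_notMem h]; exact zero_le
    _ ≤ ENNReal.ofReal (C₁ * 2 ^ (P - 1)) * ENNReal.ofReal (C₂ * δ ^ (b + 1 - (P - 1))) := by
        gcongr; exact h₂ δ hδ
    _ = _ := by
        rw [← ENNReal.ofReal_mul (by positivity), ← mul_assoc,
          show b + 1 - (P - 1) = b + 2 - P by ring]

lemma lintegral_unitDisk_inv_norm_lt_top :
    ∫⁻ z in unitDisk, ENNReal.ofReal ‖z‖⁻¹ < ∞ := by
  obtain ⟨C, -, h⟩ := exists_lintegral_unitDisk_le (b := 0) (P := 3) (by norm_num) (by norm_num)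
  have := h 0 (by simp)
  simp only [rpow_zero, zero_mul, sub_zero, norm_one, one_rpow, mul_one] at this
  exact this.trans_lt ENNReal.ofReal_lt_top

/-! ### Cauchy-type integrals -/

/-- A Schur-type test. Hölder's inequality with the weight `B^(1/s)` bounds the inner integral to
the power `s` by a constant times the integral of `(g A)^s / B`. After Tonelli the hypothesis on `A`
cancels `B`. -/
lemma lintegral_rpow_lintegral_mul_le {X Y : Type*} [MeasurableSpace X] [MeasurableSpace Y]
    {μ : Measure X} {ν : Measure Y} [SFinite μ] [SFinite ν] {s : ℝ} (hs : 1 < s)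
    {A : X → Y → ℝ≥0∞} (hA : Measurable (Function.uncurry A)) {g B : Y → ℝ≥0∞}
    (hg : Measurable g) (hB : Measurable B) (hB0 : ∀ᵐ y ∂ν, B y ≠ 0) (hBt : ∀ᵐ y ∂ν, B y ≠ ∞)
    (h : ∀ᵐ y ∂ν, ∫⁻ x, A x y ^ s ∂μ ≤ B y) :
    ∫⁻ x, (∫⁻ y, g y * A x y ∂ν) ^ s ∂μ
      ≤ (∫⁻ y, B y ^ (1 / (s - 1)) ∂ν) ^ (s - 1) * ∫⁻ y, g y ^ s ∂ν := by
  have hs0 : 0 < s := by linarith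
  have hs1 : 0 < s - 1 := by linarith
  have hpq : s.HolderConjugate (s / (s - 1)) := Real.HolderConjugate.conjExponent hs
  have hAx : ∀ x, Measurable (A x) := fun x => hA.comp measurable_prodMk_left
  set N : Y → ℝ≥0∞ := fun y => B y ^ (1 / s) with hN
  have hNm : Measurable N := hB.pow_const _
  have hNs : ∀ y, N y ^ s = B y := fun y => by
    rw [hN]; simp only; rw [← ENNReal.rpow_mul, one_div_mul_cancel hs0.ne', ENNReal.rpow_one]
  set K := (∫⁻ y, B y ^ (1 / (s - 1)) ∂ν) ^ (s - 1) with hK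
  have h1 : ∀ x, (∫⁻ y, g y * A x y ∂ν) ^ s ≤ K * ∫⁻ y, (g y * A x y) ^ s / B y ∂ν := by
    intro x
    have e1 : ∫⁻ y, g y * A x y ∂ν = ∫⁻ y, ((fun y => g y * A x y / N y) * N) y ∂ν := by
      refine lintegral_congr_ae ?_
      filter_upwards [hB0, hBt] with y hy0 hyt
      rw [Pi.mul_apply, ENNReal.div_mul_cancel]
      · exact (ENNReal.rpow_pos (pos_iff_ne_zero.2 hy0) hyt).ne'
      · exact ENNReal.rpow_ne_top_of_nonneg (by positivity) hyt
    have e2 := ENNReal.lintegral_mul_le_Lp_mul_Lq ν hpq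
      (f := fun y => g y * A x y / N y) (g := N)
      ((hg.mul (hAx x)).div hNm).aemeasurable hNm.aemeasurable
    rw [← e1] at e2
    have e3 := ENNReal.rpow_le_rpow e2 hs0.le
    rw [ENNReal.mul_rpow_of_nonneg _ _ hs0.le, ← ENNReal.rpow_mul, ← ENNReal.rpow_mul,
      one_div_mul_cancel hs0.ne', ENNReal.rpow_one] at e3
    refine e3.trans (le_of_eq ?_)
    rw [mul_comm]
    congr 1
    · rw [hK]
      congr 1
      · refine lintegral_congr fun y => ?_
        rw [hN]; simp only; rw [← ENNReal.rpow_mul]; congr 1; field_simp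
      · field_simp
    · refine lintegral_congr fun y => ?_
      rw [ENNReal.div_rpow_of_nonneg _ _ hs0.le, hNs]
  have hm2 : Measurable (Function.uncurry fun x y => (g y * A x y) ^ s / B y) :=
    (((hg.comp measurable_snd).mul hA).pow_const s).div (hB.comp measurable_snd)
  calc ∫⁻ x, (∫⁻ y, g y * A x y ∂ν) ^ s ∂μ
      ≤ ∫⁻ x, K * ∫⁻ y, (g y * A x y) ^ s / B y ∂ν ∂μ := lintegral_mono h1
    _ = K * ∫⁻ x, ∫⁻ y, (g y * A x y) ^ s / B y ∂ν ∂μ :=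
        lintegral_const_mul _ hm2.lintegral_prod_right'
    _ = K * ∫⁻ y, ∫⁻ x, (g y * A x y) ^ s / B y ∂μ ∂ν := by
        rw [lintegral_lintegral_swap hm2.aemeasurable]
    _ ≤ K * ∫⁻ y, g y ^ s ∂ν := by
        refine mul_le_mul_right (lintegral_mono_ae ?_) _
        filter_upwards [hB0, hBt, h] with y hy0 hyt hy
        have hAy : Measurable fun x => A x y ^ s :=
          (hA.comp measurable_prodMk_right).pow_const s
        have e1 : ∀ x, (g y * A x y) ^ s / B y = (g y ^ s / B y) * A x y ^ s := fun x => by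
          rw [ENNReal.mul_rpow_of_nonneg _ _ hs0.le, div_eq_mul_inv, div_eq_mul_inv]; ring
        simp only [e1]
        rw [lintegral_const_mul _ hAy]
        calc g y ^ s / B y * ∫⁻ x, A x y ^ s ∂μ ≤ g y ^ s / B y * B y := mul_le_mul_right hy _
          _ = g y ^ s := ENNReal.div_mul_cancel hy0 hyt

lemma differentiableOn_cauchyIntegral {X : Type*} [MeasurableSpace X] {μ : Measure X}
    {p v : X → ℂ} (hp : Measurable p) (hp1 : ∀ x, ‖p x‖ ≤ 1) (hv : Integrable v μ) :
    Holo fun z => ∫ x, v x / (1 - z * conj (p x)) ∂μ := by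
  intro z₀ hz₀
  rw [mem_unitDisk] at hz₀
  set ε := (1 - ‖z₀‖) / 2 with hε
  have hε0 : 0 < ε := by rw [hε]; linarith
  have hcp : Measurable fun x => conj (p x) := Complex.continuous_conj.measurable.comp hp
  have hball : ∀ z ∈ Metric.ball z₀ ε, ‖z‖ < 1 - ε := by
    intro z hz
    rw [Metric.mem_ball, dist_eq_norm] at hz
    have := norm_sub_norm_le z z₀
    rw [hε] at *; linarith
  have hlow : ∀ z ∈ Metric.ball z₀ ε, ∀ x, ε ≤ ‖1 - z * conj (p x)‖ := by
    intro z hz x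
    have h1 := one_sub_norm_le_norm_one_sub_mul (w := z) (ξ := conj (p x))
      (by rw [RCLike.norm_conj]; exact hp1 x)
    linarith [hball z hz]
  have hmeas : ∀ z, AEStronglyMeasurable (fun x => v x / (1 - z * conj (p x))) μ := fun z => by
    simp only [div_eq_mul_inv]
    exact hv.1.mul ((measurable_const.sub (hcp.const_mul z)).inv).aestronglyMeasurable
  have key := hasDerivAt_integral_of_dominated_loc_of_deriv_le (μ := μ) (𝕜 := ℂ)
    (F := fun z x => v x / (1 - z * conj (p x)))
    (F' := fun z x => v x * conj (p x) / (1 - z * conj (p x)) ^ 2)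
    (bound := fun x => ‖v x‖ * (ε ^ 2)⁻¹) (x₀ := z₀) (s := Metric.ball z₀ ε)
    (Metric.ball_mem_nhds z₀ hε0) (Eventually.of_forall hmeas) ?_ ?_ ?_ ?_ ?_
  · exact key.2.differentiableAt.differentiableWithinAt
  · refine (hv.norm.mul_const ε⁻¹).mono' (hmeas z₀) (ae_of_all _ fun x => ?_)
    rw [norm_div, div_eq_mul_inv]
    gcongr
    exact hlow z₀ (Metric.mem_ball_self hε0) x
  · simp only [div_eq_mul_inv]
    exact (hv.1.mul hcp.aestronglyMeasurable).mul
      (((measurable_const.sub (hcp.const_mul z₀)).pow_const 2).inv).aestronglyMeasurable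
  · refine ae_of_all _ fun x z hz => ?_
    rw [norm_div, norm_mul, norm_pow, RCLike.norm_conj, div_eq_mul_inv]
    gcongr
    · exact mul_le_of_le_one_right (norm_nonneg _) (hp1 x)
    · exact hlow z hz x
  · exact hv.norm.mul_const _
  · refine ae_of_all _ fun x z hz => ?_
    have hne : 1 - z * conj (p x) ≠ 0 := norm_pos_iff.1 (hε0.trans_le (hlow z hz x))
    have h1 := ((((hasDerivAt_id z).mul_const (conj (p x))).const_sub 1).inv hne).const_mul (v x)
    refine (h1.congr_deriv ?_)
    simp only [id]
    field_simp

/-- The Cauchy-type area integral `∫_D v(w) / (1 - z conj w) dA(w)`. -/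
def areaCauchy (v : ℂ → ℂ) (z : ℂ) : ℂ := ∫ w in unitDisk, v w / (1 - z * conj w)

/-- The majorant of `areaCauchy` at the boundary. -/
def areaMajorant (v : ℂ → ℂ) (θ : ℝ) : ℝ≥0∞ :=
  ∫⁻ w in unitDisk, ‖v w‖ₑ * ENNReal.ofReal ‖1 - circ θ * conj w‖⁻¹

/-- `v` is dominated by `g (w) ((1 - |w|) / |w|) ^ (1 - 1 / s)`. -/
def IsDominated (s : ℝ) (v : ℂ → ℂ) (g : ℂ → ℝ≥0∞) : Prop :=
  Measurable v ∧ Measurable g ∧ ∀ w ∈ unitDisk, w ≠ 0 →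
    ‖v w‖ₑ ≤ g w * ENNReal.ofReal (((1 - ‖w‖) / ‖w‖) ^ (1 - 1 / s))

lemma ae_mem_unitDisk_ne_zero : ∀ᵐ w ∂(volume.restrict unitDisk), w ∈ unitDisk ∧ w ≠ 0 := by
  have h1 := ae_restrict_mem (μ := (volume : Measure ℂ)) measurableSet_unitDisk
  have h2 : ∀ᵐ w ∂(volume.restrict unitDisk), w ≠ (0 : ℂ) := by
    refine ae_restrict_of_ae ?_
    simp [ae_iff, measure_singleton]
  filter_upwards [h1, h2] with w a b using ⟨a, b⟩

lemma measurable_norm_one_sub_circ : Measurable fun p : ℝ × ℂ => ‖1 - circ p.1 * conj p.2‖ := by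
  have : Continuous fun p : ℝ × ℂ => ‖1 - circ p.1 * conj p.2‖ :=
    continuous_norm.comp (continuous_const.sub ((continuous_circ.comp continuous_fst).mul
      (Complex.continuous_conj.comp continuous_snd)))
  exact this.measurable

lemma measurable_areaMajorant {v : ℂ → ℂ} (hv : Measurable v) : Measurable (areaMajorant v) := by
  have : Measurable fun p : ℝ × ℂ => ‖v p.2‖ₑ * ENNReal.ofReal ‖1 - circ p.1 * conj p.2‖⁻¹ :=
    (hv.comp measurable_snd).enorm.mul (ENNReal.measurable_ofReal.comp
      measurable_norm_one_sub_circ.inv)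
  exact this.lintegral_prod_right'

lemma rpow_weight {s c d : ℝ} (hs : 1 < s) (hc : 0 < c) (hd : 0 < d) :
    ((d / c) ^ (1 - 1 / s)) ^ s = c ^ (1 - s) * d ^ (s - 1) := by
  rw [← rpow_mul (by positivity), show (1 - 1 / s) * s = s - 1 by field_simp,
    div_rpow hd.le hc.le, show 1 - s = -(s - 1) by ring, rpow_neg hc.le, div_eq_mul_inv, mul_comm]

/-- Schur test with `B(w) = C₁ ‖w‖^(1-s)`: the angular integral of `|1 - ξ conj w|^(-s)` is of order
`(1-‖w‖)^(1-s)`, which the weight `((1-‖w‖)/‖w‖)^(s-1)` exactly compensates. Then `B^(1/(s-1))` is a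
multiple of `‖w‖⁻¹`, integrable on the disk. -/
theorem exists_lintegral_areaMajorant_le {s : ℝ} (hs : 1 < s) :
    ∃ C : ℝ≥0∞, C ≠ ∞ ∧ ∀ (v : ℂ → ℂ) (g : ℂ → ℝ≥0∞), IsDominated s v g →
      ∫⁻ θ, areaMajorant v θ ^ s ∂arc ≤ C * ∫⁻ w in unitDisk, g w ^ s := by
  have hs0 : 0 < s := by linarith
  have hs1 : 0 < s - 1 := by linarith
  obtain ⟨C₁, hC₁, h₁⟩ := exists_lintegral_arc_rpow_le hs
  set B : ℂ → ℝ≥0∞ := fun w => ENNReal.ofReal (C₁ * ‖w‖ ^ (1 - s)) with hB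
  set A : ℝ → ℂ → ℝ≥0∞ := fun θ w => ENNReal.ofReal (((1 - ‖w‖) / ‖w‖) ^ (1 - 1 / s)) *
    ENNReal.ofReal ‖1 - circ θ * conj w‖⁻¹ with hA
  have hAm : Measurable (Function.uncurry A) := by
    refine Measurable.mul ?_ (ENNReal.measurable_ofReal.comp measurable_norm_one_sub_circ.inv)
    exact ENNReal.measurable_ofReal.comp (by fun_prop)
  refine ⟨(∫⁻ w in unitDisk, B w ^ (1 / (s - 1))) ^ (s - 1), ?_, fun v g hvg => ?_⟩
  · refine ENNReal.rpow_ne_top_of_nonneg hs1.le (ne_of_lt ?_)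
    calc ∫⁻ w in unitDisk, B w ^ (1 / (s - 1))
        = ∫⁻ w in unitDisk, ENNReal.ofReal (C₁ ^ (1 / (s - 1))) * ENNReal.ofReal ‖w‖⁻¹ := by
          refine lintegral_congr_ae ?_
          filter_upwards [ae_mem_unitDisk_ne_zero] with w hw
          have hw0 : 0 < ‖w‖ := norm_pos_iff.2 hw.2
          rw [hB]
          simp only
          rw [ENNReal.ofReal_rpow_of_nonneg (by positivity) (by positivity),
            ← ENNReal.ofReal_mul (by positivity), mul_rpow hC₁.le (by positivity),
            ← rpow_mul hw0.le, show (1 - s) * (1 / (s - 1)) = -1 by field_simp; ring,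
            rpow_neg_one]
      _ = ENNReal.ofReal (C₁ ^ (1 / (s - 1))) * ∫⁻ w in unitDisk, ENNReal.ofReal ‖w‖⁻¹ :=
          lintegral_const_mul' _ _ ENNReal.ofReal_ne_top
      _ < ∞ := ENNReal.mul_lt_top ENNReal.ofReal_lt_top lintegral_unitDisk_inv_norm_lt_top
  · obtain ⟨hv, hg, hvg⟩ := hvg
    refine le_trans ?_ (lintegral_rpow_lintegral_mul_le (μ := arc) (ν := volume.restrict unitDisk)
      hs hAm hg (B := B) (by rw [hB]; fun_prop) ?_ (ae_of_all _ fun _ => ENNReal.ofReal_ne_top) ?_)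
    · refine lintegral_mono fun θ => ENNReal.rpow_le_rpow ?_ hs0.le
      refine lintegral_mono_ae ?_
      filter_upwards [ae_mem_unitDisk_ne_zero] with w hw
      rw [hA, ← mul_assoc]
      exact mul_le_mul_left (hvg w hw.1 hw.2) _
    · filter_upwards [ae_mem_unitDisk_ne_zero] with w hw
      have hw0 : 0 < ‖w‖ := norm_pos_iff.2 hw.2
      rw [hB]
      have : 0 < C₁ * ‖w‖ ^ (1 - s) := by positivity
      simpa using this
    · filter_upwards [ae_mem_unitDisk_ne_zero] with w hw
      have hw0 : 0 < ‖w‖ := norm_pos_iff.2 hw.2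
      have hw1 : ‖w‖ < 1 := mem_unitDisk.1 hw.1
      have hd : 0 < 1 - ‖w‖ := by linarith
      have e1 : ∀ θ, A θ w ^ s = ENNReal.ofReal (‖w‖ ^ (1 - s) * (1 - ‖w‖) ^ (s - 1)) *
          ENNReal.ofReal (‖1 - circ θ * conj w‖ ^ (-s)) := by
        intro θ
        rw [hA]
        simp only
        rw [ENNReal.mul_rpow_of_nonneg _ _ hs0.le,
          ENNReal.ofReal_rpow_of_nonneg (by positivity) hs0.le,
          ENNReal.ofReal_rpow_of_nonneg (by positivity) hs0.le, rpow_weight hs hw0 hd,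
          inv_rpow (norm_nonneg _), rpow_neg (norm_nonneg _)]
      simp only [e1]
      rw [lintegral_const_mul' _ _ ENNReal.ofReal_ne_top]
      refine (mul_le_mul_right (h₁ w hw1) _).trans (le_of_eq ?_)
      rw [← ENNReal.ofReal_mul (by positivity), hB]
      congr 1
      rw [show 1 - s = -(s - 1) by ring, rpow_neg hd.le]
      field_simp

/-! ### Boundary behaviour of Cauchy-type area integrals -/

lemma holo_areaCauchy {v : ℂ → ℂ} (hv : IntegrableOn v unitDisk) : Holo (areaCauchy v) := by
  -- The indicator makes the bound by `1` hold everywhere without changing the integral.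
  have h1 := differentiableOn_cauchyIntegral (μ := volume.restrict unitDisk)
    (p := unitDisk.indicator id) (measurable_id.indicator measurableSet_unitDisk) (fun x => ?_) hv
  · refine (DifferentiableOn.congr h1 fun z _ => ?_ : DifferentiableOn ℂ (areaCauchy v) unitDisk)
    refine setIntegral_congr_fun measurableSet_unitDisk fun w hw => ?_
    simp only [indicator_of_mem hw, id]
  · by_cases hx : x ∈ unitDisk
    · rw [indicator_of_mem hx]; exact (mem_unitDisk.1 hx).le
    · rw [indicator_of_notMem hx]; simp

lemma norm_one_sub_circ_pos {w : ℂ} (hw : ‖w‖ < 1) (θ : ℝ) : 0 < ‖1 - circ θ * conj w‖ :=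
  (by linarith : (0 : ℝ) < 1 - ‖w‖).trans_le (one_sub_norm_le w θ)

lemma norm_one_sub_circ_le {w : ℂ} (hw : ‖w‖ < 1) (θ : ℝ) : ‖1 - circ θ * conj w‖ ≤ 2 := by
  have := norm_sub_le 1 (circ θ * conj w)
  rw [norm_one, norm_mul, norm_circ, RCLike.norm_conj] at this
  linarith

lemma integrableOn_of_areaMajorant_lt_top {v : ℂ → ℂ} (hv : Measurable v) {θ : ℝ}
    (h : areaMajorant v θ < ∞) : IntegrableOn v unitDisk := by
  refine ⟨hv.aestronglyMeasurable, ?_⟩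
  rw [hasFiniteIntegral_iff_enorm]
  calc ∫⁻ w in unitDisk, ‖v w‖ₑ
      ≤ ∫⁻ w in unitDisk, ENNReal.ofReal 2 *
          (‖v w‖ₑ * ENNReal.ofReal ‖1 - circ θ * conj w‖⁻¹) := by
        refine setLIntegral_mono' measurableSet_unitDisk fun w hw => ?_
        rw [mem_unitDisk] at hw
        rw [mul_left_comm, ← ENNReal.ofReal_mul zero_le_two]
        refine le_mul_of_one_le_right' ?_
        rw [ENNReal.one_le_ofReal, ← div_eq_mul_inv, one_le_div (norm_one_sub_circ_pos hw θ)]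
        exact norm_one_sub_circ_le hw θ
    _ = ENNReal.ofReal 2 * areaMajorant v θ := lintegral_const_mul' _ _ ENNReal.ofReal_ne_top
    _ < ∞ := ENNReal.mul_lt_top ENNReal.ofReal_lt_top h

/-- As `1 - r ≤ |1 - rξ conj w|`, moving `rξ` out to `ξ` at most doubles the denominator. Hence the
integrand at the boundary dominates the whole radius, for maximal bounds and for dominated
convergence. -/
lemma norm_div_one_sub_radial_le {v w : ℂ} (hw : ‖w‖ < 1) {r : ℝ} (hr : r ∈ Ioo (0 : ℝ) 1)
    (θ : ℝ) : ‖v / (1 - r * circ θ * conj w)‖ ≤ 2 * (‖v‖ * ‖1 - circ θ * conj w‖⁻¹) := by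
  have hn : ‖(r : ℂ) * circ θ‖ = r := by
    rw [norm_mul, norm_circ, mul_one, Complex.norm_real, Real.norm_of_nonneg hr.1.le]
  have h1 : 1 - r ≤ ‖1 - r * circ θ * conj w‖ := by
    have := one_sub_norm_le_norm_one_sub_mul (w := (r : ℂ) * circ θ) (ξ := conj w)
      (by rw [RCLike.norm_conj]; exact hw.le)
    rwa [hn] at this
  have h2 : ‖1 - circ θ * conj w‖ ≤ ‖1 - r * circ θ * conj w‖ + (1 - r) := by
    have e : 1 - circ θ * conj w = (1 - r * circ θ * conj w) - ((1 - r : ℝ) : ℂ) * circ θ * conj w := by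
      push_cast; ring
    rw [e]
    refine (norm_sub_le _ _).trans ?_
    gcongr
    rw [norm_mul, norm_mul, norm_circ, RCLike.norm_conj, Complex.norm_real,
      Real.norm_of_nonneg (by linarith [hr.2])]
    nlinarith [hr.2]
  have h3 : 0 < ‖1 - r * circ θ * conj w‖ := lt_of_lt_of_le (by linarith [hr.2]) h1
  have h4 := norm_one_sub_circ_pos hw θ
  rw [norm_div, ← div_eq_mul_inv, mul_div_assoc', div_le_div_iff₀ h3 h4]
  nlinarith [norm_nonneg v]

lemma enorm_areaCauchy_radial_le (v : ℂ → ℂ) {r : ℝ} (hr : r ∈ Ioo (0 : ℝ) 1) (θ : ℝ) :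
    ‖areaCauchy v (r * circ θ)‖ₑ ≤ ENNReal.ofReal 2 * areaMajorant v θ := by
  refine (enorm_integral_le_lintegral_enorm _).trans ?_
  rw [areaMajorant, ← lintegral_const_mul' _ _ ENNReal.ofReal_ne_top]
  refine setLIntegral_mono' measurableSet_unitDisk fun w hw => ?_
  rw [← ofReal_norm, ← ofReal_norm, ← ENNReal.ofReal_mul (norm_nonneg _),
    ← ENNReal.ofReal_mul zero_le_two]
  exact ENNReal.ofReal_le_ofReal (norm_div_one_sub_radial_le (mem_unitDisk.1 hw) hr θ)

lemma integrableOn_div_one_sub_circ {v : ℂ → ℂ} (hv : Measurable v) {θ : ℝ}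
    (h : areaMajorant v θ < ∞) :
    IntegrableOn (fun w => v w / (1 - circ θ * conj w)) unitDisk := by
  have hm : Measurable fun w => v w / (1 - circ θ * conj w) := by
    exact hv.div (measurable_const.sub (Complex.continuous_conj.measurable.const_mul _))
  refine ⟨hm.aestronglyMeasurable, ?_⟩
  rw [hasFiniteIntegral_iff_enorm]
  refine lt_of_le_of_lt (le_of_eq ?_) h
  refine lintegral_congr fun w => ?_
  rw [← ofReal_norm, ← ofReal_norm, ← ENNReal.ofReal_mul (norm_nonneg _), norm_div, div_eq_mul_inv]

lemma tendsto_areaCauchy_radial {v : ℂ → ℂ} (hv : Measurable v) {θ : ℝ}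
    (h : areaMajorant v θ < ∞) :
    Tendsto (fun r : ℝ => areaCauchy v (r * circ θ)) (𝓝[<] 1) (𝓝 (areaCauchy v (circ θ))) := by
  refine tendsto_integral_filter_of_dominated_convergence
    (fun w => 2 * (‖v w‖ * ‖1 - circ θ * conj w‖⁻¹)) ?_ ?_ ?_ ?_
  · refine Eventually.of_forall fun r => ?_
    have hm : Measurable fun w => v w / (1 - r * circ θ * conj w) := by
      exact hv.div (measurable_const.sub (Complex.continuous_conj.measurable.const_mul _))
    exact hm.aestronglyMeasurable
  · filter_upwards [Ioo_mem_nhdsLT (zero_lt_one' ℝ)] with r hr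
    filter_upwards [ae_restrict_mem measurableSet_unitDisk] with w hw
    exact norm_div_one_sub_radial_le (mem_unitDisk.1 hw) hr θ
  · have h1 := (integrableOn_div_one_sub_circ hv h).norm.const_mul 2
    refine h1.congr (ae_of_all _ fun w => ?_)
    simp only [div_eq_mul_inv, norm_mul, norm_inv]
  · filter_upwards [ae_restrict_mem measurableSet_unitDisk] with w hw
    have hne : 1 - circ θ * conj w ≠ 0 := norm_pos_iff.1 (norm_one_sub_circ_pos (mem_unitDisk.1 hw) θ)
    have hc : ContinuousAt (fun r : ℝ => v w / (1 - r * circ θ * conj w)) 1 := by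
      refine ContinuousAt.div continuousAt_const (by fun_prop) (by simpa using hne)
    have := hc.tendsto.mono_left (nhdsWithin_le_nhds (s := Iio 1))
    simpa using this

lemma bdry_areaCauchy {v : ℂ → ℂ} (hv : Measurable v) {θ : ℝ} (h : areaMajorant v θ < ∞) :
    bdry (areaCauchy v) θ = areaCauchy v (circ θ) :=
  bdry_eq_of_tendsto (tendsto_areaCauchy_radial hv h)

/-- Lets an almost-everywhere statement on the circle produce an actual point. -/
instance : NeZero arc := ⟨by
  rw [arc, Ne, Measure.restrict_eq_zero, Real.volume_Ioc, sub_zero, ENNReal.ofReal_eq_zero]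
  exact not_le.2 two_pi_pos⟩

lemma IsDominated.ae_areaMajorant_lt_top {s : ℝ} (hs : 1 < s) {v : ℂ → ℂ} {g : ℂ → ℝ≥0∞}
    (h : IsDominated s v g) (hg : ∫⁻ w in unitDisk, g w ^ s < ∞) :
    ∀ᵐ θ ∂arc, areaMajorant v θ < ∞ := by
  obtain ⟨C, hC, h1⟩ := exists_lintegral_areaMajorant_le hs
  have h2 := (h1 v g h).trans_lt (ENNReal.mul_lt_top hC.lt_top hg)
  filter_upwards [ae_lt_top ((measurable_areaMajorant h.1).pow_const s) h2.ne] with θ hθ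
  exact (ENNReal.rpow_lt_top_iff_of_pos (by linarith)).1 hθ

lemma IsDominated.integrableOn {s : ℝ} (hs : 1 < s) {v : ℂ → ℂ} {g : ℂ → ℝ≥0∞}
    (h : IsDominated s v g) (hg : ∫⁻ w in unitDisk, g w ^ s < ∞) : IntegrableOn v unitDisk := by
  obtain ⟨θ, hθ⟩ := (h.ae_areaMajorant_lt_top hs hg).exists
  exact integrableOn_of_areaMajorant_lt_top h.1 hθ

theorem IsDominated.memHardy {s : ℝ} (hs : 1 < s) {v : ℂ → ℂ} {g : ℂ → ℝ≥0∞}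
    (h : IsDominated s v g) (hg : ∫⁻ w in unitDisk, g w ^ s < ∞) : MemHardy s (areaCauchy v) := by
  have hs0 : 0 ≤ s := by linarith
  refine ⟨holo_areaCauchy (h.integrableOn hs hg), ?_⟩
  obtain ⟨C, hC, h1⟩ := exists_lintegral_areaMajorant_le hs
  have h2 := (h1 v g h).trans_lt (ENNReal.mul_lt_top hC.lt_top hg)
  refine lt_of_le_of_lt (b := ENNReal.ofReal 2 ^ s * ∫⁻ θ, areaMajorant v θ ^ s ∂arc)
    (iSup₂_le fun r hr => ?_) (ENNReal.mul_lt_top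
      (ENNReal.rpow_lt_top_of_nonneg hs0 ENNReal.ofReal_ne_top) h2)
  rw [← lintegral_const_mul' _ _ (ENNReal.rpow_ne_top_of_nonneg hs0 ENNReal.ofReal_ne_top)]
  refine lintegral_mono fun θ => ?_
  rw [← ENNReal.mul_rpow_of_nonneg _ _ hs0, ← ENNReal.ofReal_rpow_of_nonneg (norm_nonneg _) hs0,
    ofReal_norm]
  exact ENNReal.rpow_le_rpow (enorm_areaCauchy_radial_le v hr θ) hs0

/-- The difference of the kernels at `ξ` and `a` is `(ξ - a) conj w` over the product of their
denominators, and `|ξ - a| = |1 - ξ conj a|`. -/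
lemma enorm_areaCauchy_circ_sub_le {v : ℂ → ℂ} (hv : Measurable v) {θ : ℝ}
    (h : areaMajorant v θ < ∞) {a : ℂ} (ha : ‖a‖ < 1) :
    ‖areaCauchy v (circ θ) - areaCauchy v a‖ₑ ≤ ENNReal.ofReal ‖1 - circ θ * conj a‖ *
      ∫⁻ w in unitDisk, ‖v w‖ₑ * (ENNReal.ofReal ‖1 - circ θ * conj w‖⁻¹ *
        ENNReal.ofReal ‖1 - a * conj w‖⁻¹) := by
  have hi : IntegrableOn (fun w => v w / (1 - a * conj w)) unitDisk := by
    have h1 := integrableOn_of_areaMajorant_lt_top hv h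
    have hm : Measurable fun w => v w / (1 - a * conj w) :=
      hv.div (measurable_const.sub (Complex.continuous_conj.measurable.const_mul _))
    refine (h1.norm.mul_const (1 - ‖a‖)⁻¹).mono' hm.aestronglyMeasurable ?_
    filter_upwards [ae_restrict_mem measurableSet_unitDisk] with w hw
    rw [div_eq_mul_inv, norm_mul]
    gcongr
    exact norm_inv_one_sub_mul_le ha (by rw [RCLike.norm_conj]; exact (mem_unitDisk.1 hw).le)
  rw [areaCauchy, areaCauchy, ← integral_sub (integrableOn_div_one_sub_circ hv h) hi,
    ← lintegral_const_mul' _ _ ENNReal.ofReal_ne_top]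
  refine (enorm_integral_le_lintegral_enorm _).trans ?_
  refine setLIntegral_mono' measurableSet_unitDisk fun w hw => ?_
  have hw := mem_unitDisk.1 hw
  have hx : 1 - circ θ * conj w ≠ 0 := norm_pos_iff.1 (norm_one_sub_circ_pos hw θ)
  have hy : 1 - a * conj w ≠ 0 := one_sub_mul_ne_zero ha.le (by rwa [RCLike.norm_conj])
  have e : v w / (1 - circ θ * conj w) - v w / (1 - a * conj w)
      = (circ θ - a) * (v w * (conj w * ((1 - circ θ * conj w)⁻¹ * (1 - a * conj w)⁻¹))) := by
    rw [div_sub_div _ _ hx hy, ← mul_inv, div_eq_mul_inv]; ring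
  rw [e, ← ofReal_norm, ← ofReal_norm, ← ENNReal.ofReal_mul (inv_nonneg.2 (norm_nonneg _)),
    ← ENNReal.ofReal_mul (norm_nonneg _), ← ENNReal.ofReal_mul (norm_nonneg _)]
  refine ENNReal.ofReal_le_ofReal ?_
  rw [norm_mul, norm_mul, norm_mul, norm_mul, norm_inv, norm_inv, RCLike.norm_conj,
    norm_sub_eq_norm_one_sub (norm_circ θ)]
  refine mul_le_mul_of_nonneg_left (mul_le_mul_of_nonneg_left ?_ (norm_nonneg _)) (norm_nonneg _)
  exact mul_le_of_le_one_left (by positivity) hw.le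

/-- Write `L = |1 - ξ conj a|`, `δ = 1 - |a|`. The difference formula leaves the weight `L^s
L^(1-2s) (1-|a|²)`, that is `L^(1-s) (1-|a|²)`. It is put into the kernel `A` of the Schur test,
whose angular integral is the two-parameter estimate and whose weight `B` is integrated over the
disk. -/
theorem exists_lintegral_areaCauchy_sub_le {s : ℝ} (hs : 1 < s) (hs2 : s ≤ 2) :
    ∃ C : ℝ≥0, ∀ (v : ℂ → ℂ) (g : ℂ → ℝ≥0∞), IsDominated s v g →
      ∫⁻ w in unitDisk, g w ^ s < ∞ → ∀ a ∈ unitDisk,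
      (∫⁻ θ, ENNReal.ofReal (‖bdry (areaCauchy v) θ - areaCauchy v a‖ ^ s /
        ‖1 - circ θ * conj a‖ ^ (2 * s - 1)) ∂arc) * ENNReal.ofReal (1 - ‖a‖ ^ 2)
        ≤ C * ∫⁻ w in unitDisk, g w ^ s := by
  have hs0 : 0 < s := by linarith
  have hs1 : 0 < s - 1 := by linarith
  -- Only half of the exponent `s - 1` of `1/L` is kept, since the two-parameter estimate needs `κ <
  -- 1`, while `s - 1` reaches `1` at `s = 2`. `P` is the exponent of `|1 - a conj w|⁻¹` in
  -- `B^(1/(s-1))`.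
  set κ := (s - 1) / 2 with hκ
  set P := (s + κ) / (s - 1) with hP
  obtain ⟨C₁, hC₁, h₁⟩ := exists_lintegral_arc_rpow_mul_rpow_le (κ := κ) (s := s)
    (by rw [hκ]; linarith) (by rw [hκ]; linarith) hs
  obtain ⟨C₂, hC₂, h₂⟩ := exists_lintegral_unitDisk_le (b := 0) (P := P) (by norm_num)
    (by rw [hP, lt_div_iff₀ hs1, hκ]; linarith)
  refine ⟨((2 * C₁) ^ (1 / (s - 1)) * C₂).toNNReal ^ (s - 1), fun v g hvg hg a ha => ?_⟩
  have ha := mem_unitDisk.1 ha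
  have hδ : 0 < 1 - ‖a‖ := by linarith
  set δ := 1 - ‖a‖ with hδdef
  set M : ℝ → ℝ := fun θ => (2 * δ ^ (1 - κ) * ‖1 - circ θ * conj a‖ ^ (-κ)) with hM
  have hM0 : ∀ θ, 0 ≤ M θ := fun θ => by rw [hM]; positivity
  set A : ℝ → ℂ → ℝ≥0∞ := fun θ w => ENNReal.ofReal (((1 - ‖w‖) / ‖w‖) ^ (1 - 1 / s)) *
    (ENNReal.ofReal ‖1 - circ θ * conj w‖⁻¹ * ENNReal.ofReal ‖1 - a * conj w‖⁻¹) *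
    ENNReal.ofReal (M θ ^ (1 / s)) with hA
  set B : ℂ → ℝ≥0∞ := fun w => ENNReal.ofReal
    (2 * C₁ * δ ^ (1 - κ) * ‖w‖ ^ (1 - s) * ‖1 - a * conj w‖ ^ (-(s + κ))) with hB
  have hcm : Measurable fun w : ℂ => ‖1 - a * conj w‖ :=
    (measurable_const.sub (Complex.continuous_conj.measurable.const_mul a)).norm
  have hMm : Measurable M := by
    have : Measurable fun θ => ‖1 - circ θ * conj a‖ :=
      (measurable_const.sub (measurable_circ.mul_const _)).norm
    exact (this.pow_const _).const_mul _
  have hAm : Measurable (Function.uncurry A) := by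
    refine Measurable.mul (M := ℝ≥0∞) (Measurable.mul (M := ℝ≥0∞) ?_ (Measurable.mul (M := ℝ≥0∞) ?_ ?_)) ?_
    · exact ENNReal.measurable_ofReal.comp (by fun_prop)
    · exact ENNReal.measurable_ofReal.comp measurable_norm_one_sub_circ.inv
    · exact ENNReal.measurable_ofReal.comp (hcm.comp measurable_snd).inv
    · exact ENNReal.measurable_ofReal.comp ((hMm.comp measurable_fst).pow_const _)
  have hBm : Measurable B := by
    have h3 : Measurable fun w : ℂ => 2 * C₁ * δ ^ (1 - κ) * ‖w‖ ^ (1 - s) := by fun_prop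
    exact ENNReal.measurable_ofReal.comp (h3.mul (hcm.pow_const _))
  have hy : ∀ w ∈ unitDisk, 0 < ‖1 - a * conj w‖ := fun w hw => norm_pos_iff.2
    (one_sub_mul_ne_zero ha.le (by rw [RCLike.norm_conj]; exact mem_unitDisk.1 hw))
  have schur := lintegral_rpow_lintegral_mul_le (μ := arc) (ν := volume.restrict unitDisk)
      hs hAm hvg.2.1 (B := B) hBm ?_ (ae_of_all _ fun _ => ENNReal.ofReal_ne_top) ?_
  · refine le_trans ?_ (schur.trans (mul_le_mul_left ?_ _))
    · rw [← lintegral_mul_const' _ _ ENNReal.ofReal_ne_top]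
      refine lintegral_mono_ae ?_
      filter_upwards [hvg.ae_areaMajorant_lt_top hs hg] with θ hθ
      rw [bdry_areaCauchy hvg.1 hθ]
      have hL : δ ≤ ‖1 - circ θ * conj a‖ := one_sub_norm_le a θ
      have hL0 := hδ.trans_le hL
      set L := ‖1 - circ θ * conj a‖ with hLdef
      set J := ∫⁻ w in unitDisk, ‖v w‖ₑ * (ENNReal.ofReal ‖1 - circ θ * conj w‖⁻¹ *
        ENNReal.ofReal ‖1 - a * conj w‖⁻¹) with hJ
      have e1 : ENNReal.ofReal (‖areaCauchy v (circ θ) - areaCauchy v a‖ ^ s / L ^ (2 * s - 1))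
          = ‖areaCauchy v (circ θ) - areaCauchy v a‖ₑ ^ s * ENNReal.ofReal (L ^ (1 - 2 * s)) := by
        rw [← ofReal_norm, ENNReal.ofReal_rpow_of_nonneg (norm_nonneg _) hs0.le,
          ← ENNReal.ofReal_mul (by positivity), show 1 - 2 * s = -(2 * s - 1) by ring,
          rpow_neg hL0.le, div_eq_mul_inv]
      rw [e1]
      -- `L^(1-s) = L^(-κ) L^(-κ)`; one factor is bounded by `δ^(-κ)` and `1 - |a|²` by `2δ`.
      have e2 : L ^ s * L ^ (1 - 2 * s) * (1 - ‖a‖ ^ 2) ≤ M θ := by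
        rw [← rpow_add hL0, hM]
        simp only
        rw [← hLdef, show s + (1 - 2 * s) = -κ + -κ by rw [hκ]; ring, rpow_add hL0,
          show 1 - ‖a‖ ^ 2 = δ * (1 + ‖a‖) by rw [hδdef]; ring]
        calc L ^ (-κ) * L ^ (-κ) * (δ * (1 + ‖a‖)) ≤ L ^ (-κ) * δ ^ (-κ) * (δ * 2) := by
              gcongr ?_ * ?_ * (_ * ?_)
              · exact rpow_le_rpow_of_nonpos hδ hL (by rw [hκ]; linarith)
              · linarith
          _ = 2 * δ ^ (1 - κ) * L ^ (-κ) := by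
              rw [show 1 - κ = -κ + 1 by ring, rpow_add_one hδ.ne']; ring
      calc ‖areaCauchy v (circ θ) - areaCauchy v a‖ₑ ^ s * ENNReal.ofReal (L ^ (1 - 2 * s)) *
            ENNReal.ofReal (1 - ‖a‖ ^ 2)
          ≤ (ENNReal.ofReal L * J) ^ s * ENNReal.ofReal (L ^ (1 - 2 * s)) *
            ENNReal.ofReal (1 - ‖a‖ ^ 2) := by
            gcongr
            exact enorm_areaCauchy_circ_sub_le hvg.1 hθ ha
        _ = J ^ s * ENNReal.ofReal (L ^ s * L ^ (1 - 2 * s) * (1 - ‖a‖ ^ 2)) := by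
            rw [ENNReal.mul_rpow_of_nonneg _ _ hs0.le,
              ENNReal.ofReal_rpow_of_nonneg hL0.le hs0.le, ENNReal.ofReal_mul (by positivity),
              ENNReal.ofReal_mul (by positivity)]
            ring
        _ ≤ J ^ s * ENNReal.ofReal (M θ ^ (1 / s)) ^ s := by
            rw [ENNReal.ofReal_rpow_of_nonneg (rpow_nonneg (hM0 θ) _) hs0.le, ← rpow_mul (hM0 θ),
              one_div_mul_cancel hs0.ne', rpow_one]
            gcongr
        _ = (J * ENNReal.ofReal (M θ ^ (1 / s))) ^ s :=
            (ENNReal.mul_rpow_of_nonneg _ _ hs0.le).symm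
        _ ≤ _ := by
            refine ENNReal.rpow_le_rpow ?_ hs0.le
            rw [hJ, ← lintegral_mul_const' _ _ ENNReal.ofReal_ne_top]
            refine lintegral_mono_ae ?_
            filter_upwards [ae_mem_unitDisk_ne_zero] with w hw
            rw [hA]
            simp only
            rw [← mul_assoc (g w), ← mul_assoc (g w)]
            exact mul_le_mul_left (mul_le_mul_left (hvg.2.2 w hw.1 hw.2) _) _
    · rw [ENNReal.coe_rpow_of_nonneg _ hs1.le]
      refine ENNReal.rpow_le_rpow ?_ hs1.le
      change _ ≤ ENNReal.ofReal ((2 * C₁) ^ (1 / (s - 1)) * C₂)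
      calc ∫⁻ w in unitDisk, B w ^ (1 / (s - 1))
          = ∫⁻ w in unitDisk, ENNReal.ofReal ((2 * C₁) ^ (1 / (s - 1)) *
              δ ^ ((1 - κ) * (1 / (s - 1)))) *
              ENNReal.ofReal (‖w‖⁻¹ * (1 - ‖w‖) ^ (0 : ℝ) * ‖1 - a * conj w‖ ^ (-P)) := by
            refine lintegral_congr_ae ?_
            filter_upwards [ae_mem_unitDisk_ne_zero] with w hw
            have hw0 : 0 < ‖w‖ := norm_pos_iff.2 hw.2
            have hy0 := hy w hw.1
            rw [hB]
            simp only
            rw [ENNReal.ofReal_rpow_of_nonneg (by positivity) (by positivity),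
              ← ENNReal.ofReal_mul (by positivity), mul_rpow (by positivity) (by positivity),
              mul_rpow (by positivity) (by positivity), mul_rpow (by positivity) (by positivity),
              ← rpow_mul hw0.le, ← rpow_mul hy0.le, ← rpow_mul hδ.le,
              show (1 - s) * (1 / (s - 1)) = -1 by field_simp; ring,
              show -(s + κ) * (1 / (s - 1)) = -P by rw [hP]; ring, rpow_neg_one, rpow_zero, mul_one]
            congr 1; ring
        _ = ENNReal.ofReal ((2 * C₁) ^ (1 / (s - 1)) * δ ^ ((1 - κ) * (1 / (s - 1)))) *
              ∫⁻ w in unitDisk,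
              ENNReal.ofReal (‖w‖⁻¹ * (1 - ‖w‖) ^ (0 : ℝ) * ‖1 - a * conj w‖ ^ (-P)) :=
            lintegral_const_mul' _ _ ENNReal.ofReal_ne_top
        _ ≤ ENNReal.ofReal ((2 * C₁) ^ (1 / (s - 1)) * δ ^ ((1 - κ) * (1 / (s - 1)))) *
              ENNReal.ofReal (C₂ * δ ^ (0 + 2 - P)) := mul_le_mul_right (h₂ a ha) _
        _ = _ := by
            rw [← ENNReal.ofReal_mul (by positivity)]
            congr 1
            -- The exponents cancel because `2κ = s - 1`; this makes the bound uniform in `a`.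
            have : δ ^ ((1 - κ) * (1 / (s - 1))) * δ ^ (0 + 2 - P) = 1 := by
              have h0 : (1 - κ) * (1 / (s - 1)) + (0 + 2 - P) = 0 := by
                rw [hP, hκ]; field_simp; ring
              rw [← rpow_add hδ, h0, rpow_zero]
            calc _ = (2 * C₁) ^ (1 / (s - 1)) * C₂ *
                  (δ ^ ((1 - κ) * (1 / (s - 1))) * δ ^ (0 + 2 - P)) := by ring
              _ = _ := by rw [this, mul_one]
  · filter_upwards [ae_mem_unitDisk_ne_zero] with w hw
    have hw0 : 0 < ‖w‖ := norm_pos_iff.2 hw.2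
    have hy0 := hy w hw.1
    have : 0 < 2 * C₁ * δ ^ (1 - κ) * ‖w‖ ^ (1 - s) * ‖1 - a * conj w‖ ^ (-(s + κ)) := by
      positivity
    rw [hB]
    simpa using this
  · filter_upwards [ae_mem_unitDisk_ne_zero] with w hw
    have hw0 : 0 < ‖w‖ := norm_pos_iff.2 hw.2
    have hw1 : ‖w‖ < 1 := mem_unitDisk.1 hw.1
    have hd : 0 < 1 - ‖w‖ := by linarith
    have hy0 := hy w hw.1
    have e1 : ∀ θ, A θ w ^ s = ENNReal.ofReal (‖w‖ ^ (1 - s) * (1 - ‖w‖) ^ (s - 1) *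
        ‖1 - a * conj w‖ ^ (-s) * (2 * δ ^ (1 - κ))) *
        ENNReal.ofReal (‖1 - circ θ * conj a‖ ^ (-κ) * ‖1 - circ θ * conj w‖ ^ (-s)) := by
      intro θ
      rw [hA]
      simp only
      rw [← ENNReal.ofReal_mul (by positivity), ← ENNReal.ofReal_mul (by positivity),
        ← ENNReal.ofReal_mul (by positivity), ENNReal.ofReal_rpow_of_nonneg (mul_nonneg
          (by positivity) (rpow_nonneg (hM0 θ) _)) hs0.le, ← ENNReal.ofReal_mul (by positivity),
        mul_rpow (by positivity) (rpow_nonneg (hM0 θ) _), mul_rpow (by positivity) (by positivity),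
        rpow_weight hs hw0 hd, ← rpow_mul (hM0 θ), one_div_mul_cancel hs0.ne', rpow_one,
        mul_rpow (by positivity) (by positivity), inv_rpow (norm_nonneg _),
        inv_rpow (norm_nonneg _), rpow_neg (norm_nonneg (1 - circ θ * conj w)) s,
        rpow_neg (norm_nonneg (1 - a * conj w)) s]
      congr 1; rw [hM]; ring
    simp only [e1]
    rw [lintegral_const_mul' _ _ ENNReal.ofReal_ne_top]
    refine (mul_le_mul_right (h₁ a w ha hw1) _).trans (le_of_eq ?_)
    rw [← ENNReal.ofReal_mul (by positivity), hB]
    congr 1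
    rw [show 1 - s = -(s - 1) by ring, rpow_neg hd.le, show -(s + κ) = -s + -κ by ring,
      rpow_add hy0]
    field_simp

theorem exists_bmoaNorm_areaCauchy_le {s : ℝ} (hs : 1 < s) (hs2 : s ≤ 2) :
    ∃ C : ℝ≥0, ∀ (v : ℂ → ℂ) (g : ℂ → ℝ≥0∞), IsDominated s v g →
      ∫⁻ w in unitDisk, g w ^ s < ∞ →
      bmoaNorm s (2 * s - 1) (areaCauchy v) ≤ C * (∫⁻ w in unitDisk, g w ^ s) ^ (1 / s) := by
  have hs0 : 0 ≤ 1 / s := by positivity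
  obtain ⟨C, h⟩ := exists_lintegral_areaCauchy_sub_le hs hs2
  refine ⟨C ^ (1 / s), fun v g hvg hg => iSup₂_le fun a ha => ?_⟩
  rw [ENNReal.coe_rpow_of_nonneg _ hs0, ← ENNReal.mul_rpow_of_nonneg _ _ hs0]
  exact ENNReal.rpow_le_rpow (h v g hvg hg a ha) hs0

/-! ### Representation of Bergman–Besov functions -/

lemma image_exp_neg_Ioi : (fun x : ℝ => rexp (-x)) '' Ioi 0 = Ioo 0 1 := by
  ext y
  constructor
  · rintro ⟨x, hx, rfl⟩
    exact ⟨exp_pos _, by simpa using hx⟩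
  · rintro ⟨h0, h1⟩
    exact ⟨-log y, by simpa using log_neg h0 h1, by simp [exp_log h0]⟩

section

variable {a k : ℝ}

lemma integrableOn_gamma (ha : 0 < a) (hk : 0 < k) :
    IntegrableOn (fun x : ℝ => x ^ (k - 1) * rexp (-(a * x))) (Ioi 0) :=
  .of_integral_ne_zero (by
    rw [integral_rpow_mul_exp_neg_mul_Ioi hk ha]
    exact (mul_pos (rpow_pos_of_pos (by positivity) _) (Gamma_pos_of_pos hk)).ne')

lemma exp_neg_smul_rpow (x : ℝ) : |-rexp (-x)| • (rexp (-x) ^ (a - 1) * (-log (rexp (-x))) ^ (k - 1))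
    = x ^ (k - 1) * rexp (-(a * x)) := by
  rw [log_exp, neg_neg, abs_neg, abs_of_pos (exp_pos _), smul_eq_mul, ← exp_mul, ← mul_assoc,
    ← exp_add, mul_comm]
  ring_nf

lemma integrableOn_rpow_mul_neg_log_rpow (ha : 0 < a) (hk : 0 < k) :
    IntegrableOn (fun r : ℝ => r ^ (a - 1) * (-log r) ^ (k - 1)) (Ioo 0 1) := by
  rw [← image_exp_neg_Ioi, integrableOn_image_iff_integrableOn_abs_deriv_smul measurableSet_Ioi
    (f' := fun x => -rexp (-x)) (fun x _ => ?_) (fun x _ y _ h => by simpa using h)]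
  · simp only [exp_neg_smul_rpow]
    exact integrableOn_gamma ha hk
  · simpa using (hasDerivAt_neg x).exp.hasDerivWithinAt

/-- The substitution `r = e^{-x}` turns this into the Gamma integral. It replaces the Beta integral
of the usual weight `(1-r)^(k-1)` so that the exact factor `(n+1)^(-k)` appears. -/
lemma integral_rpow_mul_neg_log_rpow (ha : 0 < a) (hk : 0 < k) :
    ∫ r in Ioo (0 : ℝ) 1, r ^ (a - 1) * (-log r) ^ (k - 1) = Gamma k * a ^ (-k) := by
  rw [← image_exp_neg_Ioi, integral_image_eq_integral_abs_deriv_smul measurableSet_Ioi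
    (f' := fun x => -rexp (-x)) (fun x _ => ?_) (fun x _ y _ h => by simpa using h)]
  · simp only [exp_neg_smul_rpow]
    rw [integral_rpow_mul_exp_neg_mul_Ioi hk ha, one_div, inv_rpow ha.le, rpow_neg ha.le, mul_comm]
  · simpa using (hasDerivAt_neg x).exp.hasDerivWithinAt

end

/-- Near `t = 1` the logarithm is comparable to `1 - t`. When `k > 1` its blow-up at `0` must be
absorbed by `t^(-σ)`; when `k < 1` the exponent is negative and `-2 log t ≥ 1 - t` suffices. -/
lemma exists_rpow_neg_two_log_le (k : ℝ) {σ : ℝ} (hσ : 0 < σ) :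
    ∃ C : ℝ, 0 < C ∧ ∀ t ∈ Ioo (0 : ℝ) 1,
      (-2 * log t) ^ (k - 1) ≤ C * (1 - t) ^ (k - 1) * t ^ (-σ) := by
  rcases le_or_gt 1 k with hk | hk
  · set ε := σ / (σ + k) with hε
    have hε0 : 0 < ε := by rw [hε]; positivity
    have hε1 : ε ≤ 1 := by rw [hε, div_le_one (by positivity)]; linarith
    have hεk : ε * (k - 1) ≤ σ := by
      rw [hε, div_mul_eq_mul_div, div_le_iff₀ (by positivity)]
      nlinarith
    refine ⟨(2 * ε⁻¹) ^ (k - 1), by positivity, fun t ht => ?_⟩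
    have ht0 : 0 < t := ht.1
    have hd : 0 < 1 - t := by linarith [ht.2]
    have h1 : -2 * log t ≤ 2 * ε⁻¹ * (1 - t) * t ^ (-ε) := by
      have h2 : log (t ^ (-ε)) ≤ t ^ (-ε) - 1 := log_le_sub_one_of_pos (by positivity)
      rw [log_rpow ht0] at h2
      have h3 : t ^ (-ε) - 1 ≤ (1 - t) * t ^ (-ε) := by
        have h4 : t * t ^ (-ε) ≤ 1 := by
          have h7 := rpow_add ht0 1 (-ε)
          rw [rpow_one] at h7
          rw [← h7]
          exact rpow_le_one ht0.le ht.2.le (by linarith)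
        linarith
      have h5 : ε⁻¹ * (-ε * log t) ≤ ε⁻¹ * ((1 - t) * t ^ (-ε)) :=
        mul_le_mul_of_nonneg_left (by linarith) (by positivity)
      have h6 : ε⁻¹ * (-ε * log t) = - log t := by field_simp
      linarith
    have hl : 0 ≤ -2 * log t := by have := log_neg ht.1 ht.2; linarith
    calc (-2 * log t) ^ (k - 1) ≤ (2 * ε⁻¹ * (1 - t) * t ^ (-ε)) ^ (k - 1) :=
          rpow_le_rpow hl h1 (by linarith)
      _ = (2 * ε⁻¹) ^ (k - 1) * (1 - t) ^ (k - 1) * t ^ (-(ε * (k - 1))) := by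
          rw [mul_rpow (by positivity) (by positivity), mul_rpow (by positivity) hd.le,
            ← rpow_mul ht0.le, neg_mul]
      _ ≤ _ := by
          exact mul_le_mul_of_nonneg_left
            (rpow_le_rpow_of_exponent_ge ht0 ht.2.le (by linarith)) (by positivity)
  · refine ⟨1, one_pos, fun t ht => ?_⟩
    have hd : 0 < 1 - t := by linarith [ht.2]
    have h1 : 1 - t ≤ -2 * log t := by
      have := log_le_sub_one_of_pos ht.1
      linarith
    have h2 : 1 ≤ t ^ (-σ) := one_le_rpow_of_pos_of_le_one_of_nonpos ht.1 ht.2.le (by linarith)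
    rw [one_mul]
    calc (-2 * log t) ^ (k - 1) ≤ (1 - t) ^ (k - 1) :=
          rpow_le_rpow_of_nonpos hd h1 (by linarith)
      _ ≤ _ := le_mul_of_one_le_right (by positivity) h2

lemma exists_add_one_rpow_mul_pow_le (k : ℝ) {r R : ℝ} (h0 : 0 ≤ r) (h1 : r < R) :
    ∃ C : ℝ, 0 ≤ C ∧ ∀ n : ℕ, ((n : ℝ) + 1) ^ k * r ^ n ≤ C * R ^ n := by
  have hR : 0 < R := h0.trans_lt h1
  obtain ⟨m, hm⟩ := exists_nat_ge k
  -- The `1 / 2` keeps `t` positive when `r = 0`, since `t` is divided by later.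
  set t := max (r / R) (1 / 2) with ht
  have ht0 : 0 < t := lt_of_lt_of_le (by norm_num) (le_max_right _ _)
  have ht1 : t < 1 := max_lt ((div_lt_one hR).2 h1) (by norm_num)
  obtain ⟨C, hC⟩ := (tendsto_pow_const_mul_const_pow_of_abs_lt_one m
    (by rwa [abs_of_pos ht0])).bddAbove_range
  have hC' : ∀ n : ℕ, ((n : ℝ) + 1) ^ m * t ^ (n + 1) ≤ C := fun n => by
    simpa using hC ⟨n + 1, rfl⟩
  refine ⟨C / t, div_nonneg (le_trans (by positivity) (hC' 0)) ht0.le, fun n => ?_⟩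
  have h2 : r ≤ t * R := (div_le_iff₀ hR).1 (le_max_left _ _)
  have h3 : ((n : ℝ) + 1) ^ k ≤ ((n : ℝ) + 1) ^ m := by
    rw [← rpow_natCast]
    exact rpow_le_rpow_of_exponent_le (by linarith [n.cast_nonneg (α := ℝ)]) hm
  calc ((n : ℝ) + 1) ^ k * r ^ n ≤ ((n : ℝ) + 1) ^ m * (t * R) ^ n := by gcongr
    _ = ((n : ℝ) + 1) ^ m * t ^ (n + 1) / t * R ^ n := by rw [mul_pow, pow_succ]; field_simp
    _ ≤ C / t * R ^ n := by
        gcongr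
        exact hC' n

section

variable {f : ℂ → ℂ}

lemma Holo.summable_weighted_coeff (hf : Holo f) (k : ℝ) {r : ℝ} (h0 : 0 ≤ r) (h1 : r < 1) :
    Summable fun n : ℕ => ((n : ℝ) + 1) ^ k * ‖coeff f n‖ * r ^ n := by
  obtain ⟨C, hC, h⟩ := exists_add_one_rpow_mul_pow_le k h0 (by linarith : r < (1 + r) / 2)
  refine Summable.of_nonneg_of_le (fun n => by positivity) (fun n => ?_)
    ((hf.summable_coeff (r := (1 + r) / 2) (by linarith) (by linarith)).mul_left C)
  calc ((n : ℝ) + 1) ^ k * ‖coeff f n‖ * r ^ n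
      = ((n : ℝ) + 1) ^ k * r ^ n * ‖coeff f n‖ := by ring
    _ ≤ C * ((1 + r) / 2) ^ n * ‖coeff f n‖ := mul_le_mul_of_nonneg_right (h n) (norm_nonneg _)
    _ = _ := by ring

lemma norm_fracDeriv_term (k : ℝ) (f : ℂ → ℂ) (n : ℕ) (z : ℂ) :
    ‖((((n : ℝ) + 1) ^ k : ℝ) : ℂ) * coeff f n * z ^ n‖
      = ((n : ℝ) + 1) ^ k * ‖coeff f n‖ * ‖z‖ ^ n := by
  rw [norm_mul, norm_mul, norm_pow, Complex.norm_real, Real.norm_of_nonneg (by positivity)]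

lemma Holo.hasSum_fracDeriv (hf : Holo f) (k : ℝ) {z : ℂ} (hz : ‖z‖ < 1) :
    HasSum (fun n : ℕ => ((((n : ℝ) + 1) ^ k : ℝ) : ℂ) * coeff f n * z ^ n) (fracDeriv k f z) := by
  refine (Summable.of_norm ?_).hasSum
  simpa only [norm_fracDeriv_term] using hf.summable_weighted_coeff k (norm_nonneg z) hz

lemma Holo.fracDeriv (hf : Holo f) (k : ℝ) : Holo (fracDeriv k f) := by
  intro z hz
  rw [mem_unitDisk] at hz
  have h1 : DifferentiableOn ℂ (BergmanBesov.fracDeriv k f) (Metric.ball 0 ((1 + ‖z‖) / 2)) := by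
    refine Complex.differentiableOn_tsum_of_summable_norm (hf.summable_weighted_coeff k
      (r := (1 + ‖z‖) / 2) (by positivity) (by linarith)) (fun n => by fun_prop)
      Metric.isOpen_ball fun n w hw => ?_
    rw [norm_fracDeriv_term]
    rw [Metric.mem_ball, dist_zero_right] at hw
    gcongr
  refine (h1.differentiableAt (Metric.isOpen_ball.mem_nhds ?_)).differentiableWithinAt
  rw [Metric.mem_ball, dist_zero_right]; linarith

lemma Holo.measurable_indicator (hf : Holo f) : Measurable (unitDisk.indicator f) := by
  classical
  rw [← piecewise_eq_indicator]
  exact hf.continuousOn.measurable_piecewise continuousOn_const measurableSet_unitDisk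

/-- The density whose Cauchy-type area integral recovers `f`. -/
def besovDensity (k : ℝ) (f : ℂ → ℂ) (w : ℂ) : ℂ :=
  unitDisk.indicator (fracDeriv k f) w * (((-2 * log ‖w‖) ^ (k - 1) : ℝ) : ℂ)

/-- The `L^s` majorant of `besovDensity`. -/
def besovMajorant (C s k : ℝ) (f : ℂ → ℂ) (w : ℂ) : ℝ≥0∞ :=
  ENNReal.ofReal (C * ‖unitDisk.indicator (fracDeriv k f) w‖ *
    (1 - ‖w‖) ^ (k - 1 - (1 - 1 / s)))

lemma Holo.measurable_besovDensity (hf : Holo f) (k : ℝ) : Measurable (besovDensity k f) :=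
  (hf.fracDeriv k).measurable_indicator.mul (Complex.measurable_ofReal.comp (by fun_prop))

lemma exists_isDominated_besovDensity {s : ℝ} (hs : 1 < s) (k : ℝ) :
    ∃ C : ℝ, 0 < C ∧ ∀ f, Holo f → IsDominated s (besovDensity k f) (besovMajorant C s k f) := by
  have hσ : 0 < 1 - 1 / s := by
    rw [sub_pos, div_lt_one (by linarith)]; exact hs
  obtain ⟨C, hC, h⟩ := exists_rpow_neg_two_log_le k hσ
  refine ⟨C, hC, fun f hf => ⟨hf.measurable_besovDensity k, ?_, fun w hw hw0 => ?_⟩⟩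
  · refine ENNReal.measurable_ofReal.comp (Measurable.mul (M := ℝ) ?_ (by fun_prop))
    exact (hf.fracDeriv k).measurable_indicator.norm.const_mul C
  · have hw1 := mem_unitDisk.1 hw
    have hw0 : 0 < ‖w‖ := norm_pos_iff.2 hw0
    have hd : 0 < 1 - ‖w‖ := by linarith
    have hl : 0 ≤ -2 * log ‖w‖ := by have := log_neg hw0 hw1; linarith
    rw [besovMajorant, besovDensity, ← ofReal_norm, ← ENNReal.ofReal_mul (by positivity),
      norm_mul, Complex.norm_real, Real.norm_of_nonneg (by positivity)]
    refine ENNReal.ofReal_le_ofReal ?_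
    calc ‖unitDisk.indicator (BergmanBesov.fracDeriv k f) w‖ * (-2 * log ‖w‖) ^ (k - 1)
        ≤ ‖unitDisk.indicator (BergmanBesov.fracDeriv k f) w‖ *
          (C * (1 - ‖w‖) ^ (k - 1) * ‖w‖ ^ (-(1 - 1 / s))) := by
          gcongr
          exact h _ ⟨hw0, hw1⟩
      _ = _ := by
          rw [div_rpow hd.le hw0.le, rpow_sub hd _ (1 - 1 / s), rpow_neg hw0.le]
          field_simp

/-- The exponents match: `s (k - 1 - (1 - 1/s)) = sk + 1 - 2s`, the weight of the Besov norm. -/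
lemma lintegral_besovMajorant {C s k : ℝ} (hs : 0 < s) (hC : 0 < C) (f : ℂ → ℂ) :
    (∫⁻ w in unitDisk, besovMajorant C s k f w ^ s) ^ (1 / s)
      = ENNReal.ofReal C * besovNorm s k f := by
  have e : ∀ w ∈ unitDisk, besovMajorant C s k f w ^ s = ENNReal.ofReal C ^ s *
      ENNReal.ofReal (‖fracDeriv k f w‖ ^ s * (1 - ‖w‖) ^ (s * k + 1 - 2 * s)) := by
    intro w hw
    have hw1 := mem_unitDisk.1 hw
    have hd : 0 < 1 - ‖w‖ := by linarith
    rw [besovMajorant, indicator_of_mem hw, ENNReal.ofReal_rpow_of_nonneg (by positivity) hs.le,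
      ENNReal.ofReal_rpow_of_nonneg hC.le hs.le, ← ENNReal.ofReal_mul (by positivity),
      mul_rpow (by positivity) (by positivity), mul_rpow hC.le (norm_nonneg _), ← rpow_mul hd.le,
      show (k - 1 - (1 - 1 / s)) * s = s * k + 1 - 2 * s by field_simp; ring, mul_assoc]
  rw [setLIntegral_congr_fun measurableSet_unitDisk e, lintegral_const_mul' _ _
    (ENNReal.rpow_ne_top_of_nonneg hs.le ENNReal.ofReal_ne_top),
    ENNReal.mul_rpow_of_nonneg _ _ (by positivity), ← ENNReal.rpow_mul,
    mul_one_div_cancel hs.ne', ENNReal.rpow_one, besovNorm]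

lemma integral_besovDensity_circle (hf : Holo f) (k : ℝ) {z : ℂ} (hz : ‖z‖ < 1) {r : ℝ}
    (hr : r ∈ Ioo (0 : ℝ) 1) :
    ∫ θ, besovDensity k f (r * circ θ) / (1 - z * conj (r * circ θ)) ∂arc
      = (((-2 * log r) ^ (k - 1) : ℝ) : ℂ) * (2 * π * fracDeriv k f (r * (r * z))) := by
  have hn : ∀ θ, ‖(r : ℂ) * circ θ‖ = r := fun θ => by
    rw [norm_mul, norm_circ, mul_one, Complex.norm_real, Real.norm_of_nonneg hr.1.le]
  have hrz : ‖(r : ℂ) * z‖ < 1 := by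
    rw [norm_mul, Complex.norm_real, Real.norm_of_nonneg hr.1.le]
    nlinarith [hr.1, hr.2, norm_nonneg z]
  rw [← integral_cauchy (diffContOnCl_of_differentiableOn_ball hr
    ((hf.fracDeriv k).diffContOnCl_dilate hr)) hrz, ← integral_const_mul]
  refine integral_congr_ae (ae_of_all _ fun θ => ?_)
  simp only [besovDensity]
  rw [hn, indicator_of_mem (mem_unitDisk.2 (by rw [hn]; exact hr.2)), map_mul, Complex.conj_ofReal]
  ring

lemma radial_besov_term {k : ℝ} (n : ℕ) {r : ℝ} (hr : r ∈ Ioo (0 : ℝ) 1) (c z : ℂ) :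
    (r : ℂ) * ((((-2 * log r) ^ (k - 1) : ℝ) : ℂ) * (2 * π * (c * (r * (r * z)) ^ n)))
      = 2 * π * (c * z ^ n) *
        ((2 ^ (k - 1) * (r ^ ((2 * n + 2 : ℝ) - 1) * (-log r) ^ (k - 1)) : ℝ) : ℂ) := by
  have hl : 0 ≤ -log r := by have := log_neg hr.1 hr.2; linarith
  have e1 : (-2 * log r) ^ (k - 1) = 2 ^ (k - 1) * (-log r) ^ (k - 1) := by
    rw [← mul_rpow (by norm_num) hl]; ring_nf
  have e2 : r ^ ((2 * n + 2 : ℝ) - 1) = r ^ (2 * n + 1) := by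
    rw [← rpow_natCast]; congr 1; push_cast; ring
  rw [e1, e2]
  push_cast
  ring

/-- In polar coordinates Cauchy's formula on the circle of radius `r` produces `D^k f(r² z)`. The
radial integral of `r^(2n+1) (-2 log r)^(k-1)` is `Γ(k) (n+1)^(-k) / 2`, which removes the
multiplier `(n+1)^k` from each Taylor term. -/
theorem areaCauchy_besovDensity {k : ℝ} (hk : 0 < k) (hf : Holo f)
    (hi : IntegrableOn (besovDensity k f) unitDisk) {z : ℂ} (hz : ‖z‖ < 1) :
    areaCauchy (besovDensity k f) z = π * Gamma k * f z := by
  have hm : Measurable fun w => besovDensity k f w / (1 - z * conj w) :=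
    (hf.measurable_besovDensity k).div
      (measurable_const.sub (Complex.continuous_conj.measurable.const_mul _))
  have hint : IntegrableOn (fun w => besovDensity k f w / (1 - z * conj w)) unitDisk := by
    refine (hi.norm.mul_const (1 - ‖z‖)⁻¹).mono' hm.aestronglyMeasurable ?_
    filter_upwards [ae_restrict_mem measurableSet_unitDisk] with w hw
    rw [div_eq_mul_inv, norm_mul]
    gcongr
    exact norm_inv_one_sub_mul_le hz (by rw [RCLike.norm_conj]; exact (mem_unitDisk.1 hw).le)
  rw [areaCauchy, integral_unitDisk hm hint]
  set F : ℕ → ℝ → ℂ := fun n r =>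
    2 * π * (((((n : ℝ) + 1) ^ k : ℝ) : ℂ) * coeff f n * z ^ n) *
        ((2 ^ (k - 1) * (r ^ ((2 * n + 2 : ℝ) - 1) * (-log r) ^ (k - 1)) : ℝ) : ℂ) with hF
  have hFi : ∀ n, IntegrableOn (F n) (Ioo 0 1) := fun n =>
    (((integrableOn_rpow_mul_neg_log_rpow (by positivity : (0 : ℝ) < 2 * n + 2) hk).const_mul
      (2 ^ (k - 1))).ofReal (𝕜 := ℂ)).const_mul _
  have hval : ∀ n : ℕ, ∫ r in Ioo (0 : ℝ) 1, 2 ^ (k - 1) *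
      (r ^ ((2 * n + 2 : ℝ) - 1) * (-log r) ^ (k - 1)) = Gamma k * ((n : ℝ) + 1) ^ (-k) / 2 := by
    intro n
    rw [integral_const_mul, integral_rpow_mul_neg_log_rpow (by positivity) hk,
      show (2 * n + 2 : ℝ) = 2 * (n + 1) by ring, mul_rpow (by norm_num) (by positivity),
      show k - 1 = k + -1 by ring, rpow_add two_pos, rpow_neg two_pos.le k, rpow_neg_one]
    field_simp
  have hFv : ∀ n, ∫ r in Ioo (0 : ℝ) 1, F n r = π * Gamma k * (coeff f n * z ^ n) := by
    intro n
    rw [hF]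
    simp only
    rw [integral_const_mul, integral_complex_ofReal, hval, rpow_neg (by positivity)]
    have : (((((n : ℝ) + 1) ^ k : ℝ)) : ℂ) ≠ 0 := by
      rw [Complex.ofReal_ne_zero]; positivity
    push_cast at this ⊢
    field_simp
  have hFn : ∀ n, ∫ r in Ioo (0 : ℝ) 1, ‖F n r‖ = π * Gamma k * (‖coeff f n‖ * ‖z‖ ^ n) := by
    intro n
    have e : ∀ r ∈ Ioo (0 : ℝ) 1, ‖F n r‖ = 2 * π * (((n : ℝ) + 1) ^ k * ‖coeff f n‖ * ‖z‖ ^ n) *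
        (2 ^ (k - 1) * (r ^ ((2 * n + 2 : ℝ) - 1) * (-log r) ^ (k - 1))) := by
      intro r hr
      have hl : 0 ≤ -log r := by have := log_neg hr.1 hr.2; linarith
      have hr0 := hr.1
      rw [hF]
      simp only
      rw [norm_mul, norm_mul, norm_fracDeriv_term, Complex.norm_real,
        Real.norm_of_nonneg (by positivity)]
      congr 2
      simp [abs_of_pos pi_pos]
    rw [setIntegral_congr_fun measurableSet_Ioo e, integral_const_mul, hval,
      rpow_neg (by positivity)]
    field_simp
  have hsum := hasSum_integral_of_summable_integral_norm (μ := volume.restrict (Ioo (0 : ℝ) 1))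
    hFi (by
      simp only [hFn]
      exact (hf.summable_coeff (norm_nonneg z) hz).mul_left _)
  simp only [hFv] at hsum
  rw [((hf.hasSum hz).mul_left ((π : ℂ) * Gamma k)).unique hsum]
  refine setIntegral_congr_fun measurableSet_Ioo fun r hr => ?_
  rw [integral_besovDensity_circle hf k hz hr]
  have hrz : ‖(r : ℂ) * (r * z)‖ < 1 := by
    rw [norm_mul, norm_mul, Complex.norm_real, Real.norm_of_nonneg hr.1.le]
    nlinarith [hr.1, hr.2, norm_nonneg z, mul_nonneg hr.1.le (norm_nonneg z)]
  have h1 := (((hf.hasSum_fracDeriv k hrz).mul_left (2 * (π : ℂ))).mul_left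
    (((-2 * log r) ^ (k - 1) : ℝ) : ℂ)).mul_left (r : ℂ)
  rw [← h1.tsum_eq]
  exact tsum_congr fun n => radial_besov_term n hr _ z

end

/-! ### Sufficiency of boundedness of the symbol -/

section Congruence

variable {f g : ℂ → ℂ}

lemma bmoaNorm_congr (h : ∀ z ∈ unitDisk, f z = g z) (s q : ℝ) : bmoaNorm s q f = bmoaNorm s q g := by
  unfold bmoaNorm
  refine iSup_congr fun z => iSup_congr fun hz => ?_
  simp only [bdry_congr h, h z hz]

lemma MemHardy.congr {s : ℝ} (hf : MemHardy s f) (h : ∀ z ∈ unitDisk, f z = g z) : MemHardy s g := by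
  refine ⟨hf.1.congr fun z hz => (h z hz).symm, lt_of_le_of_lt (iSup₂_mono fun r hr => ?_) hf.2⟩
  refine (lintegral_congr fun θ => ?_).le
  rw [h]
  rw [mem_unitDisk, norm_mul, norm_circ, mul_one, Complex.norm_real, Real.norm_of_nonneg hr.1.le]
  exact hr.2

end Congruence

lemma MemHardy.ae_norm_bdry_le {φ : ℂ → ℂ} (hφ : MemHardy 1 φ) {M : ℝ}
    (hM : ∀ z ∈ unitDisk, ‖φ z‖ ≤ M) : ∀ᵐ θ ∂arc, ‖bdry φ θ‖ ≤ M := by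
  obtain ⟨u, R, hu, -, -, -, h⟩ := hφ.exists_boundary
  filter_upwards [h] with θ hθ
  rw [bdry_eq_of_tendsto hθ]
  refine le_of_tendsto hθ.norm ?_
  filter_upwards [Ioo_mem_nhdsLT (zero_lt_one' ℝ)] with r hr
  refine hM _ ?_
  rw [mem_unitDisk, norm_mul, norm_circ, mul_one, Complex.norm_real, Real.norm_of_nonneg hr.1.le]
  exact hr.2

section

variable {s : ℝ} {v : ℂ → ℂ} {g : ℂ → ℝ≥0∞}

lemma IsDominated.lintegral_areaMajorant_lt_top (hs : 1 < s) (h : IsDominated s v g)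
    (hg : ∫⁻ w in unitDisk, g w ^ s < ∞) : ∫⁻ θ, areaMajorant v θ ∂arc < ∞ := by
  obtain ⟨C, hC, h1⟩ := exists_lintegral_areaMajorant_le hs
  have h2 := (h1 v g h).trans_lt (ENNReal.mul_lt_top hC.lt_top hg)
  -- `x ≤ 1 + x^s` suffices because the circle has finite measure.
  calc ∫⁻ θ, areaMajorant v θ ∂arc ≤ ∫⁻ θ, (1 + areaMajorant v θ ^ s) ∂arc := by
        refine lintegral_mono fun θ => ?_
        rcases le_total (areaMajorant v θ) 1 with h | h
        · exact h.trans le_self_add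
        · refine le_trans ?_ le_add_self
          simpa using ENNReal.rpow_le_rpow_of_exponent_le h hs.le
    _ = arc univ + ∫⁻ θ, areaMajorant v θ ^ s ∂arc := by
        rw [lintegral_add_left measurable_const, lintegral_one]
    _ < ∞ := ENNReal.add_lt_top.2 ⟨measure_lt_top _ _, h2⟩

lemma measurable_cauchyKernel (hv : Measurable v) :
    Measurable fun p : ℝ × ℂ => v p.2 / (1 - circ p.1 * conj p.2) := by
  have hc : Measurable fun p : ℝ × ℂ => 1 - circ p.1 * conj p.2 := by
    have : Continuous fun p : ℝ × ℂ => 1 - circ p.1 * conj p.2 :=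
      continuous_const.sub ((continuous_circ.comp continuous_fst).mul
        (Complex.continuous_conj.comp continuous_snd))
    exact this.measurable
  exact (hv.comp measurable_snd).div hc

lemma enorm_div_one_sub_circ (c w : ℂ) (θ : ℝ) : ‖c / (1 - circ θ * conj w)‖ₑ
    = ‖c‖ₑ * ENNReal.ofReal ‖1 - circ θ * conj w‖⁻¹ := by
  rw [← ofReal_norm, ← ofReal_norm, ← ENNReal.ofReal_mul (norm_nonneg _), norm_div, div_eq_mul_inv]

lemma integrable_cauchyKernel (hv : Measurable v) (h : ∫⁻ θ, areaMajorant v θ ∂arc < ∞) :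
    Integrable (fun p : ℝ × ℂ => v p.2 / (1 - circ p.1 * conj p.2))
      (arc.prod (volume.restrict unitDisk)) := by
  refine ⟨(measurable_cauchyKernel hv).aestronglyMeasurable, ?_⟩
  rw [hasFiniteIntegral_iff_enorm, lintegral_prod _ (measurable_cauchyKernel hv).enorm.aemeasurable]
  simpa only [enorm_div_one_sub_circ, areaMajorant] using h

lemma integral_conj_bdry_mul {φ : ℂ → ℂ} (hφ : MemHardy 1 φ) {w z : ℂ} (hw : ‖w‖ < 1)
    (hz : ‖z‖ < 1) :
    ∫ θ, conj (bdry φ θ) * ((1 - conj (circ θ) * z)⁻¹ * (1 - circ θ * conj w)⁻¹) ∂arc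
      = 2 * π * (conj (φ w) * (1 - z * conj w)⁻¹) := by
  have h := congrArg conj (hφ.integral_bdry_mul_szego hw (z := conj z) (by rwa [RCLike.norm_conj]))
  rw [← integral_conj] at h
  simp only [map_mul, map_inv₀, map_sub, map_one, Complex.conj_conj, Complex.conj_ofReal,
    map_ofNat] at h
  rw [← h]
  refine integral_congr_ae (ae_of_all _ fun θ => ?_)
  simp only
  rw [mul_comm z, mul_comm (circ θ) (conj w)]

/-- The Toeplitz operator with a bounded antiholomorphic symbol acts on the density of a
Cauchy-type area integral by multiplication. -/
theorem toeplitz_conjSymbol_eq {φ f : ℂ → ℂ} (hφ : MemHardy 1 φ) {M : ℝ}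
    (hM : ∀ z ∈ unitDisk, ‖φ z‖ ≤ M) (hv : Measurable v)
    (h : ∫⁻ θ, areaMajorant v θ ∂arc < ∞)
    (hf : ∀ᵐ θ ∂arc, bdry f θ = areaCauchy v (circ θ)) {z : ℂ} (hz : ‖z‖ < 1) :
    toeplitz (conjSymbol φ) f z = areaCauchy (fun w => v w * conj (unitDisk.indicator φ w)) z := by
  have hsm : AEStronglyMeasurable (fun θ => conj (bdry φ θ) * (1 - conj (circ θ) * z)⁻¹) arc := by
    refine (Complex.continuous_conj.comp_aestronglyMeasurable hφ.integrable_bdry.1).mul ?_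
    exact ((measurable_const.sub ((Complex.continuous_conj.measurable.comp
      measurable_circ).mul_const z)).inv).aestronglyMeasurable
  have hbd : ∀ᵐ p : ℝ × ℂ ∂(arc.prod (volume.restrict unitDisk)),
      ‖conj (bdry φ p.1) * (1 - conj (circ p.1) * z)⁻¹‖ ≤ M * (1 - ‖z‖)⁻¹ := by
    refine Measure.quasiMeasurePreserving_fst.ae (p := fun θ =>
      ‖conj (bdry φ θ) * (1 - conj (circ θ) * z)⁻¹‖ ≤ M * (1 - ‖z‖)⁻¹) ?_
    filter_upwards [hφ.ae_norm_bdry_le hM] with θ hθ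
    rw [norm_mul, RCLike.norm_conj, mul_comm (conj (circ θ))]
    gcongr
    · exact (norm_nonneg _).trans hθ
    · exact norm_inv_one_sub_mul_le hz (by rw [RCLike.norm_conj, norm_circ])
  -- Joint integrability for Fubini; boundedness of `φ` and `|z| < 1` make the extra factor bounded.
  have hint := (integrable_cauchyKernel hv h).mul_bdd
    (hsm.comp_quasiMeasurePreserving (Measure.quasiMeasurePreserving_fst
      (ν := (volume : Measure ℂ).restrict unitDisk))) hbd
  have e1 : ∫ θ, bdry f θ * conjSymbol φ θ / (1 - conj (circ θ) * z) ∂arc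
      = ∫ θ, (∫ w in unitDisk, v w / (1 - circ θ * conj w) *
        (conj (bdry φ θ) * (1 - conj (circ θ) * z)⁻¹)) ∂arc := by
    refine integral_congr_ae ?_
    filter_upwards [hf] with θ hθ
    rw [integral_mul_const, hθ, conjSymbol, areaCauchy, div_eq_mul_inv, mul_assoc]
  have e2 : ∫ θ, (∫ w in unitDisk, v w / (1 - circ θ * conj w) *
        (conj (bdry φ θ) * (1 - conj (circ θ) * z)⁻¹)) ∂arc
      = ∫ w in unitDisk, ∫ θ, v w / (1 - circ θ * conj w) *
        (conj (bdry φ θ) * (1 - conj (circ θ) * z)⁻¹) ∂arc :=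
    integral_integral_swap hint
  rw [toeplitz, e1, e2, areaCauchy, ← integral_const_mul]
  refine setIntegral_congr_fun measurableSet_unitDisk fun w hw => ?_
  have e3 : ∀ θ, v w / (1 - circ θ * conj w) * (conj (bdry φ θ) * (1 - conj (circ θ) * z)⁻¹)
      = v w * (conj (bdry φ θ) * ((1 - conj (circ θ) * z)⁻¹ * (1 - circ θ * conj w)⁻¹)) :=
    fun θ => by rw [div_eq_mul_inv]; ring
  simp only [e3]
  rw [integral_const_mul, integral_conj_bdry_mul hφ (mem_unitDisk.1 hw) hz, indicator_of_mem hw]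
  field_simp

end

section

variable {s k : ℝ} {φ f : ℂ → ℂ}

lemma IsDominated.const_mul {s : ℝ} {v : ℂ → ℂ} {g : ℂ → ℝ≥0∞} (h : IsDominated s v g) {p : ℂ → ℂ}
    (hp : Measurable p) {c : ℝ≥0} (hc : ∀ w ∈ unitDisk, ‖p w‖ₑ ≤ c) :
    IsDominated s (fun w => v w * p w) (fun w => c * g w) := by
  refine ⟨h.1.mul hp, h.2.1.const_mul _, fun w hw hw0 => ?_⟩
  rw [enorm_mul, mul_comm, mul_assoc]
  gcongr
  · exact hc w hw
  · exact h.2.2 w hw hw0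

lemma lintegral_const_mul_rpow (hs : 0 < s) (c : ℝ≥0) {g : ℂ → ℝ≥0∞} :
    (∫⁻ w in unitDisk, (c * g w) ^ s) ^ (1 / s) = c * (∫⁻ w in unitDisk, g w ^ s) ^ (1 / s) := by
  have e : ∀ w, (c * g w) ^ s = (c : ℝ≥0∞) ^ s * g w ^ s :=
    fun w => ENNReal.mul_rpow_of_nonneg _ _ hs.le
  simp only [e]
  rw [lintegral_const_mul' _ _ (ENNReal.rpow_ne_top_of_nonneg hs.le ENNReal.coe_ne_top),
    ENNReal.mul_rpow_of_nonneg _ _ (by positivity), ← ENNReal.rpow_mul, mul_one_div_cancel hs.ne',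
    ENNReal.rpow_one]

/-- Every Bergman–Besov function is a Cauchy-type area integral of a dominated density. -/
theorem exists_besov_representation (hs : 1 < s) (hk : 0 < k) :
    ∃ C : ℝ≥0, ∀ f, MemBesov s k f → ∃ v g, IsDominated s v g ∧
      ∫⁻ w in unitDisk, g w ^ s < ∞ ∧
      (∫⁻ w in unitDisk, g w ^ s) ^ (1 / s) = C * besovNorm s k f ∧
      ∀ z ∈ unitDisk, f z = areaCauchy v z := by
  have hs0 : 0 < s := by linarith
  obtain ⟨C₀, hC₀, h0⟩ := exists_isDominated_besovDensity hs k
  have hΓ : 0 < π * Gamma k := mul_pos pi_pos (Gamma_pos_of_pos hk)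
  -- Normalises the constant of the area reproduction formula.
  set c : ℝ≥0 := (π * Gamma k)⁻¹.toNNReal with hc
  refine ⟨c * C₀.toNNReal, fun f hf => ?_⟩
  have hd := h0 f hf.1
  have hg := lintegral_besovMajorant (k := k) hs0 hC₀ f
  have hgt : ∫⁻ w in unitDisk, besovMajorant C₀ s k f w ^ s < ∞ := by
    refine (ENNReal.rpow_lt_top_iff_of_pos (y := 1 / s) (by positivity)).1 ?_
    rw [hg]
    exact ENNReal.mul_lt_top ENNReal.ofReal_lt_top hf.2
  refine ⟨fun w => besovDensity k f w * (((π * Gamma k)⁻¹ : ℝ) : ℂ), _,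
    hd.const_mul measurable_const (c := c) fun w _ => ?_, ?_, ?_, fun z hz => ?_⟩
  · rw [← ofReal_norm, Complex.norm_real, Real.norm_of_nonneg (by positivity), hc]
    rfl
  · refine (ENNReal.rpow_lt_top_iff_of_pos (y := 1 / s) (by positivity)).1 ?_
    rw [lintegral_const_mul_rpow hs0]
    exact ENNReal.mul_lt_top ENNReal.coe_lt_top (ENNReal.rpow_lt_top_of_nonneg (by positivity)
      hgt.ne)
  · rw [lintegral_const_mul_rpow hs0, hg, ENNReal.coe_mul, mul_assoc]
    rfl
  · have h1 := areaCauchy_besovDensity hk hf.1 (hd.integrableOn hs hgt) (mem_unitDisk.1 hz)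
    have h2 : areaCauchy (fun w => besovDensity k f w * (((π * Gamma k)⁻¹ : ℝ) : ℂ)) z
        = areaCauchy (besovDensity k f) z * (((π * Gamma k)⁻¹ : ℝ) : ℂ) := by
      rw [areaCauchy, areaCauchy, ← integral_mul_const]
      refine integral_congr_ae (ae_of_all _ fun w => ?_)
      simp only
      ring
    rw [h2, h1]
    have h3 : (Gamma k : ℂ) ≠ 0 := by exact_mod_cast (Gamma_pos_of_pos hk).ne'
    push_cast
    field_simp

lemma ae_bdry_eq {v : ℂ → ℂ} (hv : Measurable v) (h : ∫⁻ θ, areaMajorant v θ ∂arc < ∞)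
    (hf : ∀ z ∈ unitDisk, f z = areaCauchy v z) : ∀ᵐ θ ∂arc, bdry f θ = areaCauchy v (circ θ) := by
  filter_upwards [ae_lt_top (measurable_areaMajorant hv) h.ne] with θ hθ
  rw [bdry_congr hf, bdry_areaCauchy hv hθ]

theorem inToeplitzDomain_of_memBesov (hs : 1 < s) (hk : 0 < k) (hφ : MemHardy 1 φ)
    (hb : MemHardyInf φ) (hf : MemBesov s k f) : InToeplitzDomain (conjSymbol φ) f := by
  obtain ⟨M, hM⟩ := hb.2
  obtain ⟨C, hC⟩ := exists_besov_representation hs hk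
  obtain ⟨v, g, hvg, hg, -, hfv⟩ := hC f hf
  have h1 := hvg.lintegral_areaMajorant_lt_top hs hg
  have h2 : Integrable (bdry f) arc := by
    refine (integrable_cauchyKernel hvg.1 h1).integral_prod_left.congr ?_
    filter_upwards [ae_bdry_eq hvg.1 h1 hfv] with θ hθ
    rw [hθ, areaCauchy]
  refine h2.mul_bdd (Complex.continuous_conj.comp_aestronglyMeasurable hφ.integrable_bdry.1)
    (c := M) ?_
  filter_upwards [hφ.ae_norm_bdry_le hM] with θ hθ
  rwa [conjSymbol, RCLike.norm_conj]

/-- `T` multiplies the density representing `f` by `conj φ`, so the new density is dominated by `M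
g`, and the estimates for Cauchy-type area integrals apply unchanged. -/
theorem toeplitzBounded_of_memHardyInf (hs : 1 < s) (hs2 : s ≤ 2) (hk : 0 < k)
    (hφ : MemHardy 1 φ) (hb : MemHardyInf φ) :
    ToeplitzBounded s k (2 * s - 1) (conjSymbol φ) := by
  have hs0 : 0 < s := by linarith
  obtain ⟨M, hM⟩ := hb.2
  obtain ⟨C, hC⟩ := exists_besov_representation hs hk
  obtain ⟨C', hC'⟩ := exists_bmoaNorm_areaCauchy_le hs hs2
  refine ⟨C' * M.toNNReal * C, fun f hf _ => ?_⟩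
  obtain ⟨v, g, hvg, hg, hgn, hfv⟩ := hC f hf
  have h1 := hvg.lintegral_areaMajorant_lt_top hs hg
  have hT : ∀ z ∈ unitDisk, toeplitz (conjSymbol φ) f z
      = areaCauchy (fun w => v w * conj (unitDisk.indicator φ w)) z := fun z hz =>
    toeplitz_conjSymbol_eq hφ hM hvg.1 h1 (ae_bdry_eq hvg.1 h1 hfv) (mem_unitDisk.1 hz)
  have hd : IsDominated s (fun w => v w * conj (unitDisk.indicator φ w))
      (fun w => M.toNNReal * g w) := by
    refine hvg.const_mul (Complex.continuous_conj.measurable.comp hφ.1.measurable_indicator)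
      fun w hw => ?_
    rw [Function.comp_apply, indicator_of_mem hw, ← ofReal_norm, RCLike.norm_conj]
    exact ENNReal.ofReal_le_ofReal (hM w hw)
  have hd' : ∫⁻ w in unitDisk, (M.toNNReal * g w) ^ s < ∞ := by
    refine (ENNReal.rpow_lt_top_iff_of_pos (y := 1 / s) (by positivity)).1 ?_
    rw [lintegral_const_mul_rpow hs0]
    exact ENNReal.mul_lt_top ENNReal.coe_lt_top (ENNReal.rpow_lt_top_of_nonneg (by positivity)
      hg.ne)
  have hle : bmoaNorm s (2 * s - 1) (toeplitz (conjSymbol φ) f)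
      ≤ (C' * M.toNNReal * C : ℝ≥0) * besovNorm s k f := by
    rw [bmoaNorm_congr hT]
    refine (hC' _ _ hd hd').trans (le_of_eq ?_)
    rw [lintegral_const_mul_rpow hs0, hgn]
    push_cast
    ring
  exact ⟨⟨(hd.memHardy hs hd').congr fun z hz => (hT z hz).symm,
    hle.trans_lt (ENNReal.mul_lt_top ENNReal.coe_lt_top hf.2)⟩, hle⟩

end

/-! ### Power kernels -/

/-- The power kernel `∑ (n+1)^α x^n`. -/
def powerKernel (α : ℝ) (x : ℂ) : ℂ := ∑' n : ℕ, ((((n : ℝ) + 1) ^ α : ℝ) : ℂ) * x ^ n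

lemma summable_rpow_mul_pow (α : ℝ) {r : ℝ} (h0 : 0 ≤ r) (h1 : r < 1) :
    Summable fun n : ℕ => ((n : ℝ) + 1) ^ α * r ^ n := by
  obtain ⟨C, hC, h⟩ := exists_add_one_rpow_mul_pow_le α h0 (by linarith : r < (1 + r) / 2)
  exact Summable.of_nonneg_of_le (fun n => by positivity) h
    ((summable_geometric_of_lt_one (by linarith) (by linarith)).mul_left C)

lemma norm_powerKernel_term (α : ℝ) (n : ℕ) (x : ℂ) :
    ‖((((n : ℝ) + 1) ^ α : ℝ) : ℂ) * x ^ n‖ = ((n : ℝ) + 1) ^ α * ‖x‖ ^ n := by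
  rw [norm_mul, norm_pow, Complex.norm_real, Real.norm_of_nonneg (by positivity)]

lemma hasSum_powerKernel (α : ℝ) {x : ℂ} (hx : ‖x‖ < 1) :
    HasSum (fun n : ℕ => ((((n : ℝ) + 1) ^ α : ℝ) : ℂ) * x ^ n) (powerKernel α x) := by
  refine (Summable.of_norm ?_).hasSum
  simpa only [norm_powerKernel_term] using summable_rpow_mul_pow α (norm_nonneg x) hx

lemma hasSum_powerKernel_natCast (m : ℕ) {x : ℂ} (hx : ‖x‖ < 1) :
    HasSum (fun n : ℕ => ((n : ℂ) + 1) ^ m * x ^ n) (powerKernel m x) := by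
  refine (hasSum_powerKernel m hx).congr_fun fun n => ?_
  rw [rpow_natCast]; push_cast; rfl

/-- Multiplying by `1 - x` takes differences of coefficients, and `(n+1)^(m+1) - n^(m+1)` is a
polynomial in `n + 1` of degree `m`. This is the recursion behind the integer-order bounds. -/
lemma one_sub_mul_powerKernel (m : ℕ) {x : ℂ} (hx : ‖x‖ < 1) :
    (1 - x) * powerKernel (m + 1 : ℕ) x = ∑ j ∈ Finset.range (m + 1),
      -((-1) ^ (m + 1 - j) * ((m + 1).choose j : ℂ)) * powerKernel j x := by
  have h1 := hasSum_powerKernel_natCast (m + 1) hx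
  -- An index shift; the term `n = 0` vanishes because the exponent is positive.
  have h2 : HasSum (fun n : ℕ => (n : ℂ) ^ (m + 1) * x ^ n) (x * powerKernel (m + 1 : ℕ) x) := by
    rw [← hasSum_nat_add_iff' 1]
    simp only [Finset.range_one, Finset.sum_singleton, Nat.cast_zero, zero_pow (Nat.succ_ne_zero m),
      zero_mul, sub_zero]
    refine (h1.mul_left x).congr_fun fun n => ?_
    push_cast; ring
  have h3 : HasSum (fun n : ℕ => ∑ j ∈ Finset.range (m + 1),
      -((-1) ^ (m + 1 - j) * ((m + 1).choose j : ℂ)) * (((n : ℂ) + 1) ^ j * x ^ n))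
      (∑ j ∈ Finset.range (m + 1),
        -((-1) ^ (m + 1 - j) * ((m + 1).choose j : ℂ)) * powerKernel j x) :=
    hasSum_sum fun j _ => (hasSum_powerKernel_natCast j hx).mul_left _
  have h4 := (h1.sub h2).congr_fun (g := fun n : ℕ => ∑ j ∈ Finset.range (m + 1),
      -((-1) ^ (m + 1 - j) * ((m + 1).choose j : ℂ)) * (((n : ℂ) + 1) ^ j * x ^ n)) fun n => by
    have e : (n : ℂ) ^ (m + 1) = ∑ j ∈ Finset.range (m + 2),
        ((n : ℂ) + 1) ^ j * (-1) ^ (m + 1 - j) * ((m + 1).choose j : ℂ) := by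
      rw [← add_pow]; ring
    symm
    rw [e, Finset.sum_range_succ]
    simp only [Nat.sub_self, pow_zero, mul_one, Nat.choose_self, Nat.cast_one]
    rw [add_mul, sub_add_cancel_right, Finset.sum_mul, ← Finset.sum_neg_distrib]
    refine Finset.sum_congr rfl fun j _ => ?_
    ring
  rw [sub_mul, one_mul]
  exact h4.unique h3

lemma one_sub_norm_pos {x : ℂ} (hx : ‖x‖ < 1) : 0 < ‖1 - x‖ :=
  norm_pos_iff.2 (sub_ne_zero.2 fun h => by rw [← h] at hx; simp at hx)

lemma exists_norm_powerKernel_natCast_le (m : ℕ) :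
    ∃ C : ℝ, 0 < C ∧ ∀ x : ℂ, ‖x‖ < 1 → ‖powerKernel m x‖ ≤ C * ‖1 - x‖ ^ (-(1 + m : ℝ)) := by
  induction m using Nat.strong_induction_on with
  | _ m ih =>
  rcases m with _ | m
  · refine ⟨1, one_pos, fun x hx => le_of_eq ?_⟩
    have h := (hasSum_powerKernel_natCast 0 hx)
    simp only [pow_zero, one_mul] at h
    rw [h.unique (hasSum_geometric_of_norm_lt_one hx)]
    simp [rpow_neg_one]
  · choose! C hC h using ih
    refine ⟨∑ j ∈ Finset.range (m + 1), ((m + 1).choose j : ℝ) * (C j * 2 ^ ((m : ℝ) - j)),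
      Finset.sum_pos (fun j hj => ?_) ⟨0, by simp⟩, fun x hx => ?_⟩
    · have hj' := Finset.mem_range.1 hj
      have := hC j hj'
      have := Nat.choose_pos hj'.le
      positivity
    · have hx0 := one_sub_norm_pos hx
      have hx2 : ‖1 - x‖ ≤ 2 := by
        have := norm_sub_le 1 x; rw [norm_one] at this; linarith
      have e : powerKernel (m + 1 : ℕ) x = (1 - x)⁻¹ * ∑ j ∈ Finset.range (m + 1),
          -((-1) ^ (m + 1 - j) * ((m + 1).choose j : ℂ)) * powerKernel j x := by
        rw [← one_sub_mul_powerKernel m hx, inv_mul_cancel_left₀ (norm_pos_iff.1 hx0)]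
      have e2 : ‖1 - x‖ ^ (-(1 + (m + 1 : ℕ) : ℝ)) = ‖1 - x‖⁻¹ * ‖1 - x‖ ^ (-(1 + m : ℝ)) := by
        rw [← rpow_neg_one, ← rpow_add hx0]; congr 1; push_cast; ring
      rw [e, e2, norm_mul, norm_inv, mul_left_comm, Finset.sum_mul]
      gcongr
      refine (norm_sum_le _ _).trans (Finset.sum_le_sum fun j hj => ?_)
      have hj' := Finset.mem_range.1 hj
      have hjm : (j : ℝ) ≤ m := by exact_mod_cast Nat.lt_succ_iff.1 hj'
      have h0 := hC j hj'
      rw [norm_mul, norm_neg, norm_mul, norm_pow, norm_neg, norm_one, one_pow, one_mul,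
        Complex.norm_natCast, mul_assoc]
      gcongr
      refine (h j hj' x hx).trans ?_
      rw [mul_assoc]
      gcongr
      rw [show -(1 + j : ℝ) = (m - j) + -(1 + m) by ring, rpow_add hx0]
      gcongr

/-- Interpolation down from an integer `m` above `α`: with `β = m - α` in `(0, 1]`, the Gamma
integral writes `(n+1)^(-β)` as an average of `t^n`. So `Γ(β)` times the kernel of order `α` is the
integral of `(-log t)^(β-1)` against the kernel of order `m` at `t x`. The bound then uses `|1 - tx|
≥ (|1 - x| + (1 - t)) / 3`, and `β ≤ 1` allows replacing `-log t` by `1 - t`. -/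
theorem exists_norm_powerKernel_le {α : ℝ} (hα : 0 < α) :
    ∃ C : ℝ, 0 < C ∧ ∀ x : ℂ, ‖x‖ < 1 → ‖powerKernel α x‖ ≤ C * ‖1 - x‖ ^ (-(1 + α)) := by
  set m : ℕ := ⌊α⌋₊ + 1 with hm
  set β : ℝ := m - α with hβ
  have hβ0 : 0 < β := by
    rw [hβ, hm]; push_cast; linarith [Nat.lt_floor_add_one α]
  have hβ1 : β ≤ 1 := by
    rw [hβ, hm]; push_cast; linarith [Nat.floor_le hα.le]
  have hΓ := Gamma_pos_of_pos hβ0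
  obtain ⟨C₁, hC₁, h₁⟩ := exists_norm_powerKernel_natCast_le m
  obtain ⟨C₂, hC₂, h₂⟩ := exists_lintegral_rpow_mul_rpow_le (b := β - 1) (Q := 1 + m)
    (by linarith) (by linarith)
  refine ⟨(Gamma β)⁻¹ * (C₁ * 3 ^ (1 + m : ℝ) * C₂), by positivity, fun x hx => ?_⟩
  have hx0 := one_sub_norm_pos hx
  set F : ℕ → ℝ → ℂ := fun n t => (((n : ℂ) + 1) ^ m * x ^ n) *
    ((t ^ (((n : ℝ) + 1) - 1) * (-log t) ^ (β - 1) : ℝ) : ℂ) with hF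
  have hFi : ∀ n, IntegrableOn (F n) (Ioo 0 1) := fun n =>
    ((integrableOn_rpow_mul_neg_log_rpow (by positivity : (0 : ℝ) < n + 1) hβ0).ofReal
      (𝕜 := ℂ)).const_mul _
  have hpow : ∀ n : ℕ, ((n : ℝ) + 1) ^ m * ((n : ℝ) + 1) ^ (-β) = ((n : ℝ) + 1) ^ α := fun n => by
    rw [← rpow_natCast, ← rpow_add (by positivity)]; congr 1; rw [hβ]; ring
  have hFv : ∀ n, ∫ t in Ioo (0 : ℝ) 1, F n t
      = Gamma β * (((((n : ℝ) + 1) ^ α : ℝ) : ℂ) * x ^ n) := by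
    intro n
    rw [hF]
    simp only
    rw [integral_const_mul, integral_complex_ofReal,
      integral_rpow_mul_neg_log_rpow (by positivity) hβ0, ← hpow]
    push_cast
    ring
  have hFnorm : ∀ n, ∀ t ∈ Ioo (0 : ℝ) 1, ‖F n t‖ = ((n : ℝ) + 1) ^ m * ‖x‖ ^ n *
      (t ^ (((n : ℝ) + 1) - 1) * (-log t) ^ (β - 1)) := by
    intro n t ht
    have hl : 0 ≤ -log t := by have := log_neg ht.1 ht.2; linarith
    have ht0 := ht.1
    rw [hF]
    simp only
    rw [norm_mul, norm_mul, norm_pow, norm_pow, Complex.norm_real,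
      Real.norm_of_nonneg (by positivity)]
    congr 3
    exact_mod_cast Complex.norm_natCast (n + 1)
  have hsum := hasSum_integral_of_summable_integral_norm (μ := volume.restrict (Ioo (0 : ℝ) 1))
    hFi (by
      refine ((summable_rpow_mul_pow α (norm_nonneg x) hx).mul_left (Gamma β)).congr fun n => ?_
      rw [setIntegral_congr_fun measurableSet_Ioo (hFnorm n), integral_const_mul,
        integral_rpow_mul_neg_log_rpow (by positivity) hβ0, ← hpow]
      ring)
  simp only [hFv] at hsum
  have hker : ∀ t ∈ Ioo (0 : ℝ) 1, ∑' n, F n t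
      = (((-log t) ^ (β - 1) : ℝ) : ℂ) * powerKernel m (t * x) := by
    intro t ht
    have htx : ‖(t : ℂ) * x‖ < 1 := by
      rw [norm_mul, Complex.norm_real, Real.norm_of_nonneg ht.1.le]
      nlinarith [ht.1, ht.2, norm_nonneg x]
    rw [← ((hasSum_powerKernel_natCast m htx).mul_left _).tsum_eq]
    refine tsum_congr fun n => ?_
    rw [hF]
    simp only
    rw [add_sub_cancel_right, rpow_natCast]
    push_cast
    ring
  rw [setIntegral_congr_fun measurableSet_Ioo hker] at hsum
  have hrep := ((hasSum_powerKernel α hx).mul_left (Gamma β : ℂ)).unique hsum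
  have hbound : ‖∫ t in Ioo (0 : ℝ) 1, (((-log t) ^ (β - 1) : ℝ) : ℂ) * powerKernel m (t * x)‖ₑ
      ≤ ENNReal.ofReal (C₁ * 3 ^ (1 + m : ℝ) * C₂ * ‖1 - x‖ ^ (-(1 + α))) := by
    calc _ ≤ ∫⁻ t in Ioo (0 : ℝ) 1,
          ‖(((-log t) ^ (β - 1) : ℝ) : ℂ) * powerKernel m (t * x)‖ₑ :=
          enorm_integral_le_lintegral_enorm _
      _ ≤ ∫⁻ t in Ioo (0 : ℝ) 1, ENNReal.ofReal (C₁ * 3 ^ (1 + m : ℝ)) *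
          ENNReal.ofReal ((1 - t) ^ (β - 1) * (‖1 - x‖ + (1 - t)) ^ (-(1 + m : ℝ))) := by
          refine setLIntegral_mono' measurableSet_Ioo fun t ht => ?_
          have ht0 := ht.1
          have hd : 0 < 1 - t := by linarith [ht.2]
          have hl : 1 - t ≤ -log t := by linarith [log_le_sub_one_of_pos ht.1]
          have hn : ‖(t : ℂ) * x‖ = t * ‖x‖ := by
            rw [norm_mul, Complex.norm_real, Real.norm_of_nonneg ht.1.le]
          have htx : ‖(t : ℂ) * x‖ ≤ t := by rw [hn]; exact mul_le_of_le_one_right ht0.le hx.le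
          have h3 : 1 - t ≤ ‖1 - t * x‖ := by
            have := norm_sub_norm_le 1 ((t : ℂ) * x)
            rw [norm_one] at this; linarith
          have h4 : ‖1 - x‖ ≤ ‖1 - t * x‖ + (1 - t) := by
            have e : 1 - x = (1 - t * x) - ((1 - t : ℝ) : ℂ) * x := by push_cast; ring
            rw [e]
            refine (norm_sub_le _ _).trans ?_
            gcongr
            rw [norm_mul, Complex.norm_real, Real.norm_of_nonneg hd.le]
            exact mul_le_of_le_one_right hd.le hx.le
          rw [← ofReal_norm, ← ENNReal.ofReal_mul (by positivity), norm_mul, Complex.norm_real,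
            Real.norm_of_nonneg (rpow_nonneg (by linarith) _)]
          refine ENNReal.ofReal_le_ofReal ?_
          calc (-log t) ^ (β - 1) * ‖powerKernel m (t * x)‖
              ≤ (1 - t) ^ (β - 1) * (C₁ * ‖1 - t * x‖ ^ (-(1 + m : ℝ))) := by
                gcongr ?_ * ?_
                · exact rpow_le_rpow_of_nonpos hd hl (by linarith)
                · exact h₁ _ (htx.trans_lt ht.2)
            _ ≤ (1 - t) ^ (β - 1) * (C₁ *
                ((‖1 - x‖ + (1 - t)) / 3) ^ (-(1 + m : ℝ))) := by
                gcongr ?_ * (_ * ?_)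
                exact rpow_le_rpow_of_nonpos (by positivity) (by linarith) (by
                  have : (0 : ℝ) ≤ m := m.cast_nonneg
                  linarith)
            _ = _ := by
                rw [div_rpow (by positivity) (by norm_num), rpow_neg (by norm_num : (0 : ℝ) ≤ 3)]
                field_simp
      _ = ENNReal.ofReal (C₁ * 3 ^ (1 + m : ℝ)) * ∫⁻ t in Ioo (0 : ℝ) 1,
          ENNReal.ofReal ((1 - t) ^ (β - 1) * (‖1 - x‖ + (1 - t)) ^ (-(1 + m : ℝ))) :=
          lintegral_const_mul' _ _ ENNReal.ofReal_ne_top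
      _ ≤ ENNReal.ofReal (C₁ * 3 ^ (1 + m : ℝ)) * ∫⁻ u in Ioi (0 : ℝ),
          ENNReal.ofReal (u ^ (β - 1) * (‖1 - x‖ + u) ^ (-(1 + m : ℝ))) := by
          refine mul_le_mul_right ?_ _
          have hmp : MeasurePreserving (fun t : ℝ => 1 - t) volume volume :=
            Measure.measurePreserving_sub_left volume 1
          have e := hmp.setLIntegral_comp_preimage_emb
            (MeasurableEquiv.subLeft (1 : ℝ)).measurableEmbedding
            (fun u => ENNReal.ofReal (u ^ (β - 1) * (‖1 - x‖ + u) ^ (-(1 + m : ℝ)))) (Iio 1 ∩ Ioi 0)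
          refine le_trans ?_ (lintegral_mono_set (inter_subset_right (s := Iio (1 : ℝ))))
          rw [← e]
          refine lintegral_mono_set fun t ht => ?_
          exact ⟨show 1 - t < 1 by linarith [ht.1], show 0 < 1 - t by linarith [ht.2]⟩
      _ ≤ ENNReal.ofReal (C₁ * 3 ^ (1 + m : ℝ)) *
          ENNReal.ofReal (C₂ * ‖1 - x‖ ^ (β - 1 + 1 - (1 + m))) := by
          exact mul_le_mul_right (h₂ _ hx0) _
      _ = _ := by
          rw [← ENNReal.ofReal_mul (by positivity), hβ]
          congr 1
          rw [show (m : ℝ) - α - 1 + 1 - (1 + m) = -(1 + α) by ring]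
          ring
  rw [← hrep, ← ofReal_norm, ENNReal.ofReal_le_ofReal_iff (by positivity), norm_mul,
    Complex.norm_real, Real.norm_of_nonneg hΓ.le] at hbound
  calc ‖powerKernel α x‖ = (Gamma β)⁻¹ * (Gamma β * ‖powerKernel α x‖) := by field_simp
    _ ≤ (Gamma β)⁻¹ * (C₁ * 3 ^ (1 + m : ℝ) * C₂ * ‖1 - x‖ ^ (-(1 + α))) := by gcongr
    _ = _ := by ring

/-! ### The test functions -/

lemma coeff_eq_of_hasSum {f : ℂ → ℂ} {c : ℕ → ℂ} (hf : Holo f)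
    (h : ∀ z : ℂ, ‖z‖ < 1 → HasSum (fun n => c n * z ^ n) (f z)) (n : ℕ) : coeff f n = c n := by
  have key : ∀ d : ℕ → ℂ, (∀ z : ℂ, ‖z‖ < 1 → HasSum (fun n => d n * z ^ n) (f z)) →
      HasFPowerSeriesAt f (FormalMultilinearSeries.ofScalars ℂ d) 0 := by
    intro d hd
    rw [hasFPowerSeriesAt_iff]
    filter_upwards [Metric.ball_mem_nhds (0 : ℂ) one_pos] with z hz
    rw [mem_ball_zero_iff] at hz
    rw [zero_add]
    refine (hd z hz).congr_fun fun n => ?_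
    rw [FormalMultilinearSeries.coeff_ofScalars, smul_eq_mul, mul_comm]
  have h1 := (key _ fun z hz => hf.hasSum hz).eq_formalMultilinearSeries (key c h)
  have h2 := congrArg (fun p => p.coeff n) h1
  simpa only [FormalMultilinearSeries.coeff_ofScalars] using h2

/-- The square of the Szegő kernel. -/
def szegoSq (w z : ℂ) : ℂ := ((1 - conj w * z) ^ 2)⁻¹

section

variable {w : ℂ}

lemma one_sub_conj_mul_ne_zero (hw : ‖w‖ < 1) {z : ℂ} (hz : ‖z‖ ≤ 1) : 1 - conj w * z ≠ 0 := by
  rw [mul_comm]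
  exact one_sub_mul_ne_zero hz (by rwa [RCLike.norm_conj])

lemma holo_szegoSq (hw : ‖w‖ < 1) : Holo (szegoSq w) := by
  intro z hz
  have h := one_sub_conj_mul_ne_zero hw (mem_unitDisk.1 hz).le
  have : DifferentiableAt ℂ (szegoSq w) z :=
    DifferentiableAt.inv (by fun_prop) (pow_ne_zero 2 h)
  exact this.differentiableWithinAt

lemma hasSum_szegoSq (hw : ‖w‖ < 1) {z : ℂ} (hz : ‖z‖ < 1) :
    HasSum (fun n : ℕ => (((n : ℂ) + 1) * conj w ^ n) * z ^ n) (szegoSq w z) := by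
  have hx : ‖conj w * z‖ < 1 := by
    rw [norm_mul, RCLike.norm_conj]
    nlinarith [norm_nonneg w, norm_nonneg z]
  have h := hasSum_choose_mul_geometric_of_norm_lt_one 1 hx
  rw [one_div] at h
  refine h.congr_fun fun n => ?_
  rw [Nat.choose_one_right, mul_pow]
  push_cast
  ring

lemma fracDeriv_szegoSq (hw : ‖w‖ < 1) (k : ℝ) (z : ℂ) :
    fracDeriv k (szegoSq w) z = powerKernel (k + 1) (conj w * z) := by
  rw [fracDeriv, powerKernel]
  refine tsum_congr fun n => ?_
  rw [coeff_eq_of_hasSum (holo_szegoSq hw) (fun z hz => hasSum_szegoSq hw hz),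
    rpow_add_one (by positivity), mul_pow]
  push_cast
  ring

end

/-- `D^k` of the test function is the power kernel of order `k + 1`, of size `|1 - conj w
z|^(-(k+2))`. The condition `k > τ` says exactly that the Besov weight has exponent above `-1`, and
the disk integral yields `sk + 1 - 2s + 2 - (k+2)s = 3 - 4s`. -/
theorem exists_besovNorm_szegoSq_le {s k : ℝ} (hs : 1 ≤ s) (hk0 : 0 ≤ k) (hk : 2 * (1 - 1 / s) < k) :
    ∃ C : ℝ, 0 < C ∧ ∀ w : ℂ, ‖w‖ < 1 →
      besovNorm s k (szegoSq w) ^ s ≤ ENNReal.ofReal (C * (1 - ‖w‖) ^ (3 - 4 * s)) := by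
  have hs0 : 0 < s := by linarith
  have hb : -1 < s * k + 1 - 2 * s := by
    have : s * (2 * (1 - 1 / s)) < s * k := by gcongr
    have e : s * (2 * (1 - 1 / s)) = 2 * s - 2 := by field_simp
    linarith
  obtain ⟨C₁, hC₁, h₁⟩ := exists_norm_powerKernel_le (α := k + 1) (by linarith)
  obtain ⟨C₂, hC₂, h₂⟩ := exists_lintegral_unitDisk_le (b := s * k + 1 - 2 * s)
    (P := (1 + (k + 1)) * s) hb (by nlinarith)
  refine ⟨C₁ ^ s * C₂, by positivity, fun w hw => ?_⟩
  rw [besovNorm, ← ENNReal.rpow_mul, one_div_mul_cancel hs0.ne', ENNReal.rpow_one]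
  calc ∫⁻ z in unitDisk, ENNReal.ofReal (‖fracDeriv k (szegoSq w) z‖ ^ s *
        (1 - ‖z‖) ^ (s * k + 1 - 2 * s))
      ≤ ∫⁻ z in unitDisk, ENNReal.ofReal (C₁ ^ s) * ENNReal.ofReal (‖z‖⁻¹ *
        (1 - ‖z‖) ^ (s * k + 1 - 2 * s) * ‖1 - w * conj z‖ ^ (-((1 + (k + 1)) * s))) := by
        refine lintegral_mono_ae ?_
        filter_upwards [ae_mem_unitDisk_ne_zero] with z hz
        have hz1 := mem_unitDisk.1 hz.1
        have hz0 : 0 < ‖z‖ := norm_pos_iff.2 hz.2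
        have hd : 0 < 1 - ‖z‖ := by linarith
        rw [← ENNReal.ofReal_mul (by positivity)]
        refine ENNReal.ofReal_le_ofReal ?_
        have hx : ‖conj w * z‖ < 1 := by
          rw [norm_mul, RCLike.norm_conj]
          nlinarith [norm_nonneg w, norm_nonneg z]
        have e : ‖1 - w * conj z‖ = ‖1 - conj w * z‖ := by
          rw [← RCLike.norm_conj]; simp
        rw [fracDeriv_szegoSq hw, e, ← neg_mul, rpow_mul (norm_nonneg _)]
        calc ‖powerKernel (k + 1) (conj w * z)‖ ^ s * (1 - ‖z‖) ^ (s * k + 1 - 2 * s)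
            ≤ (C₁ * ‖1 - conj w * z‖ ^ (-(1 + (k + 1)))) ^ s *
              (1 - ‖z‖) ^ (s * k + 1 - 2 * s) := by
              gcongr
              exact h₁ _ hx
          _ = C₁ ^ s * (1 * (1 - ‖z‖) ^ (s * k + 1 - 2 * s) *
              (‖1 - conj w * z‖ ^ (-(1 + (k + 1)))) ^ s) := by
              rw [mul_rpow hC₁.le (by positivity)]; ring
          _ ≤ _ := by
              gcongr
              exact (one_le_inv₀ hz0).2 hz1.le
    _ = ENNReal.ofReal (C₁ ^ s) * ∫⁻ z in unitDisk, ENNReal.ofReal (‖z‖⁻¹ *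
        (1 - ‖z‖) ^ (s * k + 1 - 2 * s) * ‖1 - w * conj z‖ ^ (-((1 + (k + 1)) * s))) :=
        lintegral_const_mul' _ _ ENNReal.ofReal_ne_top
    _ ≤ ENNReal.ofReal (C₁ ^ s) * ENNReal.ofReal
        (C₂ * (1 - ‖w‖) ^ (s * k + 1 - 2 * s + 2 - (1 + (k + 1)) * s)) :=
        mul_le_mul_right (h₂ w hw) _
    _ = _ := by
        rw [← ENNReal.ofReal_mul (by positivity)]
        congr 1
        rw [show s * k + 1 - 2 * s + 2 - (1 + (k + 1)) * s = 3 - 4 * s by ring]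
        ring

/-! ### Necessity of boundedness of the symbol -/

section

variable {w : ℂ}

lemma continuousAt_szegoSq (hw : ‖w‖ < 1) (θ : ℝ) : ContinuousAt (szegoSq w) (circ θ) :=
  ContinuousAt.inv₀ (by fun_prop)
    (pow_ne_zero 2 (one_sub_conj_mul_ne_zero hw (norm_circ θ).le))

lemma inToeplitzDomain_szegoSq (hw : ‖w‖ < 1) {φ : ℂ → ℂ} (hφ : MemHardy 1 φ) :
    InToeplitzDomain (conjSymbol φ) (szegoSq w) := by
  have h1 : Continuous fun θ => szegoSq w (circ θ) := continuous_iff_continuousAt.2 fun θ =>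
    ContinuousAt.comp (g := szegoSq w) (f := circ) (continuousAt_szegoSq hw θ)
      continuous_circ.continuousAt
  have h2 : Integrable (conjSymbol φ) arc :=
    (integrable_norm_iff (Complex.continuous_conj.comp_aestronglyMeasurable
      hφ.integrable_bdry.1)).1 (by simpa only [Function.comp_apply, RCLike.norm_conj]
        using hφ.integrable_bdry.norm)
  have h3 : ∀ θ, ‖szegoSq w (circ θ)‖ ≤ ((1 - ‖w‖)⁻¹) ^ 2 := fun θ => by
    rw [szegoSq, ← inv_pow, norm_pow]
    have := norm_inv_one_sub_mul_le (w := conj w) (ξ := circ θ) (by rwa [RCLike.norm_conj])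
      (norm_circ θ).le
    rw [RCLike.norm_conj] at this
    gcongr
  have h4 : (fun θ => bdry (szegoSq w) θ * conjSymbol φ θ)
      = fun θ => conjSymbol φ θ * szegoSq w (circ θ) := by
    ext θ
    rw [bdry_of_continuousAt (continuousAt_szegoSq hw θ), mul_comm]
  rw [InToeplitzDomain, h4]
  exact h2.mul_bdd h1.aestronglyMeasurable (ae_of_all _ h3)

/-- A linear combination of the Szegő kernel and its square. -/
def szegoComb (A B w z : ℂ) : ℂ := A * (1 - z * conj w)⁻¹ + B * ((1 - z * conj w) ^ 2)⁻¹

lemma toeplitz_szegoSq (hw : ‖w‖ < 1) {φ : ℂ → ℂ} (hφ : MemHardy 1 φ) {z : ℂ} (hz : ‖z‖ < 1) :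
    toeplitz (conjSymbol φ) (szegoSq w) z
      = szegoComb (conj (w * deriv φ w)) (conj (φ w)) w z := by
  have h := congrArg conj
    (hφ.integral_bdry_mul_szego_sq hw (z := conj z) (by rwa [RCLike.norm_conj]))
  rw [← integral_conj] at h
  simp only [map_mul, map_inv₀, map_sub, map_one, map_pow, map_add, Complex.conj_conj,
    Complex.conj_ofReal, map_ofNat] at h
  have e : ∫ θ, bdry (szegoSq w) θ * conjSymbol φ θ / (1 - conj (circ θ) * z) ∂arc
      = ∫ θ, conj (bdry φ θ) * ((1 - z * conj (circ θ))⁻¹ *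
        ((1 - conj w * circ θ) ^ 2)⁻¹) ∂arc := by
    refine integral_congr_ae (ae_of_all _ fun θ => ?_)
    simp only
    rw [bdry_of_continuousAt (continuousAt_szegoSq hw θ), conjSymbol, szegoSq, div_eq_mul_inv,
      mul_comm (conj (circ θ))]
    ring
  rw [toeplitz, e, h, szegoComb, map_mul]
  field_simp

lemma continuousAt_szegoComb (hw : ‖w‖ < 1) (A B : ℂ) (θ : ℝ) :
    ContinuousAt (szegoComb A B w) (circ θ) := by
  have h : 1 - circ θ * conj w ≠ 0 := norm_pos_iff.1 (norm_one_sub_circ_pos hw θ)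
  have h1 : ContinuousAt (fun z => 1 - z * conj w) (circ θ) := by fun_prop
  exact (continuousAt_const.mul (h1.inv₀ h)).add
    (continuousAt_const.mul ((h1.pow 2).inv₀ (pow_ne_zero 2 h)))

/-- A dual test function vanishing at `0` and at `w`. -/
def dualTest (w z : ℂ) : ℂ := z * (z - w) * ((1 - conj w * z) ^ 4)⁻¹

lemma norm_dualTest_circ (w : ℂ) (θ : ℝ) :
    ‖dualTest w (circ θ)‖ = ‖1 - circ θ * conj w‖ * (‖1 - circ θ * conj w‖ ^ 4)⁻¹ := by
  rw [dualTest, norm_mul, norm_mul, norm_circ, one_mul, norm_inv, norm_pow,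
    norm_sub_eq_norm_one_sub (norm_circ θ), mul_comm (conj w)]

lemma differentiableOn_dualTest (w : ℂ) :
    DifferentiableOn ℂ (dualTest w) {z | 1 - conj w * z ≠ 0} := by
  intro z hz
  have h1 : DifferentiableAt ℂ (fun u => 1 - conj w * u) z := by fun_prop
  have h2 : DifferentiableAt ℂ (fun u => u * (u - w)) z := by fun_prop
  exact (h2.mul ((h1.pow 4).inv (pow_ne_zero 4 hz))).differentiableWithinAt

lemma closedBall_subset_setOf (hw : ‖w‖ < 1) :
    Metric.closedBall 0 1 ⊆ {z | 1 - conj w * z ≠ 0} := fun z hz =>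
  one_sub_conj_mul_ne_zero hw (by simpa using hz)

lemma deriv_mul_dualTest (hw : ‖w‖ < 1) :
    deriv (fun z => z * dualTest w z) w = w ^ 2 * ((1 - conj w * w) ^ 4)⁻¹ := by
  have hne : 1 - conj w * w ≠ 0 := one_sub_conj_mul_ne_zero hw hw.le
  have e : (fun z => z * dualTest w z)
      = fun z => (z - w) * (z ^ 2 * ((1 - conj w * z) ^ 4)⁻¹) := by
    ext z; rw [dualTest]; ring
  have h1 : DifferentiableAt ℂ (fun z => z ^ 2 * ((1 - conj w * z) ^ 4)⁻¹) w :=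
    DifferentiableAt.mul (by fun_prop) (DifferentiableAt.inv (by fun_prop) (pow_ne_zero 4 hne))
  have h2 := ((hasDerivAt_id w).sub_const w).mul h1.hasDerivAt
  rw [e]
  refine (h2.congr_deriv ?_).deriv
  simp

/-- Conjugated kernels reproduce the dual function: the constant `c` sees its value at `0`, `A` its
value at `w`, both zero. Only `B` survives, through the derivative of `z * dualTest w z` at `w`. -/
lemma integral_dualTest_mul_conj (hw : ‖w‖ < 1) (A B c : ℂ) :
    ∫ θ, dualTest w (circ θ) * conj (szegoComb A B w (circ θ) - c) ∂arc
      = 2 * π * (conj B * (w ^ 2 * ((1 - conj w * w) ^ 4)⁻¹)) := by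
  have hU : IsOpen {z : ℂ | 1 - conj w * z ≠ 0} := isOpen_ne_fun (by fun_prop) (by fun_prop)
  have hd : DiffContOnCl ℂ (dualTest w) (Metric.ball 0 1) := by
    refine DifferentiableOn.diffContOnCl ((differentiableOn_dualTest w).mono ?_)
    rw [closure_ball _ one_ne_zero]
    exact closedBall_subset_setOf hw
  have i0 := integral_cauchy hd (w := 0) (by simp)
  have i1 := integral_cauchy hd hw
  have i2 := integral_cauchy_sq hU (closedBall_subset_setOf hw) (differentiableOn_dualTest w) hw
  rw [deriv_mul_dualTest hw] at i2
  have hψ : Continuous fun θ => dualTest w (circ θ) := by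
    refine (differentiableOn_dualTest w).continuousOn.comp_continuous continuous_circ fun θ => ?_
    exact closedBall_subset_setOf hw (by simp [norm_circ])
  have hk : Continuous fun θ => 1 - w * conj (circ θ) :=
    continuous_const.sub (continuous_const.mul (Complex.continuous_conj.comp continuous_circ))
  have hk0 := one_sub_mul_conj_circ_ne_zero hw
  have c1 : Integrable (fun θ => dualTest w (circ θ) / (1 - w * conj (circ θ))) arc :=
    integrable_arc_of_continuous (hψ.div hk hk0)
  have c2 : Integrable (fun θ => dualTest w (circ θ) / (1 - w * conj (circ θ)) ^ 2) arc :=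
    integrable_arc_of_continuous (hψ.div (hk.pow 2) fun θ => pow_ne_zero 2 (hk0 θ))
  have c0 : Integrable (fun θ => dualTest w (circ θ)) arc := integrable_arc_of_continuous hψ
  have e : ∀ θ, dualTest w (circ θ) * conj (szegoComb A B w (circ θ) - c)
      = conj A * (dualTest w (circ θ) / (1 - w * conj (circ θ))) +
        conj B * (dualTest w (circ θ) / (1 - w * conj (circ θ)) ^ 2) -
        conj c * dualTest w (circ θ) := fun θ => by
    simp only [szegoComb, map_sub, map_add, map_mul, map_inv₀, map_pow, map_one, Complex.conj_conj]
    rw [mul_comm (conj (circ θ)) w]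
    ring
  simp only [e]
  have c3 : Integrable (fun θ => conj A * (dualTest w (circ θ) / (1 - w * conj (circ θ))) +
      conj B * (dualTest w (circ θ) / (1 - w * conj (circ θ)) ^ 2)) arc :=
    (c1.const_mul _).add (c2.const_mul _)
  rw [integral_sub c3 (c0.const_mul _),
    integral_add (c1.const_mul _) (c2.const_mul _), integral_const_mul, integral_const_mul,
    integral_const_mul, i1, i2]
  simp only [zero_mul, sub_zero, div_one] at i0
  rw [i0]
  simp only [dualTest, sub_self, mul_zero, zero_mul]
  ring

/-- A substitute for Hölder that includes `s = 1`. Below the threshold `X = δ^(-2)` the first term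
suffices. Above it, `s ≥ 1` gives `X ≤ X^s δ^(2s-2)`, while `s ≤ 2` and `L ≥ δ` give `L^(-3) ≤
L^(-(2s-1)) δ^(2s-4)`. -/
lemma mul_rpow_neg_three_le {X L δ s : ℝ} (hs1 : 1 ≤ s) (hs2 : s ≤ 2) (hX : 0 ≤ X) (hδ : 0 < δ)
    (hL : δ ≤ L) : X * L ^ (-3 : ℝ)
      ≤ δ ^ (-2 : ℝ) * L ^ (-3 : ℝ) + δ ^ (4 * s - 6) * (X ^ s / L ^ (2 * s - 1)) := by
  have hL0 := hδ.trans_le hL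
  rcases le_total X (δ ^ (-2 : ℝ)) with h | h
  · have : 0 ≤ δ ^ (4 * s - 6) * (X ^ s / L ^ (2 * s - 1)) := by positivity
    have := mul_le_mul_of_nonneg_right h (rpow_nonneg hL0.le (-3))
    linarith
  · have hX0 : 0 < X := lt_of_lt_of_le (by positivity) h
    have h1 : X ≤ X ^ s * δ ^ (2 * s - 2) := by
      have e1 : X ^ s * X ^ (1 - s) = X := by
        rw [← rpow_add hX0]; simp
      have e2 : X ^ (1 - s) ≤ (δ ^ (-2 : ℝ)) ^ (1 - s) :=
        rpow_le_rpow_of_nonpos (by positivity) h (by linarith)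
      rw [← rpow_mul hδ.le, show -2 * (1 - s) = 2 * s - 2 by ring] at e2
      calc X = X ^ s * X ^ (1 - s) := e1.symm
        _ ≤ _ := by gcongr
    have h2 : L ^ (-3 : ℝ) ≤ L ^ (-(2 * s - 1)) * δ ^ (2 * s - 4) := by
      rw [show (-3 : ℝ) = -(2 * s - 1) + (2 * s - 4) by ring, rpow_add hL0]
      gcongr ?_ * ?_
      exact rpow_le_rpow_of_nonpos hδ hL (by linarith)
    calc X * L ^ (-3 : ℝ)
        ≤ X ^ s * δ ^ (2 * s - 2) * (L ^ (-(2 * s - 1)) * δ ^ (2 * s - 4)) := by gcongr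
      _ = δ ^ (4 * s - 6) * (X ^ s / L ^ (2 * s - 1)) := by
          rw [show 4 * s - 6 = (2 * s - 2) + (2 * s - 4) by ring, rpow_add hδ, rpow_neg hL0.le]
          ring
      _ ≤ _ := le_add_of_nonneg_left (by positivity)

end

section

variable {s k : ℝ} {φ : ℂ → ℂ}

/-- The key lower bound: the oscillation of `T f_w` controls the value of the symbol at `w`. -/
lemma ofReal_norm_symbol_le (hφ : MemHardy 1 φ) {w : ℂ} (hw : ‖w‖ < 1) :
    ENNReal.ofReal (2 * π * (‖φ w‖ * (‖w‖ ^ 2 * ((1 - ‖w‖ ^ 2) ^ 4)⁻¹)))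
      ≤ ∫⁻ θ, ENNReal.ofReal (‖bdry (toeplitz (conjSymbol φ) (szegoSq w)) θ -
          toeplitz (conjSymbol φ) (szegoSq w) w‖ * ‖1 - circ θ * conj w‖ ^ (-3 : ℝ)) ∂arc := by
  set F := toeplitz (conjSymbol φ) (szegoSq w) with hF
  set A := conj (w * deriv φ w) with hA
  set B := conj (φ w) with hB
  have hFG : ∀ z ∈ unitDisk, F z = szegoComb A B w z :=
    fun z hz => toeplitz_szegoSq hw hφ (mem_unitDisk.1 hz)
  have hbd : ∀ θ, bdry F θ = szegoComb A B w (circ θ) := fun θ => by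
    rw [bdry_congr hFG, bdry_of_continuousAt (continuousAt_szegoComb hw A B θ)]
  have h1 := integral_dualTest_mul_conj hw A B (F w)
  have h2 : ‖(2 * π * (conj B * (w ^ 2 * ((1 - conj w * w) ^ 4)⁻¹)) : ℂ)‖
      = 2 * π * (‖φ w‖ * (‖w‖ ^ 2 * ((1 - ‖w‖ ^ 2) ^ 4)⁻¹)) := by
    have e : 1 - conj w * w = ((1 - ‖w‖ ^ 2 : ℝ) : ℂ) := by
      rw [mul_comm, Complex.mul_conj, Complex.normSq_eq_norm_sq]; push_cast; ring
    have h0 : 0 ≤ 1 - ‖w‖ ^ 2 := by nlinarith [norm_nonneg w]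
    rw [e, hB, Complex.conj_conj]
    simp only [norm_mul, norm_inv, norm_pow, Complex.norm_real, Real.norm_of_nonneg h0,
      Real.norm_of_nonneg pi_pos.le, Complex.norm_ofNat]
  rw [← h2, ← h1, ofReal_norm]
  refine (enorm_integral_le_lintegral_enorm _).trans (le_of_eq (lintegral_congr fun θ => ?_))
  have hL := norm_one_sub_circ_pos hw θ
  rw [hbd, ← ofReal_norm, norm_mul, RCLike.norm_conj, norm_dualTest_circ, mul_comm]
  congr 2
  rw [show (-3 : ℝ) = ((-3 : ℤ) : ℝ) by norm_num, rpow_intCast]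
  field_simp

/-- The oscillation of `T f_w` against `L^(-3)` is at least a multiple of `|φ(w)| |w|²
(1-|w|²)^(-4)`. Boundedness of `T` and the size of `f_w` bound it above by a multiple of `δ^(-4)`,
with `δ = 1 - |w|`, so the powers cancel. -/
theorem memHardyInf_of_toeplitzBounded (hs1 : 1 ≤ s) (hs2 : s ≤ 2) (hk : 2 * (1 - 1 / s) < k)
    (hφ : MemHardy 1 φ) (hT : ToeplitzBounded s k (2 * s - 1) (conjSymbol φ)) :
    MemHardyInf φ := by
  have hs0 : 0 < s := by linarith
  have hk0 : 0 ≤ k := by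
    have : 1 / s ≤ 1 := by rw [div_le_one hs0]; exact hs1
    linarith
  obtain ⟨C, hC⟩ := hT
  obtain ⟨C₁, hC₁, h₁⟩ := exists_besovNorm_szegoSq_le hs1 hk0 hk
  obtain ⟨C₂, hC₂, h₂⟩ := exists_lintegral_arc_rpow_le (s := 3) (by norm_num)
  set K : ℝ := C₂ + (C : ℝ) ^ s * C₁ with hK
  -- The `16` comes from `(1 - ‖w‖²)^4 ≤ (2δ)^4`.
  have main : ∀ w : ℂ, ‖w‖ < 1 → ‖φ w‖ * ‖w‖ ^ 2 ≤ 16 * K := by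
    intro w hw
    set δ := 1 - ‖w‖ with hδ
    have hδ0 : 0 < δ := by rw [hδ]; linarith
    have hB : MemBesov s k (szegoSq w) := ⟨holo_szegoSq hw,
      (ENNReal.rpow_lt_top_iff_of_pos hs0).1 ((h₁ w hw).trans_lt ENNReal.ofReal_lt_top)⟩
    have hb := (hC _ hB (inToeplitzDomain_szegoSq hw hφ)).2
    have hlow := ofReal_norm_symbol_le hφ hw
    set F := toeplitz (conjSymbol φ) (szegoSq w) with hF
    set I := ∫⁻ θ, ENNReal.ofReal (‖bdry F θ - F w‖ ^ s / ‖1 - circ θ * conj w‖ ^ (2 * s - 1)) ∂arc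
      with hI
    have hw2 : δ ≤ 1 - ‖w‖ ^ 2 := by rw [hδ]; nlinarith [norm_nonneg w]
    have hw3 : 1 - ‖w‖ ^ 2 ≤ 2 * δ := by rw [hδ]; nlinarith [norm_nonneg w]
    have hI1 : I * ENNReal.ofReal δ ≤ ENNReal.ofReal ((C : ℝ) ^ s * (C₁ * δ ^ (3 - 4 * s))) := by
      have h3 : (I * ENNReal.ofReal (1 - ‖w‖ ^ 2)) ^ (1 / s) ≤ bmoaNorm s (2 * s - 1) F :=
        le_iSup₂ (f := fun (z : ℂ) (_ : z ∈ unitDisk) =>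
          ((∫⁻ θ, ENNReal.ofReal (‖bdry F θ - F z‖ ^ s / ‖1 - circ θ * conj z‖ ^ (2 * s - 1)) ∂arc)
            * ENNReal.ofReal (1 - ‖z‖ ^ 2)) ^ (1 / s)) w (mem_unitDisk.2 hw)
      have h4 := ENNReal.rpow_le_rpow (h3.trans hb) hs0.le
      rw [← ENNReal.rpow_mul, one_div_mul_cancel hs0.ne', ENNReal.rpow_one,
        ENNReal.mul_rpow_of_nonneg _ _ hs0.le] at h4
      calc I * ENNReal.ofReal δ ≤ I * ENNReal.ofReal (1 - ‖w‖ ^ 2) := by gcongr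
        _ ≤ (C : ℝ≥0∞) ^ s * besovNorm s k (szegoSq w) ^ s := h4
        _ ≤ (C : ℝ≥0∞) ^ s * ENNReal.ofReal (C₁ * δ ^ (3 - 4 * s)) := by gcongr; exact h₁ w hw
        _ = _ := by
            rw [ENNReal.ofReal_mul (p := (C : ℝ) ^ s) (by positivity),
              ← ENNReal.ofReal_rpow_of_nonneg C.coe_nonneg hs0.le,
              ENNReal.ofReal_coe_nnreal]
    have hI2 : I ≤ ENNReal.ofReal ((C : ℝ) ^ s * C₁ * δ ^ (2 - 4 * s)) := by
      calc I = I * ENNReal.ofReal δ * ENNReal.ofReal δ⁻¹ := by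
            rw [mul_assoc, ← ENNReal.ofReal_mul hδ0.le, mul_inv_cancel₀ hδ0.ne',
              ENNReal.ofReal_one, mul_one]
        _ ≤ ENNReal.ofReal ((C : ℝ) ^ s * (C₁ * δ ^ (3 - 4 * s))) * ENNReal.ofReal δ⁻¹ := by gcongr
        _ = _ := by
            rw [← ENNReal.ofReal_mul (by positivity), ← rpow_neg_one δ]
            congr 1
            rw [show 2 - 4 * s = 3 - 4 * s + -1 by ring, rpow_add hδ0]
            ring
    have hup : ∫⁻ θ, ENNReal.ofReal (‖bdry F θ - F w‖ * ‖1 - circ θ * conj w‖ ^ (-3 : ℝ)) ∂arc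
        ≤ ENNReal.ofReal (K * δ ^ (-4 : ℝ)) := by
      calc _ ≤ ∫⁻ θ, (ENNReal.ofReal (δ ^ (-2 : ℝ)) *
              ENNReal.ofReal (‖1 - circ θ * conj w‖ ^ (-3 : ℝ)) +
            ENNReal.ofReal (δ ^ (4 * s - 6)) * ENNReal.ofReal
              (‖bdry F θ - F w‖ ^ s / ‖1 - circ θ * conj w‖ ^ (2 * s - 1))) ∂arc := by
            refine lintegral_mono fun θ => ?_
            rw [← ENNReal.ofReal_mul (by positivity), ← ENNReal.ofReal_mul (by positivity),
              ← ENNReal.ofReal_add (by positivity) (by positivity)]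
            exact ENNReal.ofReal_le_ofReal (mul_rpow_neg_three_le hs1 hs2 (norm_nonneg _) hδ0
              (one_sub_norm_le w θ))
        _ = ENNReal.ofReal (δ ^ (-2 : ℝ)) *
              ∫⁻ θ, ENNReal.ofReal (‖1 - circ θ * conj w‖ ^ (-3 : ℝ)) ∂arc +
            ENNReal.ofReal (δ ^ (4 * s - 6)) * I := by
            rw [lintegral_add_left, lintegral_const_mul' _ _ ENNReal.ofReal_ne_top,
              lintegral_const_mul' _ _ ENNReal.ofReal_ne_top]
            have : Measurable fun θ => ‖1 - circ θ * conj w‖ :=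
              (measurable_const.sub (measurable_circ.mul_const _)).norm
            exact (ENNReal.measurable_ofReal.comp (this.pow_const _)).const_mul _
        _ ≤ ENNReal.ofReal (δ ^ (-2 : ℝ)) * ENNReal.ofReal (C₂ * δ ^ (1 - 3 : ℝ)) +
            ENNReal.ofReal (δ ^ (4 * s - 6)) *
              ENNReal.ofReal ((C : ℝ) ^ s * C₁ * δ ^ (2 - 4 * s)) := by
            gcongr
            exact h₂ w hw
        _ = _ := by
            rw [← ENNReal.ofReal_mul (by positivity), ← ENNReal.ofReal_mul (by positivity),
              ← ENNReal.ofReal_add (by positivity) (by positivity)]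
            congr 1
            have e1 : δ ^ (-4 : ℝ) = δ ^ (-2 : ℝ) * δ ^ (1 - 3 : ℝ) := by
              rw [← rpow_add hδ0]; norm_num
            have e2 : δ ^ (-4 : ℝ) = δ ^ (4 * s - 6) * δ ^ (2 - 4 * s) := by
              rw [← rpow_add hδ0]; ring_nf
            rw [hK, add_mul]
            nth_rw 1 [e1]
            rw [e2]
            ring
    have hfin := hlow.trans hup
    have hK0 : 0 ≤ K := by rw [hK]; positivity
    rw [ENNReal.ofReal_le_ofReal_iff (by positivity)] at hfin
    have e4 : δ ^ (-4 : ℝ) = (δ ^ 4)⁻¹ := by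
      rw [rpow_neg hδ0.le]; norm_cast
    rw [e4] at hfin
    have hw0 : 0 < 1 - ‖w‖ ^ 2 := hδ0.trans_le hw2
    have h5 : (1 - ‖w‖ ^ 2) ^ 4 ≤ 16 * δ ^ 4 := by
      calc (1 - ‖w‖ ^ 2) ^ 4 ≤ (2 * δ) ^ 4 := by gcongr
        _ = _ := by ring
    calc ‖φ w‖ * ‖w‖ ^ 2 = (‖φ w‖ * (‖w‖ ^ 2 * ((1 - ‖w‖ ^ 2) ^ 4)⁻¹)) * (1 - ‖w‖ ^ 2) ^ 4 := by
          field_simp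
      _ ≤ (2 * π * (‖φ w‖ * (‖w‖ ^ 2 * ((1 - ‖w‖ ^ 2) ^ 4)⁻¹))) * (1 - ‖w‖ ^ 2) ^ 4 := by
          refine mul_le_mul_of_nonneg_right (le_mul_of_one_le_left (by positivity) ?_)
            (by positivity)
          linarith [pi_gt_three]
      _ ≤ K * (δ ^ 4)⁻¹ * (16 * δ ^ 4) := by gcongr
      _ = 16 * K := by field_simp
  -- The factor `‖w‖²` is useless near the origin, where compactness bounds `φ`; for `‖z‖ ≥ 1/2` it
  -- costs a factor `4`, whence `64 = 4 · 16`.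
  obtain ⟨M, hM⟩ := (isCompact_closedBall (0 : ℂ) (1 / 2)).exists_bound_of_continuousOn
    (hφ.1.continuousOn.mono (Metric.closedBall_subset_ball (by norm_num : (1 / 2 : ℝ) < 1)))
  refine ⟨hφ.1, max M (64 * K), fun z hz => ?_⟩
  rcases le_total ‖z‖ (1 / 2) with h | h
  · exact (hM z (by simpa using h)).trans (le_max_left _ _)
  · refine le_trans ?_ (le_max_right _ _)
    have h6 := main z (mem_unitDisk.1 hz)
    have h7 : (1 / 4 : ℝ) ≤ ‖z‖ ^ 2 := by nlinarith
    nlinarith [norm_nonneg (φ z)]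

end

end BergmanBesov

end

theorem theorem1 (s q τ k : ℝ) (hs1 : 1 ≤ s) (hs2 : s ≤ 2)
    (hq : q = 2 * s - 1) (hτ : τ = 2 * (1 - 1 / s)) (hk : τ < k)
    (φ : ℂ → ℂ) (hφ : BergmanBesov.MemHardy 1 φ) :
    (1 < s →
      (BergmanBesov.ToeplitzBounded s k q (BergmanBesov.conjSymbol φ) ↔
        BergmanBesov.MemHardyInf φ) ∧
      (BergmanBesov.MemHardyInf φ →
        ∀ f : ℂ → ℂ, BergmanBesov.MemBesov s k f →
          BergmanBesov.InToeplitzDomain (BergmanBesov.conjSymbol φ) f)) ∧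
    (s = 1 →
      BergmanBesov.ToeplitzBounded s k q (BergmanBesov.conjSymbol φ) →
        BergmanBesov.MemHardyInf φ) := by
  subst hq hτ
  have hk0 : 0 < k := by
    refine lt_of_le_of_lt ?_ hk
    have : 1 / s ≤ 1 := by rw [div_le_one (by linarith)]; exact hs1
    linarith
  have hnec := fun h => BergmanBesov.memHardyInf_of_toeplitzBounded hs1 hs2 hk hφ h
  exact ⟨fun hs => ⟨⟨hnec, BergmanBesov.toeplitzBounded_of_memHardyInf hs hs2 hk0 hφ⟩,
    fun hb f hf => BergmanBesov.inToeplitzDomain_of_memBesov hs hk0 hφ hb hf⟩, fun _ h => hnec h⟩
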